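/- **Setting.** Let $j$ be the anti-holomorphic involution $[z_0:z_1:z_2:z_3]\mapsto[-\bar z_1:\bar z_0:-\bar z_3:\bar z_2]$ of $\mathbb{CP}^3$, let $\pi:\mathbb{CP}^3\to\mathbb{HP}^1\simeq S^4$, $[z]\mapsto[z_0+jz_1:z_2+jz_3]$, be the twistor projection onto the round 4-sphere, where $[q_0:q_1]\in\mathbb{HP}^1$ (right quaternionic lines) corresponds to $(2q_1\bar q_0,\ |q_0|^2-|q_1|^2)/(|q_0|^2+|q_1|^2)\in S^4\subset\mathbb H\times\mathbb R$. Let $\Sigma=\{[q_0:q_1]: |q_0|=|q_1|\}\subset S^4$ be the distinguished round 3-sphere, and $Q^{2,2}=\pi^{-1}(\Sigma)=\{|z_0|^2+|z_1|^2=|z_2|^2+|z_3|^2\}$. Let $\mathcal G_{j,Q^{2,2}}\subset \mathrm{PGL}(4,\mathbb C)$ be the group of all projective transformations that commute with $j$ and map $Q^{2,2}$ onto itself. A smooth $j$-invariant quadric is a set $\mathcal S=\{[z]: z^TQz=0\}$ with $Q$ complex symmetric, $\det Q\ne0$ and $j(\mathcal S)=\mathcal S$; its discriminant circle is $D(\mathcal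 S)=\{p\in S^4: \pi^{-1}(p)\cap\mathcal S\text{ does not consist of exactly two points}\}$. Two pairs of subsets of $S^4$ are conformally equivalent if some smooth conformal diffeomorphism of the round $S^4$ (orientation preserving or reversing) maps one pair to the other. Identify $S^4=\mathbb H\cup\{\infty\}$ via $q=q_1q_0^{-1}$, so that $\Sigma=\{|q|=1\}$, and let $\mathbb C\subset\mathbb H$. The inversive distance is $$I(D,\Sigma)=\frac{|a^2-r^2-1|}{2r}$$ whenever the pair $(D,\Sigma)$ is conformally equivalent to $(\{z\in\mathbb C:|z-a|=r\},\Sigma)$ with $a\ge0$, $r>0$. **Theorem.** For smooth $j$-invariant quadrics $\mathcal S,\mathcal S'\subset\mathbb{CP}^3$, the following are equivalent: (i) $\mathcal S$ and $\mathcal S'$ are $\mathcal G_{j,Q^{2,2}}$-equivalent; (ii) the pairs $(D(\mathcal S),\Sigma)$ and $(D(\mathcal S'),\Sigma)$ are conformally equivalent in $S^4$. Moreover: (a) the smooth $j$-invariant quadrics with $D(\mathcal S)\subset\Sigma$ form a single $\mathcal G_{j,Q^{2,2}}$-orbit; (b) for every smooth $j$-invariant quadric $\mathcal S$, the number $I(D(\mathcal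 S),\Sigma)$ is well defined (a normalization as above exists, and all normalizations give the same value); two smooth $j$-invariant quadrics with $D(\mathcal S),D(\mathcal S')\not\subset\Sigma$ are $\mathcal G_{j,Q^{2,2}}$-equivalent if and only if $I(D(\mathcal S),\Sigma)=I(D(\mathcal S'),\Sigma)$; and the set of values of $I(D(\mathcal S),\Sigma)$ over all smooth $j$-invariant quadrics with $D(\mathcal S)\not\subset\Sigma$ is exactly $[0,\infty)$. Thus the orbits of these quadrics are parametrized by $I\in[0,\infty)$. -/

import Mathlib

open scoped Manifold ContDiff Pointwise MatrixGroups Quaternion ComplexConjugate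
open scoped LinearAlgebra.Projectivization

namespace TwistorQuadrics

noncomputable section

/-! ### Complex projective space, the involution `j`, and quadrics -/

/-- Complex projective 3-space. -/
abbrev CP3 : Type := ℙ ℂ (Fin 4 → ℂ)

/-- The anti-linear map `J(z₀,z₁,z₂,z₃) = (-z̄₁, z̄₀, -z̄₃, z̄₂)` on `ℂ⁴`. -/
def J : (Fin 4 → ℂ) →ₛₗ[starRingEnd ℂ] (Fin 4 → ℂ) where
  toFun z := ![-conj (z 1), conj (z 0), -conj (z 3), conj (z 2)]
  map_add' x y := by
    ext i; fin_cases i <;> simp <;> ring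
  map_smul' c x := by
    ext i; fin_cases i <;> simp

theorem J_J (z : Fin 4 → ℂ) : J (J z) = -z := by
  ext i; fin_cases i <;> simp [J]

theorem J_injective : Function.Injective J := fun x y h => by
  have := congrArg J h
  rwa [J_J, J_J, neg_inj] at this

/-- The anti-holomorphic involution `j` of `ℂP³` induced by `J`. -/
def j : CP3 → CP3 := Projectivization.map J J_injective

/-- The quadric `{[z] | zᵀ Q z = 0}` in `ℂP³`. -/
def quadric (Q : Matrix (Fin 4) (Fin 4) ℂ) : Set CP3 :=
  {x | x.rep ⬝ᵥ Q.mulVec x.rep = 0}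

/-- The defining condition of `quadric Q` may be tested on any representative. -/
theorem mk_mem_quadric (Q : Matrix (Fin 4) (Fin 4) ℂ) (z : Fin 4 → ℂ) (hz : z ≠ 0) :
    Projectivization.mk ℂ z hz ∈ quadric Q ↔ z ⬝ᵥ Q.mulVec z = 0 := by
  obtain ⟨a, ha⟩ := Projectivization.exists_smul_eq_mk_rep ℂ z hz
  simp only [quadric, Set.mem_ofPred_eq, ← ha, Units.smul_def, Matrix.mulVec_smul,
    smul_dotProduct, dotProduct_smul, smul_eq_mul]
  simp

/-- The smooth `j`-invariant quadrics in `ℂP³`: zero sets of nondegenerate symmetric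
matrices that are mapped to themselves by `j`. -/
def smoothJInvariantQuadrics : Set (Set CP3) :=
  {S | (∃ Q : Matrix (Fin 4) (Fin 4) ℂ, Q.IsSymm ∧ Q.det ≠ 0 ∧ S = quadric Q) ∧ j '' S = S}

/-! ### The hyperquadric `Q^{2,2}` and its twistor-compatible symmetry group -/

/-- The real hyperquadric `|z₀|² + |z₁|² = |z₂|² + |z₃|²` in `ℂP³`. -/
def Q22 : Set CP3 :=
  {x | ‖x.rep 0‖ ^ 2 + ‖x.rep 1‖ ^ 2 = ‖x.rep 2‖ ^ 2 + ‖x.rep 3‖ ^ 2}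

/-- The defining condition of `Q22` may be tested on any representative. -/
theorem mk_mem_Q22 (z : Fin 4 → ℂ) (hz : z ≠ 0) :
    Projectivization.mk ℂ z hz ∈ Q22 ↔
      ‖z 0‖ ^ 2 + ‖z 1‖ ^ 2 = ‖z 2‖ ^ 2 + ‖z 3‖ ^ 2 := by
  obtain ⟨a, ha⟩ := Projectivization.exists_smul_eq_mk_rep ℂ z hz
  have h0 : (‖(a : ℂ)‖ ^ 2) ≠ 0 := by simp
  simp only [Q22, Set.mem_ofPred_eq, ← ha, Units.smul_def, Pi.smul_apply, norm_smul, mul_pow,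
    ← mul_add]
  exact mul_right_inj' h0

/-- The group of all projective transformations of `ℂP³` that commute with `j` and preserve
`Q^{2,2}`. -/
def GjQ22 : Subgroup PGL(4, ℂ) where
  carrier := {g | (∀ x : CP3, g • j x = j (g • x)) ∧ g • Q22 = Q22}
  mul_mem' := by
    rintro g h ⟨hg, hg'⟩ ⟨hh, hh'⟩
    exact ⟨fun x => by rw [mul_smul, hh, hg, mul_smul], by rw [mul_smul, hh', hg']⟩
  one_mem' := ⟨fun x => by rw [one_smul, one_smul], one_smul _ _⟩
  inv_mem' := by
    rintro g ⟨hg, hg'⟩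
    refine ⟨fun x => ?_, ?_⟩
    · rw [inv_smul_eq_iff, hg, smul_inv_smul]
    · rw [inv_smul_eq_iff, hg']

/-! ### The 4-sphere and the twistor projection -/

/-- Euclidean 5-space. -/
abbrev E5 : Type := EuclideanSpace ℝ (Fin 5)

/-- The round unit 4-sphere. -/
abbrev S4 : Type := Metric.sphere (0 : E5) 1

/-- The point of `S⁴ ⊂ ℍ × ℝ = ℝ⁵` corresponding to `[q₀ : q₁] ∈ ℍP¹` (right quaternionic lines
in `ℍ²`), namely `(2 q₁ q̄₀, |q₀|² - |q₁|²) / (|q₀|² + |q₁|²)`. -/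
def hopf (q₀ q₁ : ℍ[ℝ]) : E5 :=
  (‖q₀‖ ^ 2 + ‖q₁‖ ^ 2)⁻¹ •
    !₂[2 * (q₁ * star q₀).re, 2 * (q₁ * star q₀).imI, 2 * (q₁ * star q₀).imJ,
      2 * (q₁ * star q₀).imK, ‖q₀‖ ^ 2 - ‖q₁‖ ^ 2]

theorem hopf_mem (q₀ q₁ : ℍ[ℝ]) (h : q₀ ≠ 0 ∨ q₁ ≠ 0) : hopf q₀ q₁ ∈ Metric.sphere (0 : E5) 1 := by
  have hpos : 0 < ‖q₀‖ ^ 2 + ‖q₁‖ ^ 2 := by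
    rcases h with h | h
    · have := norm_pos_iff.mpr h; positivity
    · have := norm_pos_iff.mpr h; positivity
  have hn : ‖q₁ * star q₀‖ ^ 2 = ‖q₁‖ ^ 2 * ‖q₀‖ ^ 2 := by
    rw [norm_mul, norm_star, mul_pow]
  have hq : ∀ q : ℍ[ℝ], ‖q‖ ^ 2 = q.re ^ 2 + q.imI ^ 2 + q.imJ ^ 2 + q.imK ^ 2 := fun q => by
    rw [← Quaternion.normSq_eq_norm_mul_self q |>.trans (sq _).symm, Quaternion.normSq_def']
  rw [hq (q₁ * star q₀)] at hn
  unfold hopf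
  generalize q₁ * star q₀ = w at hn ⊢
  rw [mem_sphere_zero_iff_norm, norm_smul, norm_inv, Real.norm_of_nonneg hpos.le,
    inv_mul_eq_one₀ hpos.ne', eq_comm, EuclideanSpace.norm_eq,
    Real.sqrt_eq_iff_mul_self_eq (by positivity) hpos.le]
  simp only [Fin.sum_univ_five, Real.norm_eq_abs, sq_abs]
  simp
  linear_combination 4 * hn

/-- The quaternion unit `j`. -/
def quatJ : ℍ[ℝ] := ⟨0, 0, 1, 0⟩

/-- The quaternion `z + j w` attached to `(z, w) ∈ ℂ²`. -/
def quat (z w : ℂ) : ℍ[ℝ] := (z : ℍ[ℝ]) + quatJ * (w : ℍ[ℝ])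

theorem quat_ne_zero (z : Fin 4 → ℂ) (hz : z ≠ 0) :
    quat (z 0) (z 1) ≠ 0 ∨ quat (z 2) (z 3) ≠ 0 := by
  by_contra! h
  have key : ∀ a b : ℂ, quat a b = 0 → a = 0 ∧ b = 0 := fun a b hab => by
    have h1 := congrArg QuaternionAlgebra.re hab
    have h2 := congrArg QuaternionAlgebra.imI hab
    have h3 := congrArg QuaternionAlgebra.imJ hab
    have h4 := congrArg QuaternionAlgebra.imK hab
    simp [quat, Quaternion.re_mul, Quaternion.imI_mul, Quaternion.imJ_mul, Quaternion.imK_mul]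
      at h1 h2 h3 h4
    simp [quatJ] at h1 h2 h3 h4
    exact ⟨Complex.ext h1 h2, Complex.ext h3 h4⟩
  obtain ⟨h0, h1⟩ := key _ _ h.1
  obtain ⟨h2, h3⟩ := key _ _ h.2
  exact hz (by ext i; fin_cases i <;> simp [h0, h1, h2, h3])

theorem quat_smul (a z w : ℂ) : quat (a * z) (a * w) = quat z w * (a : ℍ[ℝ]) := by
  ext <;> simp [quat, Quaternion.re_mul, Quaternion.imI_mul, Quaternion.imJ_mul, Quaternion.imK_mul] <;> simp [quatJ] <;> ring

theorem hopf_mul (q₀ q₁ a : ℍ[ℝ]) (ha : a ≠ 0) : hopf (q₀ * a) (q₁ * a) = hopf q₀ q₁ := by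
  have h1 : (q₁ * a) * star (q₀ * a) = (‖a‖^2) • (q₁ * star q₀) := by
    rw [star_mul]
    have : a * star a = ((‖a‖^2 : ℝ) : ℍ[ℝ]) := by
      rw [Quaternion.self_mul_star, Quaternion.normSq_eq_norm_mul_self, sq]
    rw [mul_assoc, ← mul_assoc a, this, ← Quaternion.coe_mul_eq_smul, ← mul_assoc,
      ← Quaternion.coe_commutes, mul_assoc]
  have hn := norm_ne_zero_iff.mpr ha
  unfold hopf
  rw [h1]
  ext i
  by_cases h : ‖q₀‖ ^ 2 + ‖q₁‖ ^ 2 = 0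
  · have : (‖q₀ * a‖ ^ 2 + ‖q₁ * a‖ ^ 2) = 0 := by rw [norm_mul, norm_mul, mul_pow, mul_pow, ← add_mul, h, zero_mul]
    simp only [h, this]; simp
  fin_cases i <;> simp [norm_mul, mul_pow, ← add_mul] <;> field_simp

theorem norm_quat (z w : ℂ) : ‖quat z w‖ ^ 2 = ‖z‖^2 + ‖w‖^2 := by
  rw [← Quaternion.normSq_eq_norm_mul_self _ |>.trans (sq _).symm, Quaternion.normSq_def', ← Complex.normSq_eq_norm_sq, ← Complex.normSq_eq_norm_sq, Complex.normSq_apply, Complex.normSq_apply]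
  simp [quat, Quaternion.re_mul, Quaternion.imI_mul, Quaternion.imJ_mul, Quaternion.imK_mul]
  simp [quatJ]; ring

/-- The twistor projection `π : ℂP³ → ℍP¹ ≃ S⁴`,
`[z₀ : z₁ : z₂ : z₃] ↦ [z₀ + j z₁ : z₂ + j z₃]`. -/
def twistorProj (x : CP3) : S4 :=
  ⟨hopf (quat (x.rep 0) (x.rep 1)) (quat (x.rep 2) (x.rep 3)),
    hopf_mem _ _ (quat_ne_zero _ x.rep_nonzero)⟩

/-- The twistor projection may be computed on any representative. -/
theorem twistorProj_mk (z : Fin 4 → ℂ) (hz : z ≠ 0) :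
    (twistorProj (Projectivization.mk ℂ z hz) : E5) = hopf (quat (z 0) (z 1)) (quat (z 2) (z 3)) := by
  obtain ⟨a, ha⟩ := Projectivization.exists_smul_eq_mk_rep ℂ z hz
  have h0 : (((a:ℂ) : ℍ[ℝ])) ≠ 0 := by
    intro h
    have h1 := congrArg QuaternionAlgebra.re h
    have h2 := congrArg QuaternionAlgebra.imI h
    simp at h1 h2
    exact a.ne_zero (Complex.ext h1 h2)
  simp only [twistorProj, ← ha, Units.smul_def, Pi.smul_apply, smul_eq_mul, quat_smul, hopf_mul _ _ _ h0]

/-- The distinguished round 3-sphere `Σ = {[q₀ : q₁] | |q₀| = |q₁|} ⊂ S⁴` (the equator). -/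
def Sig : Set S4 := {p | (p : E5) 4 = 0}

/-- `Q^{2,2}` is the preimage of the distinguished 3-sphere. -/
theorem preimage_Sig : twistorProj ⁻¹' Sig = Q22 := by
  ext x
  induction x using Projectivization.ind with | h z hz =>
  rw [mk_mem_Q22, Set.mem_preimage, Sig, Set.mem_ofPred_eq, twistorProj_mk]
  have hne := quat_ne_zero z hz
  have hpos : 0 < ‖quat (z 0) (z 1)‖ ^ 2 + ‖quat (z 2) (z 3)‖ ^ 2 := by
    rcases hne with h | h
    · have := norm_pos_iff.mpr h; positivity
    · have := norm_pos_iff.mpr h; positivity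
  simp only [← norm_quat]
  simp [hopf, hpos.ne', sub_eq_zero]

/-- The discriminant locus: the points of `S⁴` whose twistor fibre does not meet `S` in exactly
two points. -/
def discriminant (S : Set CP3) : Set S4 :=
  {p | (twistorProj ⁻¹' {p} ∩ S).encard ≠ 2}

/-! ### Conformal equivalence in the round sphere `S⁴` -/

/-- A smooth diffeomorphism of `S⁴` is conformal (possibly orientation reversing) if at each point
its differential is a positive multiple of an isometry for the round metric, i.e. for the metric
induced by the inclusion in `ℝ⁵`. -/
def IsConformal (f : S4 ≃ₘ^∞⟮𝓡 4, 𝓡 4⟯ S4) : Prop :=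
  ∀ x : S4, ∃ c : ℝ, 0 < c ∧ ∀ v : TangentSpace (𝓡 4) x,
    ‖mvfderiv (𝓡 4) (fun y : S4 => (f y : E5)) x v‖ =
      c * ‖mvfderiv (𝓡 4) (fun y : S4 => (y : E5)) x v‖

/-- The pairs `(D, B)` and `(D', B')` of subsets of `S⁴` are conformally equivalent. -/
def ConformallyEquivalent (D B D' B' : Set S4) : Prop :=
  ∃ f : S4 ≃ₘ^∞⟮𝓡 4, 𝓡 4⟯ S4, IsConformal f ∧ f '' D = D' ∧ f '' B = B'

/-! ### The inversive distance -/

/-- The complex plane `ℂ ⊂ ℍ ⊂ ℍ ∪ {∞} = S⁴`, where `q ∈ ℍ` stands for `[1 : q] ∈ ℍP¹`; in this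
chart `Sig` is `{|q| = 1}`. -/
def planarPoint (z : ℂ) : S4 := ⟨hopf 1 (z : ℍ[ℝ]), hopf_mem _ _ (Or.inl one_ne_zero)⟩

/-- The circle `{|z - a| = r}` in `ℂ ⊂ S⁴`. -/
def planarCircle (a r : ℝ) : Set S4 := planarPoint '' Metric.sphere (a : ℂ) r

/-- The numbers `|a² - r² - 1| / (2r)` obtained from all the normalizations, by a conformal
transformation of `S⁴`, of `B` to `Sig = {|q| = 1}` and of `D` to a planar circle
`{|z - a| = r}`, with `a ≥ 0` and `r > 0`. -/
def inversiveValues (D B : Set S4) : Set ℝ :=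
  {t | ∃ a r : ℝ, 0 ≤ a ∧ 0 < r ∧ ConformallyEquivalent D B (planarCircle a r) Sig ∧
    t = |a ^ 2 - r ^ 2 - 1| / (2 * r)}

/-- The inversive distance `I(D, B)` of the circle `D` and the 3-sphere `B`: the common element of
`inversiveValues D B` (a junk value unless that set has exactly one element). -/
def inversiveDistance (D B : Set S4) : ℝ := sInf (inversiveValues D B)

end

end TwistorQuadrics

open TwistorQuadrics

/-!
The proof brings both sides of the equivalence to the same list of normal forms, the quadrics
`(z₂ - a z₀) (z₃ - a z₁) = z₀ z₁` with `a = √(2 + 2 s)`, where `s = -1` or `s ≥ 0`.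

*Discriminants.* Over a point `[1 : u + j w]` the normal form restricts to a binary quadratic form
whose discriminant is a sum of two squares that vanishes exactly for `w = 0`, `|u - a| = 1`. So the
discriminant circle is the planar circle of centre `a` and radius `1`
(`discriminant_normalQuadric`), whose inversive distance to `Σ` is `|s|`, and which lies in `Σ` only
for `s = -1`.

*Classification* (`exists_normalQuadric_orbit`). The symmetric form `B` of a `j`-invariant quadric
can be scaled to be real for the quaternionic structure `J` (`exists_real_matrix`). An eigenvector
of `B` relative to the symplectic form `herm (J x) z` leads to vectors `p`, `q` that span a
`B`-isotropic plane and are, over the quaternions, an orthonormal basis for the Hermitian form of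
signature `(2, 2)` (`exists_adaptedPair`). In the frame `p, J p, q, J q` the quadric becomes planar,
`m z₀ z₁ + n (z₀ z₃ + z₁ z₂) + p z₂ z₃ = 0` with real coefficients. On
the triples `(m, n, p)` the symmetries act by transformations preserving `n² - m p` up to sign:
boosts in the plane of `m + p` and `2 n`, two reflections, and for `n = 0` the change of the sign of
`p`. Every triple can be moved by these to that of a normal form
(`lorentzQuadric_mem_orbit_normalQuadric`).

*Equivalent quadrics have conformally equivalent pairs* (`conformallyEquivalent_smul`). A projective
transformation that commutes with `j` comes from a quaternionic `2 × 2` matrix `M`. On the null cone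
of `ℝ⁵ × ℝ`, the space of quaternionic Hermitian matrices, it induces the linear map `X ↦ M X M*`,
and a linear map that permutes the null lines acts on the sphere by a conformal diffeomorphism
(`exists_conformal_of_linearEquiv`).

*The inversive distance is a conformal invariant* (`inversive_eq_of_conformal`). This rests on
Liouville's theorem (`exists_lorentz_of_conformal`). A conformal map, read in the flat chart and
lifted to the null cone with the right factor, is an isometric immersion `F` of `ℝ⁴`.
Differentiating the relations `⟨F, F⟩ = 0` and `⟨∂ᵢF, ∂ⱼF⟩ = δᵢⱼ` shows that `F` is a quadratic
polynomial, hence the restriction of a linear Lorentz transformation. Such a transformation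
preserves the normal vector of `Σ` up to sign. Among the unit normals of the 3-spheres through the
circle, the product with that vector is largest in absolute value for the 3-sphere orthogonal to the
plane, where it is the inversive distance (`sq_le_of_orthogonal_planarCircle`).

Conformal equivalence thus determines `|s|` and whether the circle lies in `Σ`, hence `s`.
-/

namespace TwistorQuadrics

noncomputable section

/-! ### Conformal diffeomorphisms of the 4-sphere -/

theorem fact_finrank_E5 : Fact (Module.finrank ℝ E5 = 4 + 1) := ⟨by simp⟩

theorem mdifferentiableAt_coe_S4 (x : S4) :
    MDifferentiableAt (𝓡 4) 𝓘(ℝ, E5) (fun y : S4 => (y : E5)) x :=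
  have := fact_finrank_E5
  (contMDiff_coe_sphere (m := 1) (n := 4) x).mdifferentiableAt one_ne_zero

theorem mdifferentiableAt_diffeo (f : S4 ≃ₘ^∞⟮𝓡 4, 𝓡 4⟯ S4) (x : S4) :
    MDifferentiableAt (𝓡 4) (𝓡 4) f x :=
  f.contMDiff.mdifferentiableAt (by simp)

theorem mdifferentiableAt_coe_diffeo (f : S4 ≃ₘ^∞⟮𝓡 4, 𝓡 4⟯ S4) (x : S4) :
    MDifferentiableAt (𝓡 4) 𝓘(ℝ, E5) (fun y : S4 => (f y : E5)) x :=
  (mdifferentiableAt_coe_S4 (f x)).comp x (mdifferentiableAt_diffeo f x)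

/-- The chain rule for the derivative of a vector-valued function on a manifold. -/
theorem mvfderiv_comp_vector {E' H' M' E H M F : Type*} [NormedAddCommGroup E'] [NormedSpace ℝ E']
    [TopologicalSpace H'] {I' : ModelWithCorners ℝ E' H'} [TopologicalSpace M'] [ChartedSpace H' M']
    [NormedAddCommGroup E] [NormedSpace ℝ E] [TopologicalSpace H] {I : ModelWithCorners ℝ E H}
    [TopologicalSpace M] [ChartedSpace H M] [NormedAddCommGroup F] [NormedSpace ℝ F]
    {g : M → F} {f : M' → M} (x : M') (hg : MDifferentiableAt I 𝓘(ℝ, F) g (f x))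
    (hf : MDifferentiableAt I' I f x) (v : TangentSpace I' x) :
    mvfderiv I' (g ∘ f) x v = mvfderiv I g (f x) (mfderiv I' I f x v) :=
  mfderiv_comp_apply x hg hf v

/-- The chain rule for `f ∘ g`, read in the ambient space `ℝ⁵`. -/
theorem mvfderiv_coe_comp (f g : S4 ≃ₘ^∞⟮𝓡 4, 𝓡 4⟯ S4) (x : S4) (v : TangentSpace (𝓡 4) x) :
    mvfderiv (𝓡 4) (fun y : S4 => (f (g y) : E5)) x v =
      mvfderiv (𝓡 4) (fun y : S4 => (f y : E5)) (g x) (mfderiv (𝓡 4) (𝓡 4) g x v) :=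
  mvfderiv_comp_vector (g := fun y : S4 => (f y : E5)) (f := g) x
    (mdifferentiableAt_coe_diffeo f (g x)) (mdifferentiableAt_diffeo g x) v

theorem mvfderiv_coe_eq (g : S4 ≃ₘ^∞⟮𝓡 4, 𝓡 4⟯ S4) (x : S4) (v : TangentSpace (𝓡 4) x) :
    mvfderiv (𝓡 4) (fun y : S4 => (g y : E5)) x v =
      mvfderiv (𝓡 4) (fun y : S4 => (y : E5)) (g x) (mfderiv (𝓡 4) (𝓡 4) g x v) :=
  mvfderiv_comp_vector (g := fun y : S4 => (y : E5)) (f := g) x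
    (mdifferentiableAt_coe_S4 (g x)) (mdifferentiableAt_diffeo g x) v

theorem IsConformal.trans {f g : S4 ≃ₘ^∞⟮𝓡 4, 𝓡 4⟯ S4} (hg : IsConformal g)
    (hf : IsConformal f) : IsConformal (g.trans f) := by
  intro x
  obtain ⟨c, hc, h⟩ := hg x
  obtain ⟨d, hd, h'⟩ := hf (g x)
  refine ⟨d * c, mul_pos hd hc, fun v => ?_⟩
  have : mvfderiv (𝓡 4) (fun y : S4 => ((g.trans f) y : E5)) x v =
      mvfderiv (𝓡 4) (fun y : S4 => (f (g y) : E5)) x v := rfl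
  rw [this, mvfderiv_coe_comp, h', ← mvfderiv_coe_eq, h, mul_assoc]

theorem IsConformal.symm {f : S4 ≃ₘ^∞⟮𝓡 4, 𝓡 4⟯ S4} (hf : IsConformal f) :
    IsConformal f.symm := by
  intro x
  obtain ⟨c, hc, h⟩ := hf (f.symm x)
  refine ⟨c⁻¹, inv_pos.mpr hc, fun v => ?_⟩
  have h1 : (fun y : S4 => (f (f.symm y) : E5)) = fun y : S4 => (y : E5) := by
    funext y; simp
  have h2 := mvfderiv_coe_comp f f.symm x v
  rw [h1] at h2
  rw [h2, h, ← mvfderiv_coe_eq, inv_mul_cancel_left₀ hc.ne']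

theorem ConformallyEquivalent.trans {D B D' B' D'' B'' : Set S4}
    (h : ConformallyEquivalent D B D' B') (h' : ConformallyEquivalent D' B' D'' B'') :
    ConformallyEquivalent D B D'' B'' := by
  obtain ⟨f, hf, rfl, rfl⟩ := h
  obtain ⟨g, hg, rfl, rfl⟩ := h'
  exact ⟨f.trans g, hf.trans hg, by simp [Set.image_comp], by simp [Set.image_comp]⟩

theorem ConformallyEquivalent.symm {D B D' B' : Set S4}
    (h : ConformallyEquivalent D B D' B') : ConformallyEquivalent D' B' D B := by
  obtain ⟨f, hf, rfl, rfl⟩ := h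
  refine ⟨f.symm, hf.symm, ?_, ?_⟩ <;> simp [← Set.image_comp]

/-- The Lorentzian form `⟨x, y⟩ - s t` on `ℝ⁵ × ℝ`. The 4-sphere is the projectivization of its
null cone, `y ∈ S⁴` corresponding to the null vector `(y, 1)`. -/
def lorentz : LinearMap.BilinForm ℝ (E5 × ℝ) :=
  (innerₗ E5).compl₁₂ (LinearMap.fst ℝ E5 ℝ) (LinearMap.fst ℝ E5 ℝ) -
    (LinearMap.mul ℝ ℝ).compl₁₂ (LinearMap.snd ℝ E5 ℝ) (LinearMap.snd ℝ E5 ℝ)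

theorem lorentz_apply (x y : E5 × ℝ) : lorentz x y = inner ℝ x.1 y.1 - x.2 * y.2 := by
  simp [lorentz]

theorem lorentz_comm (x y : E5 × ℝ) : lorentz x y = lorentz y x := by
  simp only [lorentz_apply, real_inner_comm, mul_comm]

theorem norm_coe_S4 (y : S4) : ‖(y : E5)‖ = 1 := by
  simp

theorem lorentz_self_coe (y : S4) : lorentz ((y : E5), 1) ((y : E5), 1) = 0 := by
  simp [lorentz_apply]

/-- A linear map that sends the null cone of `lorentz` into itself scales `lorentz`: evaluating on
the null vectors `(y, 1)` and `(-y, 1)` separates the even and odd parts, and polarization does the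
rest. -/
theorem exists_scale_of_preserves_cone (Λ : E5 × ℝ →ₗ[ℝ] E5 × ℝ)
    (h : ∀ y : S4, lorentz (Λ ((y : E5), 1)) (Λ ((y : E5), 1)) = 0) :
    ∃ κ : ℝ, ∀ x y : E5 × ℝ, lorentz (Λ x) (Λ y) = κ * lorentz x y := by
  have split : ∀ (y : E5) (t : ℝ), Λ (y, t) = Λ (y, 0) + t • Λ (0, 1) := fun y t => by
    rw [← map_smul, ← map_add]; simp
  set e := Λ (0, 1) with he
  have hunit : ∀ y : E5, ‖y‖ = 1 → lorentz (Λ (y, 0)) (Λ (y, 0)) = -lorentz e e ∧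
      lorentz (Λ (y, 0)) e = 0 := by
    intro y hy
    have h1 := h ⟨y, by simpa using hy⟩
    have h2 := h ⟨-y, by simpa using hy⟩
    have hneg : Λ (-y, 0) = -Λ (y, 0) := by rw [← map_neg]; simp
    simp only at h1 h2
    rw [split] at h1 h2
    rw [hneg] at h2
    simp only [map_add, map_neg, LinearMap.add_apply, LinearMap.neg_apply, one_smul,
      lorentz_comm e] at h1 h2
    constructor <;> linarith
  have hall : ∀ y : E5, lorentz (Λ (y, 0)) (Λ (y, 0)) = -lorentz e e * ‖y‖ ^ 2 ∧
      lorentz (Λ (y, 0)) e = 0 := by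
    intro y
    by_cases hy : y = 0
    · subst hy
      have : Λ ((0 : E5), (0 : ℝ)) = 0 := by rw [Prod.mk_zero_zero, map_zero]
      simp [this]
    · have hn : ‖y‖ ≠ 0 := norm_ne_zero_iff.mpr hy
      obtain ⟨h1, h2⟩ := hunit (‖y‖⁻¹ • y)
        (by rw [norm_smul, norm_inv, norm_norm, inv_mul_cancel₀ hn])
      have hs : Λ (y, 0) = ‖y‖ • Λ (‖y‖⁻¹ • y, 0) := by
        rw [← map_smul]; simp [smul_smul, hn]
      rw [hs]
      simp only [map_smul, LinearMap.smul_apply, h1, h2, smul_eq_mul]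
      constructor <;> ring
  refine ⟨-lorentz e e, fun x y => ?_⟩
  have hpol : lorentz (Λ (x.1, 0)) (Λ (y.1, 0)) = -lorentz e e * inner ℝ x.1 y.1 := by
    have h1 := (hall (x.1 + y.1)).1
    have hadd : Λ (x.1 + y.1, 0) = Λ (x.1, 0) + Λ (y.1, 0) := by rw [← map_add]; simp
    rw [hadd, norm_add_sq_real] at h1
    simp only [map_add, LinearMap.add_apply, (hall x.1).1, (hall y.1).1,
      lorentz_comm (Λ (y.1, 0)) (Λ (x.1, 0))] at h1
    linarith
  rw [← Prod.mk.eta (p := x), ← Prod.mk.eta (p := y), split x.1, split y.1]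
  simp only [map_add, map_smul, LinearMap.add_apply, LinearMap.smul_apply, hpol, (hall _).2,
    lorentz_comm e, lorentz_apply, smul_eq_mul]
  ring

/-- The map `y ↦ Λ(y, 1)`, followed by the central projection to the hyperplane `t = 1`, is
differentiable where the denominator does not vanish, with the derivative given by the quotient
rule. -/
theorem projectivize_fderiv (Λ : E5 × ℝ →ₗ[ℝ] E5 × ℝ) (y : E5) (hy : (Λ (y, 1)).2 ≠ 0) :
    DifferentiableAt ℝ (fun y => (Λ (y, 1)).2⁻¹ • (Λ (y, 1)).1) y ∧
    ∀ w : E5, (Λ (y, 1)).2 • fderiv ℝ (fun y => (Λ (y, 1)).2⁻¹ • (Λ (y, 1)).1) y w =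
      (Λ (w, 0)).1 - (Λ (w, 0)).2 • ((Λ (y, 1)).2⁻¹ • (Λ (y, 1)).1) := by
  set T : E5 × ℝ →L[ℝ] E5 × ℝ := LinearMap.toContinuousLinearMap Λ with hT
  have h0 : HasFDerivAt (fun y : E5 => (y, (1 : ℝ))) (ContinuousLinearMap.inl ℝ E5 ℝ) y :=
    (hasFDerivAt_id y).prodMk (hasFDerivAt_const _ _)
  have h1 : HasFDerivAt (fun y : E5 => Λ (y, 1)) (T ∘L ContinuousLinearMap.inl ℝ E5 ℝ) y :=
    T.hasFDerivAt.comp y h0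
  have h2 := h1.fst
  have h3 := h1.snd
  have h4 : HasFDerivAt (fun y : E5 => (Λ (y, 1)).2⁻¹)
    ((-((Λ (y, 1)).2 ^ 2)⁻¹) • ((ContinuousLinearMap.snd ℝ E5 ℝ) ∘L
      (T ∘L ContinuousLinearMap.inl ℝ E5 ℝ))) y := (hasDerivAt_inv hy).comp_hasFDerivAt y h3
  have h5 := h4.smul h2
  refine ⟨h5.differentiableAt, fun w => ?_⟩
  have h6 := congrArg (fun A : E5 →L[ℝ] E5 => A w) h5.fderiv
  have h7 : fderiv ℝ (fun y => (Λ (y, 1)).2⁻¹ • (Λ (y, 1)).1) y w =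
      (Λ (y, 1)).2⁻¹ • (Λ (w, 0)).1 + (-((Λ (y, 1)).2 ^ 2)⁻¹ * (Λ (w, 0)).2) • (Λ (y, 1)).1 :=
    h6.trans (by simp [hT])
  rw [h7, smul_add, smul_smul, smul_smul, smul_smul, mul_inv_cancel₀ hy, one_smul, sub_eq_add_neg,
    ← neg_smul]
  congr 2
  field_simp

/-- A linear automorphism of `ℝ⁵ × ℝ` that permutes the null lines induces a smooth conformal
diffeomorphism of the sphere. -/
theorem exists_conformal_of_linearEquiv (Λ : (E5 × ℝ) ≃ₗ[ℝ] (E5 × ℝ)) (f : S4 ≃ S4)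
    (h : ∀ y : S4, ∃ c : ℝ, c ≠ 0 ∧ Λ ((y : E5), 1) = c • ((f y : E5), 1)) :
    ∃ F : S4 ≃ₘ^∞⟮𝓡 4, 𝓡 4⟯ S4, IsConformal F ∧ ⇑F = f := by
  have := fact_finrank_E5
  have smooth : ∀ (Λ : (E5 × ℝ) ≃ₗ[ℝ] (E5 × ℝ)) (f : S4 → S4),
      (∀ y : S4, ∃ c : ℝ, c ≠ 0 ∧ Λ ((y : E5), 1) = c • ((f y : E5), 1)) →
      ContMDiff (𝓡 4) (𝓡 4) ∞ f := by
    intro Λ f h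
    have h1 : ContMDiff (𝓡 4) 𝓘(ℝ, E5) ∞ (fun y : S4 => (f y : E5)) := by
      have h2 : (fun y : S4 => (f y : E5)) =
          (fun y : E5 => (Λ (y, 1)).2⁻¹ • (Λ (y, 1)).1) ∘ (fun y : S4 => (y : E5)) := by
        funext y
        obtain ⟨c, hc, hy⟩ := h y
        simp [hy, smul_smul, hc]
      rw [h2]
      intro y
      refine ContMDiffAt.comp y (ContDiffAt.contMDiffAt ?_) (contMDiff_coe_sphere y)
      have hL : ContDiffAt ℝ ∞ (fun y : E5 => Λ (y, 1)) y :=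
        (LinearMap.toContinuousLinearMap (Λ : E5 × ℝ →ₗ[ℝ] E5 × ℝ)).contDiff.contDiffAt.comp
          (y : E5) (contDiffAt_id.prodMk contDiffAt_const)
      obtain ⟨c, hc, hy⟩ := h y
      exact (hL.snd.inv (by simp [hy, hc])).smul hL.fst
    exact h1.codRestrict_sphere (fun y => (f y).2)
  have hinv : ∀ y : S4, ∃ c : ℝ, c ≠ 0 ∧ Λ.symm ((y : E5), 1) = c • ((f.symm y : E5), 1) := by
    intro y
    obtain ⟨c, hc, hy⟩ := h (f.symm y)
    refine ⟨c⁻¹, inv_ne_zero hc, ?_⟩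
    rw [LinearEquiv.symm_apply_eq, map_smul, hy, smul_smul, inv_mul_cancel₀ hc, one_smul,
      Equiv.apply_symm_apply]
  let F : S4 ≃ₘ^∞⟮𝓡 4, 𝓡 4⟯ S4 :=
    { toEquiv := f
      contMDiff_toFun := smooth Λ f h
      contMDiff_invFun := smooth Λ.symm f.symm hinv }
  refine ⟨F, ?_, rfl⟩
  obtain ⟨κ, hκ⟩ := exists_scale_of_preserves_cone (Λ : E5 × ℝ →ₗ[ℝ] E5 × ℝ) (fun y => by
    obtain ⟨c, hc, hy⟩ := h y
    rw [LinearEquiv.coe_coe, hy, map_smul, map_smul, LinearMap.smul_apply, lorentz_self_coe]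
    simp)
  have hκ' : ∀ x y : E5 × ℝ, lorentz (Λ x) (Λ y) = κ * lorentz x y := hκ
  have hκ0 : κ ≠ 0 := by
    intro h0
    have := hκ' (Λ.symm (EuclideanSpace.single 0 1, 0)) (Λ.symm (EuclideanSpace.single 0 1, 0))
    rw [h0, zero_mul, Λ.apply_symm_apply, lorentz_apply] at this
    simp at this
  -- on tangent vectors the derivative scales the norm by `√κ / |t|`, where `t` is the last
  -- coordinate of `Λ (x, 1)`
  have key : ∀ (x : S4) (w : E5), inner ℝ (x : E5) w = 0 →
      (Λ ((x : E5), 1)).2 ≠ 0 ∧ (Λ ((x : E5), 1)).2 ^ 2 *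
        ‖fderiv ℝ (fun y : E5 => (Λ (y, 1)).2⁻¹ • (Λ (y, 1)).1) x w‖ ^ 2 = κ * ‖w‖ ^ 2 := by
    intro x w hw
    obtain ⟨c, hc, hx⟩ := h x
    have hc' : (Λ ((x : E5), 1)).2 = c := by simp [hx]
    have hℓ : (Λ ((x : E5), 1)).2 ≠ 0 := hc' ▸ hc
    refine ⟨hℓ, ?_⟩
    have hd := (projectivize_fderiv (Λ : E5 × ℝ →ₗ[ℝ] E5 × ℝ) x hℓ).2 w
    simp only [LinearEquiv.coe_coe] at hd
    have hfx : (Λ ((x : E5), 1)).2⁻¹ • (Λ ((x : E5), 1)).1 = (f x : E5) := by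
      simp [hx, smul_smul, hc]
    have h1 := hκ' (w, 0) (w, 0)
    have h2 := hκ' (w, 0) ((x : E5), 1)
    rw [hx] at h2
    simp only [lorentz_apply, Prod.smul_fst, Prod.smul_snd, inner_smul_right, smul_eq_mul,
      real_inner_self_eq_norm_sq, real_inner_comm (x : E5) w, hw] at h1 h2
    have h3 : inner ℝ (f x : E5) (Λ (w, 0)).1 = (Λ (w, 0)).2 := by
      rw [real_inner_comm]
      apply mul_left_cancel₀ hc; linarith
    calc (Λ ((x : E5), 1)).2 ^ 2 *
        ‖fderiv ℝ (fun y : E5 => (Λ (y, 1)).2⁻¹ • (Λ (y, 1)).1) x w‖ ^ 2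
        = ‖(Λ ((x : E5), 1)).2 •
          fderiv ℝ (fun y : E5 => (Λ (y, 1)).2⁻¹ • (Λ (y, 1)).1) x w‖ ^ 2 := by
          rw [norm_smul, mul_pow, Real.norm_eq_abs, sq_abs]
      _ = ‖(Λ (w, 0)).1 - (Λ (w, 0)).2 • (f x : E5)‖ ^ 2 := by rw [hd, hfx]
      _ = κ * ‖w‖ ^ 2 := by
          rw [norm_sub_sq_real, norm_smul, inner_smul_right, real_inner_comm, h3, norm_coe_S4,
            mul_one, Real.norm_eq_abs, sq_abs]
          linarith
  -- `κ` is positive, as the left-hand side of `key` is not negative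
  have hκpos : 0 < κ := by
    refine lt_of_le_of_ne ?_ hκ0.symm
    let x : S4 := ⟨EuclideanSpace.single 0 1, by simp⟩
    have := (key x (EuclideanSpace.single 1 1)
      (by simp [x, EuclideanSpace.inner_single_left])).2
    rw [PiLp.norm_single] at this
    norm_num at this
    rw [← this]; positivity
  intro x
  have hx0 := (key x 0 (by simp)).1
  refine ⟨√κ / |(Λ ((x : E5), 1)).2|, by positivity, fun v => ?_⟩
  -- `w` is the tangent vector `v`, seen in the ambient space
  set w := mvfderiv (𝓡 4) (fun y : S4 => (y : E5)) x v with hw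
  have hperp : inner ℝ (x : E5) w = 0 := by
    have : w ∈ (ℝ ∙ (x : E5))ᗮ := by
      rw [← range_mvfderiv_subtypeVal (n := 4) x]; exact ⟨v, rfl⟩
    exact Submodule.mem_orthogonal_singleton_iff_inner_right.mp this
  have hcomp : mvfderiv (𝓡 4) (fun y : S4 => (F y : E5)) x v =
      fderiv ℝ (fun y : E5 => (Λ (y, 1)).2⁻¹ • (Λ (y, 1)).1) x w := by
    have h2 : (fun y : S4 => (F y : E5)) =
        (fun y : E5 => (Λ (y, 1)).2⁻¹ • (Λ (y, 1)).1) ∘ (fun y : S4 => (y : E5)) := by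
      funext y
      obtain ⟨c, hc, hy⟩ := h y
      simp [hy, smul_smul, hc]
      rfl
    have hd := (projectivize_fderiv (Λ : E5 × ℝ →ₗ[ℝ] E5 × ℝ) x hx0).1
    rw [h2, hw]
    have := mvfderiv_comp_vector (g := fun y : E5 => (Λ (y, 1)).2⁻¹ • (Λ (y, 1)).1)
      (f := fun y : S4 => (y : E5)) x hd.mdifferentiableAt (mdifferentiableAt_coe_S4 x) v
    rw [this]
    simp only [mvfderiv, mfderiv_eq_fderiv]
    rfl
  rw [hcomp]
  have hk := (key x w hperp).2
  rw [div_mul_eq_mul_div, eq_div_iff (by positivity), ← sq_eq_sq₀ (by positivity) (by positivity)]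
  rw [mul_pow, mul_pow, sq_abs, Real.sq_sqrt hκpos.le, mul_comm]
  exact hk

/-! ### The action of the symmetry group on the 4-sphere -/

theorem J_apply_zero (z : Fin 4 → ℂ) : J z 0 = -conj (z 1) := rfl
theorem J_apply_one (z : Fin 4 → ℂ) : J z 1 = conj (z 0) := rfl
theorem J_apply_two (z : Fin 4 → ℂ) : J z 2 = -conj (z 3) := rfl
theorem J_apply_three (z : Fin 4 → ℂ) : J z 3 = conj (z 2) := rfl

theorem J_ne_zero {z : Fin 4 → ℂ} (hz : z ≠ 0) : J z ≠ 0 := fun h =>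
  hz (J_injective (h.trans (map_zero J).symm))

theorem j_mk (z : Fin 4 → ℂ) (hz : z ≠ 0) :
    j (Projectivization.mk ℂ z hz) = Projectivization.mk ℂ (J z) (J_ne_zero hz) := rfl

theorem mk_GL_smul (A : GL (Fin 4) ℂ) (z : Fin 4 → ℂ) (hz : z ≠ 0) :
    ∃ h : A.1.mulVec z ≠ 0, (Matrix.ProjGenLinGroup.mk A : PGL(4, ℂ)) • Projectivization.mk ℂ z hz =
      Projectivization.mk ℂ (A.1.mulVec z) h :=
  ⟨(smul_ne_zero_iff_ne A).2 hz, rfl⟩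

theorem exists_unit_sq_eq {c : ℂ} (hc : conj c * c = 1) : ∃ d : ℂ, d ^ 2 = c ∧ conj d * d = 1 := by
  obtain ⟨d, hd⟩ := IsAlgClosed.exists_pow_nat_eq c (n := 2) two_pos
  refine ⟨d, hd, ?_⟩
  have h1 : (conj d * d) ^ 2 = 1 := by rw [mul_pow, ← map_pow, hd, hc]
  rw [Complex.conj_mul'] at h1 ⊢
  have h2 : (‖d‖ ^ 2) ^ 2 = 1 := by exact_mod_cast h1
  have h3 : ‖d‖ ^ 2 = 1 := by nlinarith [sq_nonneg ‖d‖]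
  exact_mod_cast h3

/-- A projective transformation that commutes with `j` has a matrix that commutes with `J`. -/
theorem exists_GL_commuting_J (g : PGL(4, ℂ)) (hg : ∀ x : CP3, g • j x = j (g • x)) :
    ∃ A : GL (Fin 4) ℂ, Matrix.ProjGenLinGroup.mk A = g ∧
      ∀ z, A.1.mulVec (J z) = J (A.1.mulVec z) := by
  obtain ⟨A, rfl⟩ := Matrix.ProjGenLinGroup.mk_surjective g
  have hinv : ∀ z, A.1.mulVec (A⁻¹.1.mulVec z) = z := fun z => by
    rw [Matrix.mulVec_mulVec]; simp
  have hinv' : ∀ z, A⁻¹.1.mulVec (A.1.mulVec z) = z := fun z => by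
    rw [Matrix.mulVec_mulVec]; simp
  -- the linear map `J A⁻¹ J A` maps every line to itself, so it is a scalar
  let B : (Fin 4 → ℂ) →ₗ[ℂ] (Fin 4 → ℂ) :=
    J.comp ((Matrix.toLin' A⁻¹.1).comp (J.comp (Matrix.toLin' A.1)))
  have hB : ∀ z, B z = J (A⁻¹.1.mulVec (J (A.1.mulVec z))) := fun z => rfl
  obtain ⟨a, ha⟩ := B.exists_eq_smul_id_of_forall_notLinearIndependent fun z => by
    by_cases hz : z = 0
    · simp [hz, linearIndependent_fin2]
    · have h1 := hg (Projectivization.mk ℂ z hz)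
      rw [j_mk] at h1
      obtain ⟨h2, h3⟩ := mk_GL_smul A z hz
      obtain ⟨h4, h5⟩ := mk_GL_smul A (J z) (J_ne_zero hz)
      rw [h3, h5, j_mk, eq_comm, Projectivization.mk_eq_mk_iff'] at h1
      obtain ⟨c, hc⟩ := h1
      rw [LinearIndependent.pair_iff' hz]
      push Not
      refine ⟨-conj c, ?_⟩
      rw [hB, ← hc, Matrix.mulVec_smul, hinv', map_smulₛₗ, J_J]
      simp
  have ha' : ∀ z, J (A⁻¹.1.mulVec (J (A.1.mulVec z))) = a • z := fun z => by
    rw [← hB, ha]; rfl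
  set c : ℂ := -conj a with hc
  have hJA : ∀ z, J (A.1.mulVec z) = c • A.1.mulVec (J z) := fun z => by
    have h1 := congrArg J (ha' z)
    rw [J_J, map_smulₛₗ] at h1
    have h2 := congrArg A.1.mulVec (neg_eq_iff_eq_neg.mp h1)
    rw [hinv, ← neg_smul, Matrix.mulVec_smul] at h2
    exact h2
  -- `J² = -1` forces the constant `c` to have modulus one
  have hcn : conj c * c = 1 := by
    have h1 := congrArg J (hJA (Pi.single 0 1))
    rw [J_J, map_smulₛₗ, hJA, J_J, smul_smul, Matrix.mulVec_neg, smul_neg, neg_inj] at h1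
    have h2 := congrArg A⁻¹.1.mulVec h1
    rw [Matrix.mulVec_smul, hinv'] at h2
    have h3 := congrFun h2 0
    simpa using h3.symm
  -- multiplying `A` by a square root of `c` makes it commute with `J`
  obtain ⟨d, hd, hdn⟩ := exists_unit_sq_eq hcn
  have hd0 : d ≠ 0 := by rintro rfl; simp at hdn
  refine ⟨A * Matrix.GeneralLinearGroup.scalar (Fin 4) (Units.mk0 d hd0), ?_, fun z => ?_⟩
  · rw [map_mul, Matrix.ProjGenLinGroup.mk_scalar, mul_one]
  · have h1 : ∀ z, (A * Matrix.GeneralLinearGroup.scalar (Fin 4) (Units.mk0 d hd0)).1.mulVec z =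
        d • A.1.mulVec z := fun z => by
      rw [Units.val_mul, ← Matrix.mulVec_mulVec]
      simp [Matrix.mulVec_smul]
    rw [h1, h1, map_smulₛₗ, hJA, smul_smul, ← hd, sq, ← mul_assoc, hdn, one_mul]

theorem quat_ext {z w z' w' : ℂ} (h : quat z w = quat z' w') : z = z' ∧ w = w' := by
  have h1 := congrArg QuaternionAlgebra.re h
  have h2 := congrArg QuaternionAlgebra.imI h
  have h3 := congrArg QuaternionAlgebra.imJ h
  have h4 := congrArg QuaternionAlgebra.imK h
  simp [quat, Quaternion.re_mul, Quaternion.imI_mul, Quaternion.imJ_mul, Quaternion.imK_mul]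
    at h1 h2 h3 h4
  simp [quatJ] at h1 h2 h3 h4
  exact ⟨Complex.ext h1 h2, Complex.ext h3 h4⟩

theorem quat_eta (q : ℍ[ℝ]) : quat ⟨q.re, q.imI⟩ ⟨q.imJ, -q.imK⟩ = q := by
  ext <;> simp [quat, Quaternion.re_mul, Quaternion.imI_mul, Quaternion.imJ_mul,
    Quaternion.imK_mul] <;> simp [quatJ]

theorem quat_mul (u w x y : ℂ) :
    quat u w * quat x y = quat (u * x - conj w * y) (w * x + conj u * y) := by
  ext <;> simp [quat, Quaternion.re_mul, Quaternion.imI_mul, Quaternion.imJ_mul,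
    Quaternion.imK_mul] <;> simp [quatJ] <;> ring

theorem quat_add (u w x y : ℂ) : quat u w + quat x y = quat (u + x) (w + y) := by
  ext <;> simp [quat, Quaternion.re_mul, Quaternion.imI_mul, Quaternion.imJ_mul,
    Quaternion.imK_mul] <;> simp [quatJ]
  ring

/-- A matrix that commutes with `J` acts on `ℂ⁴ = ℍ²` as a quaternionic matrix, because `J` is right
multiplication by the unit `j` of `ℍ`. -/
theorem exists_quaternionic_entries (A : Matrix (Fin 4) (Fin 4) ℂ)
    (hA : ∀ z, A.mulVec (J z) = J (A.mulVec z)) :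
    ∃ p q r s : ℍ[ℝ], ∀ z : Fin 4 → ℂ,
      quat (A.mulVec z 0) (A.mulVec z 1) = p * quat (z 0) (z 1) + q * quat (z 2) (z 3) ∧
      quat (A.mulVec z 2) (A.mulVec z 3) = r * quat (z 0) (z 1) + s * quat (z 2) (z 3) := by
  refine ⟨quat (A 0 0) (A 1 0), quat (A 0 2) (A 1 2), quat (A 2 0) (A 3 0), quat (A 2 2) (A 3 2),
    fun z => ?_⟩
  have h0 := hA ![1, 0, 0, 0]
  have h2 := hA ![0, 0, 1, 0]
  have e0 : J ![1, 0, 0, 0] = ![0, 1, 0, 0] := by ext i; fin_cases i <;> simp [J]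
  have e2 : J ![0, 0, 1, 0] = ![0, 0, 0, 1] := by ext i; fin_cases i <;> simp [J]
  rw [e0] at h0
  rw [e2] at h2
  have k := fun i => congrFun h0 i
  have l := fun i => congrFun h2 i
  have k0 := k 0; have k1 := k 1; have k2 := k 2; have k3 := k 3
  have l0 := l 0; have l1 := l 1; have l2 := l 2; have l3 := l 3
  simp [J_apply_zero, J_apply_one, J_apply_two, J_apply_three, Matrix.mulVec, dotProduct,
    Fin.sum_univ_four] at k0 k1 k2 k3 l0 l1 l2 l3
  simp only [quat_mul, quat_add, Matrix.mulVec, dotProduct, Fin.sum_univ_four, k0, k1, k2, k3,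
    l0, l1, l2, l3]
  constructor <;> congr 1 <;> ring

/-- The null vector `(2 q₁ q̄₀, |q₀|² - |q₁|²; |q₀|² + |q₁|²)` above the point `[q₀ : q₁]`. -/
def nullVector (q₀ q₁ : ℍ[ℝ]) : E5 × ℝ :=
  (!₂[2 * (q₁ * star q₀).re, 2 * (q₁ * star q₀).imI, 2 * (q₁ * star q₀).imJ,
    2 * (q₁ * star q₀).imK, ‖q₀‖ ^ 2 - ‖q₁‖ ^ 2], ‖q₀‖ ^ 2 + ‖q₁‖ ^ 2)

theorem sum_sq_pos {q₀ q₁ : ℍ[ℝ]} (h : q₀ ≠ 0 ∨ q₁ ≠ 0) : 0 < ‖q₀‖ ^ 2 + ‖q₁‖ ^ 2 := by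
  rcases h with h | h
  · have := norm_pos_iff.mpr h; positivity
  · have := norm_pos_iff.mpr h; positivity

theorem nullVector_eq {q₀ q₁ : ℍ[ℝ]} (h : q₀ ≠ 0 ∨ q₁ ≠ 0) :
    nullVector q₀ q₁ = (‖q₀‖ ^ 2 + ‖q₁‖ ^ 2) • (hopf q₀ q₁, 1) := by
  have := (sum_sq_pos h).ne'
  simp [nullVector, hopf, smul_smul, this]

theorem norm_quaternion_sq (q : ℍ[ℝ]) :
    ‖q‖ ^ 2 = q.re ^ 2 + q.imI ^ 2 + q.imJ ^ 2 + q.imK ^ 2 := by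
  rw [← Quaternion.normSq_eq_norm_mul_self q |>.trans (sq _).symm, Quaternion.normSq_def']

/-- The quaternion with the given real coordinates. -/
def ofCoords (a b c d : ℝ) : ℍ[ℝ] := ⟨a, b, c, d⟩

@[simp] theorem ofCoords_re (a b c d : ℝ) : (ofCoords a b c d).re = a := rfl
@[simp] theorem ofCoords_imI (a b c d : ℝ) : (ofCoords a b c d).imI = b := rfl
@[simp] theorem ofCoords_imJ (a b c d : ℝ) : (ofCoords a b c d).imJ = c := rfl
@[simp] theorem ofCoords_imK (a b c d : ℝ) : (ofCoords a b c d).imK = d := rfl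

/-- The entries `(|q₀|², |q₁|², q₁ q̄₀)` of the quaternionic Hermitian matrix attached to a vector
of `ℝ⁵ × ℝ`; they are read off from `nullVector q₀ q₁`. -/
def hermEntries : E5 × ℝ →ₗ[ℝ] ℝ × ℝ × ℍ[ℝ] where
  toFun x := ((x.2 + x.1 4) / 2, (x.2 - x.1 4) / 2,
    ofCoords (x.1 0 / 2) (x.1 1 / 2) (x.1 2 / 2) (x.1 3 / 2))
  map_add' x y := by
    ext <;> simp <;> ring
  map_smul' c x := by
    ext <;> simp <;> ring

/-- The inverse of `hermEntries`. -/
def ofHermEntries : ℝ × ℝ × ℍ[ℝ] →ₗ[ℝ] E5 × ℝ where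
  toFun x := (!₂[2 * x.2.2.re, 2 * x.2.2.imI, 2 * x.2.2.imJ, 2 * x.2.2.imK, x.1 - x.2.1],
    x.1 + x.2.1)
  map_add' x y := by
    ext i
    · fin_cases i <;> simp <;> ring
    · simp; ring
  map_smul' c x := by
    ext i
    · fin_cases i <;> simp <;> ring
    · simp; ring

/-- The map `X ↦ M X M*` on quaternionic Hermitian matrices, for `M = (p q; r s)`. -/
def hermMap (p q r s : ℍ[ℝ]) : ℝ × ℝ × ℍ[ℝ] →ₗ[ℝ] ℝ × ℝ × ℍ[ℝ] where
  toFun x := (x.1 * ‖p‖ ^ 2 + x.2.1 * ‖q‖ ^ 2 + 2 * (q * x.2.2 * star p).re,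
    x.1 * ‖r‖ ^ 2 + x.2.1 * ‖s‖ ^ 2 + 2 * (s * x.2.2 * star r).re,
    x.1 • (r * star p) + x.2.1 • (s * star q) + s * x.2.2 * star p + r * star x.2.2 * star q)
  map_add' x y := by
    refine Prod.ext ?_ (Prod.ext ?_ ?_)
    · simp only [Prod.fst_add, Prod.snd_add, mul_add, add_mul, Quaternion.re_add]; ring
    · simp only [Prod.fst_add, Prod.snd_add, mul_add, add_mul, Quaternion.re_add]; ring
    · simp only [Prod.fst_add, Prod.snd_add, mul_add, add_mul, star_add, add_smul]; abel
  map_smul' c x := by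
    refine Prod.ext ?_ (Prod.ext ?_ ?_)
    · simp only [Prod.smul_fst, Prod.smul_snd, mul_smul_comm, smul_mul_assoc, Quaternion.re_smul,
        smul_eq_mul, RingHom.id_apply]; ring
    · simp only [Prod.smul_fst, Prod.smul_snd, mul_smul_comm, smul_mul_assoc, Quaternion.re_smul,
        smul_eq_mul, RingHom.id_apply]; ring
    · simp only [Prod.smul_fst, Prod.smul_snd, mul_smul_comm, smul_mul_assoc, Quaternion.star_smul,
        smul_eq_mul, RingHom.id_apply, smul_add, mul_smul]

theorem hermEntries_nullVector (q₀ q₁ : ℍ[ℝ]) :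
    hermEntries (nullVector q₀ q₁) = (‖q₀‖ ^ 2, ‖q₁‖ ^ 2, q₁ * star q₀) := by
  ext <;> simp [hermEntries, nullVector]

theorem ofHermEntries_apply (q₀ q₁ : ℍ[ℝ]) :
    ofHermEntries (‖q₀‖ ^ 2, ‖q₁‖ ^ 2, q₁ * star q₀) = nullVector q₀ q₁ := rfl

theorem self_mul_star_eq (q : ℍ[ℝ]) : q * star q = ((‖q‖ ^ 2 : ℝ) : ℍ[ℝ]) := by
  rw [Quaternion.self_mul_star, Quaternion.normSq_eq_norm_mul_self, sq]

theorem norm_add_sq_quaternion (x y : ℍ[ℝ]) :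
    ‖x + y‖ ^ 2 = ‖x‖ ^ 2 + ‖y‖ ^ 2 + 2 * (y * star x).re := by
  rw [norm_add_sq_real, Quaternion.inner_def, ← Quaternion.re_star (y * star x), star_mul,
    star_star]
  ring

/-- `hermMap` moves the Hermitian matrix of the vector `(q₀, q₁)` to that of its image under
`(p q; r s)`. -/
theorem hermMap_apply (p q r s q₀ q₁ : ℍ[ℝ]) :
    hermMap p q r s (‖q₀‖ ^ 2, ‖q₁‖ ^ 2, q₁ * star q₀) =
      (‖p * q₀ + q * q₁‖ ^ 2, ‖r * q₀ + s * q₁‖ ^ 2,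
        (r * q₀ + s * q₁) * star (p * q₀ + q * q₁)) := by
  have key : ∀ p q : ℍ[ℝ], ‖q₀‖ ^ 2 * ‖p‖ ^ 2 + ‖q₁‖ ^ 2 * ‖q‖ ^ 2 +
      2 * (q * (q₁ * star q₀) * star p).re = ‖p * q₀ + q * q₁‖ ^ 2 := fun p q => by
    rw [norm_add_sq_quaternion, norm_mul, norm_mul, star_mul, mul_pow, mul_pow]
    simp only [mul_assoc]
    ring
  refine Prod.ext (key p q) (Prod.ext (key r s) ?_)
  simp only [hermMap, LinearMap.coe_mk, AddHom.coe_mk, star_add, star_mul, star_star, mul_add,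
    add_mul]
  have h : ∀ a b c : ℍ[ℝ], a * c * (star c * star b) = (‖c‖ ^ 2) • (a * star b) := fun a b c => by
    rw [mul_assoc, ← mul_assoc c, self_mul_star_eq, ← Quaternion.coe_mul_eq_smul, ← mul_assoc,
      ← Quaternion.coe_commutes, mul_assoc]
  rw [h, h]
  simp only [mul_assoc]
  abel

/-- For a matrix commuting with `J`, a linear map of `ℝ⁵ × ℝ` that induces its action on null
vectors. -/
theorem exists_coneMap (A : Matrix (Fin 4) (Fin 4) ℂ)
    (hA : ∀ z, A.mulVec (J z) = J (A.mulVec z)) :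
    ∃ Λ : E5 × ℝ →ₗ[ℝ] E5 × ℝ, ∀ z : Fin 4 → ℂ,
      Λ (nullVector (quat (z 0) (z 1)) (quat (z 2) (z 3))) =
        nullVector (quat (A.mulVec z 0) (A.mulVec z 1)) (quat (A.mulVec z 2) (A.mulVec z 3)) := by
  obtain ⟨p, q, r, s, h⟩ := exists_quaternionic_entries A hA
  refine ⟨ofHermEntries.comp ((hermMap p q r s).comp hermEntries), fun z => ?_⟩
  rw [LinearMap.comp_apply, LinearMap.comp_apply, hermEntries_nullVector, hermMap_apply,
    ofHermEntries_apply, (h z).1, (h z).2]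

/-- Linear maps that agree on the null cone are equal: the null vectors span `ℝ⁵ × ℝ`. -/
theorem linearMap_ext_of_cone {T T' : E5 × ℝ →ₗ[ℝ] E5 × ℝ}
    (h : ∀ y : S4, T ((y : E5), 1) = T' ((y : E5), 1)) : T = T' := by
  have split : ∀ (T : E5 × ℝ →ₗ[ℝ] E5 × ℝ) (y : E5) (t : ℝ), T (y, t) = T (y, 0) + t • T (0, 1) :=
    fun T y t => by rw [← map_smul, ← map_add]; simp
  have hneg : ∀ (T : E5 × ℝ →ₗ[ℝ] E5 × ℝ) (y : E5), T (-y, 0) = -T (y, 0) := fun T y => by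
    rw [← map_neg]; simp
  have hunit : ∀ y : E5, ‖y‖ = 1 → T (y, 0) = T' (y, 0) ∧ T (0, 1) = T' (0, 1) := by
    intro y hy
    have h1 := h ⟨y, by simpa using hy⟩
    have h2 := h ⟨-y, by simpa using hy⟩
    simp only at h1 h2
    rw [split T, split T', one_smul, one_smul] at h1 h2
    rw [hneg, hneg] at h2
    have h4 : (2 : ℝ) • T (0, 1) = (2 : ℝ) • T' (0, 1) := by
      have h3 := congrArg₂ (· + ·) h1 h2
      rw [two_smul, two_smul]
      convert h3 using 1 <;> abel
    have h5 := smul_right_injective _ (two_ne_zero (α := ℝ)) h4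
    exact ⟨by rw [h5] at h1; exact add_right_cancel h1, h5⟩
  have hall : ∀ y : E5, T (y, 0) = T' (y, 0) := by
    intro y
    by_cases hy : y = 0
    · subst hy; rw [Prod.mk_zero_zero, map_zero, map_zero]
    · have hn : ‖y‖ ≠ 0 := norm_ne_zero_iff.mpr hy
      have h1 := (hunit (‖y‖⁻¹ • y) (by rw [norm_smul, norm_inv, norm_norm, inv_mul_cancel₀ hn])).1
      have hs : ∀ T : E5 × ℝ →ₗ[ℝ] E5 × ℝ, T (y, 0) = ‖y‖ • T (‖y‖⁻¹ • y, 0) := fun T => by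
        rw [← map_smul]; simp [smul_smul, hn]
      rw [hs T, hs T', h1]
  have h01 := (hunit (EuclideanSpace.single 0 1) (by simp)).2
  refine LinearMap.ext fun x => ?_
  rw [← Prod.mk.eta (p := x), split T, split T', hall, h01]

/-! ### The quaternionic chart -/

theorem hopf_one_coord (q : ℍ[ℝ]) : hopf 1 q = (1 + ‖q‖ ^ 2)⁻¹ •
    !₂[2 * q.re, 2 * q.imI, 2 * q.imJ, 2 * q.imK, 1 - ‖q‖ ^ 2] := by
  simp [hopf]

theorem hopf_eq_hopf_one_iff {q₀ q₁ : ℍ[ℝ]} (h : q₀ ≠ 0 ∨ q₁ ≠ 0) (q : ℍ[ℝ]) :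
    hopf q₀ q₁ = hopf 1 q ↔ q₁ = q * q₀ := by
  constructor
  · intro he
    have hN := sum_sq_pos h
    have hM : 0 < 1 + ‖q‖ ^ 2 := by positivity
    have h1 : nullVector q₀ q₁ = ((‖q₀‖ ^ 2 + ‖q₁‖ ^ 2) / (1 + ‖q‖ ^ 2)) • nullVector 1 q := by
      rw [nullVector_eq h, nullVector_eq (Or.inl one_ne_zero), he, smul_smul]
      congr 1
      simp [hM.ne']
    have h2 := congrArg hermEntries h1
    rw [map_smul, hermEntries_nullVector, hermEntries_nullVector] at h2
    have h3 := congrArg Prod.fst h2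
    have h4 := congrArg (fun x => x.2.2) h2
    simp at h3 h4
    rw [← h3] at h4
    have hq0 : q₀ ≠ 0 := by
      rintro rfl
      simp at h3
      have h6 : ‖q₁‖ ^ 2 ≠ 0 := by simpa using h
      exact (div_ne_zero h6 hM.ne') h3.symm
    have h5 : q₁ * star q₀ = q * q₀ * star q₀ := by
      rw [h4, mul_assoc, self_mul_star_eq, ← Quaternion.coe_commutes, Quaternion.coe_mul_eq_smul]
    exact mul_right_cancel₀ (star_ne_zero.mpr hq0) h5
  · rintro rfl
    have hq0 : q₀ ≠ 0 := by
      rintro rfl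
      simp at h
    simpa using hopf_mul 1 q q₀ hq0

theorem hopf_one_injective : Function.Injective (hopf 1) := fun q q' h => by
  simpa using (hopf_eq_hopf_one_iff (Or.inl one_ne_zero) q').mp h

/-- Every point of the 4-sphere is `∞ = [0 : 1]` or lies in the quaternionic chart. -/
theorem exists_hopf_eq (p : S4) : (∃ q, (p : E5) = hopf 1 q) ∨ (p : E5) = hopf 0 1 := by
  have hp := norm_coe_S4 p
  rw [EuclideanSpace.norm_eq, Real.sqrt_eq_one, Fin.sum_univ_five] at hp
  simp only [Real.norm_eq_abs, sq_abs] at hp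
  set x : E5 := (p : E5)
  by_cases h4 : x 4 = -1
  · right
    rw [h4] at hp
    have h0 : x 0 = 0 := by
      nlinarith [sq_nonneg (x 0), sq_nonneg (x 1), sq_nonneg (x 2), sq_nonneg (x 3)]
    have h1 : x 1 = 0 := by
      nlinarith [sq_nonneg (x 0), sq_nonneg (x 1), sq_nonneg (x 2), sq_nonneg (x 3)]
    have h2 : x 2 = 0 := by
      nlinarith [sq_nonneg (x 0), sq_nonneg (x 1), sq_nonneg (x 2), sq_nonneg (x 3)]
    have h3 : x 3 = 0 := by
      nlinarith [sq_nonneg (x 0), sq_nonneg (x 1), sq_nonneg (x 2), sq_nonneg (x 3)]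
    ext i
    fin_cases i <;> simp [hopf, *]
  · left
    have hne : 1 + x 4 ≠ 0 := fun h => h4 (by linarith)
    refine ⟨ofCoords (x 0 / (1 + x 4)) (x 1 / (1 + x 4)) (x 2 / (1 + x 4)) (x 3 / (1 + x 4)), ?_⟩
    have hq : ‖ofCoords (x 0 / (1 + x 4)) (x 1 / (1 + x 4)) (x 2 / (1 + x 4))
        (x 3 / (1 + x 4))‖ ^ 2 = (1 - x 4) / (1 + x 4) := by
      rw [norm_quaternion_sq, ofCoords_re, ofCoords_imI, ofCoords_imJ, ofCoords_imK]
      field_simp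
      linear_combination hp
    have hs : (1 + ‖ofCoords (x 0 / (1 + x 4)) (x 1 / (1 + x 4)) (x 2 / (1 + x 4))
        (x 3 / (1 + x 4))‖ ^ 2)⁻¹ = (1 + x 4) / 2 := by
      rw [hq]; field_simp; ring
    rw [hopf_one_coord, hs, hq]
    ext i
    fin_cases i <;> simp <;> field_simp
    ring

theorem twistorProj_surjective : Function.Surjective twistorProj := by
  intro p
  rcases exists_hopf_eq p with ⟨q, hq⟩ | hq
  · refine ⟨Projectivization.mk ℂ ![1, 0, ⟨q.re, q.imI⟩, ⟨q.imJ, -q.imK⟩]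
      (fun h => by simpa using congrFun h 0), Subtype.ext ?_⟩
    have h1 : quat 1 0 = 1 := by simp [quat]
    rw [twistorProj_mk, hq]
    simp [quat_eta, h1]
  · refine ⟨Projectivization.mk ℂ ![0, 0, 1, 0]
      (fun h => by simpa using congrFun h 2), Subtype.ext ?_⟩
    have h1 : quat 1 0 = 1 := by simp [quat]
    have h0 : quat 0 0 = 0 := by simp [quat]
    rw [twistorProj_mk, hq]
    simp [h0, h1]

theorem nullVector_quat {z : Fin 4 → ℂ} (hz : z ≠ 0) :
    nullVector (quat (z 0) (z 1)) (quat (z 2) (z 3)) =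
      (‖quat (z 0) (z 1)‖ ^ 2 + ‖quat (z 2) (z 3)‖ ^ 2) •
        ((twistorProj (Projectivization.mk ℂ z hz) : E5), 1) := by
  rw [twistorProj_mk, nullVector_eq (quat_ne_zero z hz)]

/-- The symmetry group acts on the 4-sphere by conformal diffeomorphisms, compatibly with the
twistor projection. -/
theorem exists_conformal_of_commutes_j (g : PGL(4, ℂ)) (hg : ∀ x : CP3, g • j x = j (g • x)) :
    ∃ F : S4 ≃ₘ^∞⟮𝓡 4, 𝓡 4⟯ S4, IsConformal F ∧
      ∀ x, F (twistorProj x) = twistorProj (g • x) := by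
  obtain ⟨A, rfl, hA⟩ := exists_GL_commuting_J g hg
  have hinv : ∀ z, A.1.mulVec (A⁻¹.1.mulVec z) = z := fun z => by
    rw [Matrix.mulVec_mulVec]; simp
  have hinv' : ∀ z, A⁻¹.1.mulVec (A.1.mulVec z) = z := fun z => by
    rw [Matrix.mulVec_mulVec]; simp
  have hA' : ∀ z, A⁻¹.1.mulVec (J z) = J (A⁻¹.1.mulVec z) := fun z => by
    conv_lhs => rw [← hinv z, ← hA, hinv']
  obtain ⟨Λ, hΛ⟩ := exists_coneMap A.1 hA
  obtain ⟨Λ', hΛ'⟩ := exists_coneMap A⁻¹.1 hA'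
  have id_of : ∀ T : E5 × ℝ →ₗ[ℝ] E5 × ℝ, (∀ z : Fin 4 → ℂ,
      T (nullVector (quat (z 0) (z 1)) (quat (z 2) (z 3))) =
        nullVector (quat (z 0) (z 1)) (quat (z 2) (z 3))) → T = LinearMap.id := by
    intro T hT
    refine linearMap_ext_of_cone fun y => ?_
    obtain ⟨x, rfl⟩ := twistorProj_surjective y
    induction x using Projectivization.ind with | h z hz =>
    have h1 := hT z
    rw [nullVector_quat hz, map_smul] at h1
    exact smul_right_injective _ (sum_sq_pos (quat_ne_zero z hz)).ne' h1
  let E : (E5 × ℝ) ≃ₗ[ℝ] (E5 × ℝ) := LinearEquiv.ofLinearMap Λ Λ'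
    (id_of _ fun z => by rw [LinearMap.comp_apply, hΛ', hΛ, hinv])
    (id_of _ fun z => by rw [LinearMap.comp_apply, hΛ, hΛ', hinv'])
  have hpos : ∀ (T : E5 × ℝ →ₗ[ℝ] E5 × ℝ) (A : GL (Fin 4) ℂ), (∀ z : Fin 4 → ℂ,
      T (nullVector (quat (z 0) (z 1)) (quat (z 2) (z 3))) = nullVector
        (quat (A.1.mulVec z 0) (A.1.mulVec z 1)) (quat (A.1.mulVec z 2) (A.1.mulVec z 3))) →
      ∀ x : CP3, ∃ c : ℝ, c ≠ 0 ∧ T ((twistorProj x : E5), 1) =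
        c • ((twistorProj ((Matrix.ProjGenLinGroup.mk A : PGL(4, ℂ)) • x) : E5), 1) := by
    intro T A hT x
    induction x using Projectivization.ind with | h z hz =>
    obtain ⟨h0, h1⟩ := mk_GL_smul A z hz
    rw [h1]
    have h2 := hT z
    rw [nullVector_quat hz, nullVector_quat h0, map_smul] at h2
    have hN := (sum_sq_pos (quat_ne_zero z hz)).ne'
    have hM := (sum_sq_pos (quat_ne_zero _ h0)).ne'
    refine ⟨(‖quat (z 0) (z 1)‖ ^ 2 + ‖quat (z 2) (z 3)‖ ^ 2)⁻¹ * _,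
      mul_ne_zero (inv_ne_zero hN) hM, ?_⟩
    rw [mul_smul, ← h2, smul_smul, inv_mul_cancel₀ hN, one_smul]
  -- the image of a point does not depend on the chosen point of the twistor fibre
  have fib : ∀ (T : E5 × ℝ →ₗ[ℝ] E5 × ℝ) (A : GL (Fin 4) ℂ),
      (∀ x : CP3, ∃ c : ℝ, c ≠ 0 ∧ T ((twistorProj x : E5), 1) =
        c • ((twistorProj ((Matrix.ProjGenLinGroup.mk A : PGL(4, ℂ)) • x) : E5), 1)) →
      ∀ x y : CP3, twistorProj x = twistorProj y →
        twistorProj ((Matrix.ProjGenLinGroup.mk A : PGL(4, ℂ)) • x) =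
          twistorProj ((Matrix.ProjGenLinGroup.mk A : PGL(4, ℂ)) • y) := by
    intro T A hT x y hxy
    obtain ⟨c, hc, h1⟩ := hT x
    obtain ⟨d, hd, h2⟩ := hT y
    rw [hxy, h2] at h1
    have h3 := congrArg Prod.snd h1
    simp at h3
    subst h3
    have h4 := congrArg Prod.fst h1
    exact Subtype.ext (smul_right_injective _ hc h4).symm
  have fA := fib Λ A (hpos Λ A hΛ)
  have fA' := fib Λ' A⁻¹ (hpos Λ' A⁻¹ hΛ')
  have sec := Function.surjInv_eq twistorProj_surjective
  let f : S4 ≃ S4 :=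
    { toFun := fun y => twistorProj ((Matrix.ProjGenLinGroup.mk A : PGL(4, ℂ)) •
        Function.surjInv twistorProj_surjective y)
      invFun := fun y => twistorProj ((Matrix.ProjGenLinGroup.mk A⁻¹ : PGL(4, ℂ)) •
        Function.surjInv twistorProj_surjective y)
      left_inv := fun y => by
        change twistorProj (_ • _) = y
        rw [fA' _ _ (sec _), map_inv, inv_smul_smul, sec]
      right_inv := fun y => by
        change twistorProj (_ • _) = y
        rw [fA _ _ (sec _), map_inv, smul_inv_smul, sec] }
  obtain ⟨F, hF, hFf⟩ := exists_conformal_of_linearEquiv E f (fun y => by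
    have h := hpos Λ A hΛ (Function.surjInv twistorProj_surjective y)
    rw [sec] at h
    exact h)
  refine ⟨F, hF, fun x => ?_⟩
  rw [hFf]
  exact fA _ _ (sec _)

/-- Quadrics in the same orbit have conformally equivalent pairs `(D, Σ)`. -/
theorem conformallyEquivalent_smul (g : GjQ22) (S : Set CP3) :
    ConformallyEquivalent (discriminant S) Sig (discriminant (g • S)) Sig := by
  obtain ⟨F, hF, h⟩ := exists_conformal_of_commutes_j g.1 g.2.1
  have hinj : Function.Injective F := F.injective
  have hsurj : Function.Surjective F := F.surjective
  have hfib : ∀ p, twistorProj ⁻¹' {F p} ∩ g • S = g • (twistorProj ⁻¹' {p} ∩ S) := by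
    intro p
    rw [Set.smul_set_inter]
    congr 1
    ext x
    rw [Set.mem_smul_set_iff_inv_smul_mem]
    have h1 : twistorProj x = F (twistorProj (g⁻¹ • x)) := by
      rw [h]
      exact congrArg twistorProj (smul_inv_smul g x).symm
    simp only [Set.mem_preimage, Set.mem_singleton_iff, h1]
    exact hinj.eq_iff
  refine ⟨F, hF, ?_, ?_⟩
  · ext p
    obtain ⟨p, rfl⟩ := hsurj p
    rw [hinj.mem_set_image]
    simp only [discriminant, Set.mem_ofPred_eq, hfib]
    rw [← Set.image_smul, Function.Injective.encard_image (MulAction.injective g)]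
  · ext p
    obtain ⟨p, rfl⟩ := hsurj p
    rw [hinj.mem_set_image]
    obtain ⟨x, rfl⟩ := twistorProj_surjective p
    rw [h, ← Set.mem_preimage, ← Set.mem_preimage, preimage_Sig]
    conv_rhs => rw [← g.2.2]
    exact (Set.smul_mem_smul_set_iff (a := g.1)).symm

/-! ### Rigidity of conformal maps -/

/-- Euclidean 4-space, the source of the stereographic chart. -/
abbrev E4 : Type := EuclideanSpace ℝ (Fin 4)

section PartialDerivatives

variable {W : Type*} [NormedAddCommGroup W] [NormedSpace ℝ W]

/-- The partial derivative `∂ᵢF` of a map defined on `ℝ⁴`. -/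
def pd (i : Fin 4) (F : E4 → W) (x : E4) : W := fderiv ℝ F x (EuclideanSpace.single i 1)

theorem contDiff_pd (i : Fin 4) {F : E4 → W} (hF : ContDiff ℝ ∞ F) : ContDiff ℝ ∞ (pd i F) :=
  (hF.fderiv_right (m := ∞) (by simp)).clm_apply contDiff_const

theorem ContDiff.differentiableAt_infty {F : E4 → W} (hF : ContDiff ℝ ∞ F) (x : E4) :
    DifferentiableAt ℝ F x :=
  hF.differentiable (by simp) x

theorem pd_comm (i j : Fin 4) {F : E4 → W} (hF : ContDiff ℝ ∞ F) :
    pd i (pd j F) = pd j (pd i F) := by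
  funext x
  have hd : DifferentiableAt ℝ (fderiv ℝ F) x :=
    (hF.fderiv_right (m := ∞) (by simp)).differentiable (by simp) x
  have key : ∀ k l : Fin 4, pd k (pd l F) x =
      fderiv ℝ (fderiv ℝ F) x (EuclideanSpace.single k 1) (EuclideanSpace.single l 1) := by
    intro k l
    have := (hd.hasFDerivAt.clm_apply (hasFDerivAt_const
      (EuclideanSpace.single l (1 : ℝ) : E4) x)).fderiv
    change fderiv ℝ (fun y => fderiv ℝ F y (EuclideanSpace.single l 1)) x _ = _
    rw [this]
    simp
  rw [key, key]
  exact (hF.contDiffAt.isSymmSndFDerivAt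
    (by
      rw [minSmoothness_of_isRCLikeNormedField]
      exact WithTop.coe_le_coe.2 (le_top (a := (2 : ℕ∞))))) _ _

theorem pd_smul (i : Fin 4) {b : E4 → ℝ} {F : E4 → W} {x : E4} (hb : DifferentiableAt ℝ b x)
    (hF : DifferentiableAt ℝ F x) :
    pd i (fun x => b x • F x) x = pd i b x • F x + b x • pd i F x := by
  simp [pd, fderiv_fun_smul hb hF, add_comm]

theorem pd_sub (i : Fin 4) {F G : E4 → W} {x : E4} (hF : DifferentiableAt ℝ F x)
    (hG : DifferentiableAt ℝ G x) : pd i (fun x => F x - G x) x = pd i F x - pd i G x := by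
  simp [pd, fderiv_fun_sub hF hG]

theorem pd_const (i : Fin 4) (w : W) (x : E4) : pd i (fun _ : E4 => w) x = 0 := by
  simp [pd]

theorem pd_coord (i k : Fin 4) (x : E4) : pd k (fun x : E4 => x i) x = if i = k then 1 else 0 := by
  have : HasFDerivAt (fun x : E4 => x i) (EuclideanSpace.proj i : E4 →L[ℝ] ℝ) x :=
    (EuclideanSpace.proj i : E4 →L[ℝ] ℝ).hasFDerivAt
  simp [pd, this.fderiv]

theorem eq_of_pd_eq_zero {F : E4 → W} (hF : Differentiable ℝ F) (h : ∀ i x, pd i F x = 0)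
    (x : E4) : F x = F 0 := by
  refine is_const_of_fderiv_eq_zero (𝕜 := ℝ) hF (fun x => ?_) x 0
  refine ContinuousLinearMap.coe_injective
    ((EuclideanSpace.basisFun (Fin 4) ℝ).toBasis.ext fun i => ?_)
  simpa [pd] using h i x

end PartialDerivatives

theorem hasFDerivAt_lorentz {F G : E4 → E5 × ℝ} {x : E4} (hF : DifferentiableAt ℝ F x)
    (hG : DifferentiableAt ℝ G x) (u : E4) :
    fderiv ℝ (fun x => lorentz (F x) (G x)) x u =
      lorentz (fderiv ℝ F x u) (G x) + lorentz (F x) (fderiv ℝ G x u) := by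
  have h1 := hF.hasFDerivAt.fst
  have h2 := hF.hasFDerivAt.snd
  have h3 := hG.hasFDerivAt.fst
  have h4 := hG.hasFDerivAt.snd
  have h5 := (h1.inner ℝ h3).sub (h2.mul h4)
  have h6 : (fun x => lorentz (F x) (G x)) =
      fun x => inner ℝ (F x).1 (G x).1 - (F x).2 * (G x).2 := by
    funext y; rw [lorentz_apply]
  rw [h6]
  refine (congrArg (fun A : E4 →L[ℝ] ℝ => A u) h5.fderiv).trans ?_
  simp [lorentz_apply]
  ring

theorem pd_lorentz (i : Fin 4) {F G : E4 → E5 × ℝ} (hF : ContDiff ℝ ∞ F) (hG : ContDiff ℝ ∞ G)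
    (x : E4) : pd i (fun x => lorentz (F x) (G x)) x =
      lorentz (pd i F x) (G x) + lorentz (F x) (pd i G x) :=
  hasFDerivAt_lorentz (hF.differentiableAt_infty x) (hG.differentiableAt_infty x) _

/-- If `φ` is null and `h` is an orthonormal family of four vectors orthogonal to `φ`, then the
orthogonal complement of all of them is the line of `φ`. -/
theorem eq_smul_of_lorentz_orthogonal (φ w : E5 × ℝ) (h : Fin 4 → E5 × ℝ)
    (hφ : lorentz φ φ = 0) (hφ2 : φ.2 ≠ 0) (hhφ : ∀ k, lorentz (h k) φ = 0)
    (hh : ∀ k l, lorentz (h k) (h l) = if k = l then 1 else 0) (hwφ : lorentz w φ = 0)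
    (hwh : ∀ k, lorentz w (h k) = 0) : w = (w.2 / φ.2) • φ := by
  -- project everything to the tangent space of the sphere at `G`
  set G : E5 := φ.2⁻¹ • φ.1 with hG
  have hGG : inner ℝ G G = (1 : ℝ) := by
    rw [lorentz_apply] at hφ
    rw [hG, inner_smul_left, inner_smul_right]
    have : inner ℝ φ.1 φ.1 = φ.2 * φ.2 := by linarith
    rw [this]; simp [hφ2]
  have hG2 : ∀ v : E5 × ℝ, lorentz v φ = 0 → inner ℝ v.1 G = v.2 := fun v hv => by
    rw [lorentz_apply] at hv
    rw [hG, inner_smul_right]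
    have : inner ℝ v.1 φ.1 = v.2 * φ.2 := by linarith
    rw [this]; field_simp
  let P : E5 × ℝ → E5 := fun v => v.1 - v.2 • G
  have hPG : ∀ v : E5 × ℝ, lorentz v φ = 0 → inner ℝ (P v) G = 0 := fun v hv => by
    simp only [P, inner_sub_left, inner_smul_left, hGG, hG2 v hv]; simp
  have hPP : ∀ v v' : E5 × ℝ, lorentz v φ = 0 → lorentz v' φ = 0 →
      inner ℝ (P v) (P v') = lorentz v v' := fun v v' hv hv' => by
    have h1 := hG2 v' hv'
    rw [real_inner_comm] at h1
    simp only [P, inner_sub_left, inner_sub_right, inner_smul_left, inner_smul_right, hGG, hG2 v hv,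
      h1, lorentz_apply]
    simp
  let b : Option (Fin 4) → E5 := fun o => o.elim G (fun k => P (h k))
  have hb : Orthonormal ℝ b := by
    rw [orthonormal_iff_ite]
    rintro (_ | k) (_ | l)
    · simpa [b] using hGG
    · simpa [b, real_inner_comm] using hPG _ (hhφ l)
    · simpa [b] using hPG _ (hhφ k)
    · simp [b, hPP _ _ (hhφ k) (hhφ l), hh]
  have hspan := hb.linearIndependent.span_eq_top_of_card_eq_finrank' (by simp)
  have hzero : P w = 0 := by
    have h1 : ∀ v ∈ Submodule.span ℝ (Set.range b), inner ℝ (P w) v = 0 := by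
      intro v hv
      induction hv using Submodule.span_induction with
      | mem v hv =>
        obtain ⟨o, rfl⟩ := hv
        rcases o with _ | k
        · exact hPG w hwφ
        · exact (hPP w (h k) hwφ (hhφ k)).trans (hwh k)
      | zero => simp
      | add x y _ _ hx hy => rw [inner_add_right, hx, hy, add_zero]
      | smul a x _ hx => rw [inner_smul_right, hx, mul_zero]
    exact inner_self_eq_zero.mp (h1 _ (hspan ▸ Submodule.mem_top))
  refine Prod.ext ?_ ?_
  · have h1 : w.1 = w.2 • G := sub_eq_zero.mp hzero
    rw [h1, hG, smul_smul, Prod.smul_fst, div_eq_mul_inv]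
  · simp [hφ2]

theorem exists_ne_ne (i j : Fin 4) : ∃ k, k ≠ i ∧ k ≠ j := by
  revert i j; decide

/-- A null map `F : ℝ⁴ → ℝ⁵ × ℝ` that is isometric for the flat metric is a quadratic polynomial:
its mixed second derivatives vanish and the pure ones agree and are constant. -/
theorem isometric_null_map_quadratic (F : E4 → E5 × ℝ) (hF : ContDiff ℝ ∞ F)
    (h2 : ∀ x, (F x).2 ≠ 0) (hnull : ∀ x, lorentz (F x) (F x) = 0)
    (hiso : ∀ x i j, lorentz (pd i F x) (pd j F x) = if i = j then 1 else 0) :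
    ∃ (F₀ M : E5 × ℝ) (a : Fin 4 → E5 × ℝ),
      (∀ x, F x = F₀ + ∑ i, x i • a i + (‖x‖ ^ 2 / 2) • M) ∧
      lorentz F₀ F₀ = 0 ∧ lorentz M M = 0 ∧ lorentz F₀ M = -1 ∧ (∀ i, lorentz F₀ (a i) = 0) ∧
      (∀ i, lorentz M (a i) = 0) ∧ ∀ i j, lorentz (a i) (a j) = if i = j then 1 else 0 := by
  have c1 : ∀ i, ContDiff ℝ ∞ (pd i F) := fun i => contDiff_pd i hF
  have c2 : ∀ i j, ContDiff ℝ ∞ (pd i (pd j F)) := fun i j => contDiff_pd i (c1 j)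
  -- first and second derivatives of the two hypotheses
  have e1 : ∀ i x, lorentz (pd i F x) (F x) = 0 := fun i x => by
    have h := pd_lorentz i hF hF x
    simp only [hnull, pd_const] at h
    rw [lorentz_comm (F x)] at h
    linarith
  have e2 : ∀ i j x, lorentz (pd i (pd j F) x) (F x) = -if i = j then 1 else 0 := fun i j x => by
    have h := pd_lorentz i (c1 j) hF x
    simp only [e1, pd_const] at h
    rw [hiso] at h
    have hs : (if i = j then (1 : ℝ) else 0) = if j = i then 1 else 0 := by simp only [eq_comm]
    linarith
  -- these products are symmetric in `i`, `j` and antisymmetric in `j`, `k`, so they vanish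
  have e3 : ∀ i j k x, lorentz (pd i (pd j F) x) (pd k F x) = 0 := by
    intro i j k x
    have anti : ∀ i j k, lorentz (pd i (pd j F) x) (pd k F x) =
        -lorentz (pd i (pd k F) x) (pd j F x) := fun i j k => by
      have h := pd_lorentz i (c1 j) (c1 k) x
      simp only [hiso, pd_const] at h
      rw [lorentz_comm (pd j F x)] at h
      linarith
    have h1 := anti i j k
    have h2 := anti k i j
    have h3 := anti j k i
    rw [pd_comm i k hF] at h1
    rw [pd_comm k j hF] at h2
    rw [pd_comm j i hF] at h3
    linarith
  have span : ∀ x w, lorentz w (F x) = 0 → (∀ k, lorentz w (pd k F x) = 0) →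
      w = (w.2 / (F x).2) • F x := fun x w hw hw' =>
    eq_smul_of_lorentz_orthogonal (F x) w (fun k => pd k F x) (hnull x) (h2 x) (fun k => e1 k x)
      (hiso x) hw hw'
  have ratio : ∀ G : E4 → E5 × ℝ, ContDiff ℝ ∞ G → ContDiff ℝ ∞ (fun x => (G x).2 / (F x).2) :=
    fun G hG => (contDiff_snd.comp hG).div (contDiff_snd.comp hF) h2
  have dsmul : ∀ (b : E4 → ℝ) (k : Fin 4) (x : E4), ContDiff ℝ ∞ b →
      pd k (fun x => b x • F x) x = pd k b x • F x + b x • pd k F x := fun b k x hb =>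
    pd_smul k (hb.differentiableAt_infty x) (hF.differentiableAt_infty x)
  -- mixed second derivatives vanish: `∂ᵢ∂ⱼF` and `∂ᵢ∂ₖF` are multiples of `F`; compare the
  -- components along `∂ₖF` of the two expressions for the third derivative
  have e4 : ∀ i j, i ≠ j → pd i (pd j F) = fun _ => 0 := by
    intro i j hij
    obtain ⟨k, hki, hkj⟩ := exists_ne_ne i j
    have hb := fun m l (hml : m ≠ l) => funext fun x => span x (pd m (pd l F) x)
      (by rw [e2, if_neg hml, neg_zero]) (fun k => e3 m l k x)
    have hbij := hb i j hij
    have hbik := hb i k hki.symm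
    have hcomm : pd k (pd i (pd j F)) = pd j (pd i (pd k F)) := by
      rw [pd_comm i j hF, pd_comm k j (c1 i), pd_comm k i hF]
    rw [hbij, hbik] at hcomm
    funext x
    have h3 := congrFun hcomm x
    rw [dsmul _ k x (ratio _ (c2 i j)), dsmul _ j x (ratio _ (c2 i k))] at h3
    have h4 := congrArg (fun w => lorentz w (pd k F x)) h3
    have e1' : lorentz (F x) (pd k F x) = 0 := by rw [lorentz_comm, e1]
    simp [e1', hiso, hkj.symm] at h4
    rw [hbij]
    simp only
    rcases h4 with h4 | h4
    · rw [h4]; simp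
    · exact absurd h4 (h2 x)
  -- pure second derivatives agree
  have e5 : ∀ i j, i ≠ j → pd i (pd i F) = pd j (pd j F) := by
    intro i j hij
    obtain ⟨k, hki, hkj⟩ := exists_ne_ne i j
    have hb := funext fun x => span x (pd i (pd i F) x - pd j (pd j F) x)
      (by rw [map_sub, LinearMap.sub_apply, e2, e2]; simp)
      (fun k => by rw [map_sub, LinearMap.sub_apply, e3, e3, sub_zero])
    have hz : ∀ m, k ≠ m → pd k (pd m (pd m F)) = fun _ => 0 := fun m hm => by
      rw [pd_comm k m (c1 m), e4 k m hm]
      funext x; exact pd_const _ _ _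
    funext x
    have h3 := congrFun (congrArg (pd k) hb) x
    rw [pd_sub k ((c2 i i).differentiableAt_infty x) ((c2 j j).differentiableAt_infty x), hz i hki,
      hz j hkj, dsmul _ k x (ratio (fun x => pd i (pd i F) x - pd j (pd j F) x)
        ((c2 i i).sub (c2 j j)))] at h3
    have h4 := congrArg (fun w => lorentz w (pd k F x)) h3
    have e1' : lorentz (F x) (pd k F x) = 0 := by rw [lorentz_comm, e1]
    simp only [sub_zero, map_zero, LinearMap.zero_apply, map_add, map_smul, LinearMap.add_apply,
      LinearMap.smul_apply, e1', hiso, if_true, smul_eq_mul, mul_one, mul_zero, zero_add] at h4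
    have h5 := congrFun hb x
    rw [← h4, zero_smul] at h5
    exact sub_eq_zero.mp h5
  -- and are constant
  set M : E5 × ℝ := pd 0 (pd 0 F) 0 with hM
  have e6 : ∀ i x, pd i (pd i F) x = M := by
    have h0 : ∀ i, pd i (pd i F) = pd 0 (pd 0 F) := fun i => by
      by_cases hi : i = 0
      · rw [hi]
      · exact e5 i 0 hi
    intro i x
    rw [h0]
    refine eq_of_pd_eq_zero ((c2 0 0).differentiable (by simp)) (fun k x => ?_) x
    obtain ⟨m, hm, -⟩ := exists_ne_ne k k
    rw [← h0 m, pd_comm k m (c1 m), e4 k m hm.symm, pd_const]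
  set a : Fin 4 → E5 × ℝ := fun i => pd i F 0 with ha
  have dcoord : ∀ (i : Fin 4) (x : E4), DifferentiableAt ℝ (fun x : E4 => x i) x := fun i x =>
    (EuclideanSpace.proj i : E4 →L[ℝ] ℝ).differentiableAt
  have e7 : ∀ i x, pd i F x = a i + x i • M := by
    intro i x
    have hd : ∀ x, DifferentiableAt ℝ (fun x : E4 => x i • M) x := fun x =>
      (dcoord i x).smul_const M
    have h := eq_of_pd_eq_zero (F := fun x => pd i F x - x i • M)
      (fun x => ((c1 i).differentiableAt_infty x).sub (hd x)) (fun k x => by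
        rw [pd_sub k ((c1 i).differentiableAt_infty x) (hd x),
          pd_smul k (dcoord i x) (differentiableAt_const M), pd_const, pd_coord]
        by_cases hik : i = k
        · subst hik; simp [e6]
        · rw [e4 k i (Ne.symm hik)]; simp [hik]) x
    simp only [PiLp.zero_apply, zero_smul, sub_zero] at h
    exact (sub_eq_iff_eq_add.mp h)
  have e8 : ∀ x, F x = F 0 + ∑ i, x i • a i + (‖x‖ ^ 2 / 2) • M := by
    intro x
    have hd : ∀ x : E4, HasFDerivAt (fun x : E4 => ∑ i, x i • a i + (‖x‖ ^ 2 / 2) • M)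
        (∑ i, (EuclideanSpace.proj i : E4 →L[ℝ] ℝ).smulRight (a i) +
          (((1 / 2 : ℝ) • (2 • innerSL ℝ x)).smulRight M)) x := fun x => by
      refine HasFDerivAt.add (HasFDerivAt.fun_sum fun i _ =>
        ((EuclideanSpace.proj i : E4 →L[ℝ] ℝ).hasFDerivAt).smul_const (a i)) ?_
      have h1 := ((hasStrictFDerivAt_norm_sq x).hasFDerivAt).const_mul (1 / 2 : ℝ)
      have h2 := h1.smul_const M
      refine h2.congr_of_eventuallyEq (Filter.Eventually.of_forall fun y => ?_)
      simp only; congr 1; ring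
    have h := eq_of_pd_eq_zero (F := fun x : E4 => F x - (∑ i, x i • a i + (‖x‖ ^ 2 / 2) • M))
      (fun x => (hF.differentiableAt_infty x).sub (hd x).differentiableAt) (fun k x => by
        rw [pd_sub k (hF.differentiableAt_infty x) (hd x).differentiableAt, e7]
        simp only [pd, (hd x).fderiv]
        simp [EuclideanSpace.inner_single_right, ite_smul]) x
    simp at h
    rw [add_assoc, ← h]; abel
  refine ⟨F 0, M, a, e8, hnull 0, ?_, ?_, fun i => ?_, fun i => ?_, fun i j => hiso 0 i j⟩
  · have h := e3 0 0 0 (EuclideanSpace.single 0 1)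
    have h' := e3 0 0 0 0
    rw [e6, e7] at h h'
    simp at h h'
    linarith
  · rw [hM, lorentz_comm, e2]; simp
  · rw [lorentz_comm]; exact e1 i 0
  · exact e3 0 0 i 0

/-! ### Liouville's theorem -/

/-- The quaternionic chart `q ↦ [1 : q]` of the 4-sphere, in real coordinates. -/
def chart (x : E4) : S4 :=
  ⟨hopf 1 (ofCoords (x 0) (x 1) (x 2) (x 3)), hopf_mem _ _ (Or.inl one_ne_zero)⟩

/-- The linear part of the lift of `chart` to the null cone. -/
def liftLinear : E4 →ₗ[ℝ] E5 × ℝ where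
  toFun x := (!₂[x 0, x 1, x 2, x 3, 0], 0)
  map_add' x y := by
    ext i
    · fin_cases i <;> simp
    · simp
  map_smul' c x := by
    ext i
    · fin_cases i <;> simp
    · simp

/-- The lift `(x, (1 - |x|²) / 2; (1 + |x|²) / 2)` of `chart` to the null cone; it is isometric for
the flat metric. -/
def lift (x : E4) : E5 × ℝ :=
  liftLinear x + (!₂[0, 0, 0, 0, 1 / 2], 1 / 2) + (‖x‖ ^ 2 / 2) • (!₂[0, 0, 0, 0, -1], 1)

theorem norm_sq_E4 (x : E4) : ‖x‖ ^ 2 = x 0 ^ 2 + x 1 ^ 2 + x 2 ^ 2 + x 3 ^ 2 := by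
  rw [EuclideanSpace.norm_sq_eq, Fin.sum_univ_four]
  simp

theorem norm_ofCoords (x : E4) : ‖ofCoords (x 0) (x 1) (x 2) (x 3)‖ ^ 2 = ‖x‖ ^ 2 := by
  rw [norm_quaternion_sq, norm_sq_E4]; rfl

theorem lift_eq (x : E4) :
    lift x = (!₂[x 0, x 1, x 2, x 3, (1 - ‖x‖ ^ 2) / 2], (1 + ‖x‖ ^ 2) / 2) := by
  ext i
  · fin_cases i <;> simp [lift, liftLinear]
    ring
  · simp [lift, liftLinear]; ring

theorem lift_eq_smul (x : E4) : lift x = ((1 + ‖x‖ ^ 2) / 2) • ((chart x : E5), 1) := by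
  have h : 1 + ‖x‖ ^ 2 ≠ 0 := by positivity
  rw [lift_eq]
  ext i
  · fin_cases i <;> simp [chart, hopf_one_coord, norm_ofCoords] <;> field_simp
  · simp

theorem lift_snd_pos (x : E4) : 0 < (lift x).2 := by
  rw [lift_eq]; positivity

theorem coe_chart_eq (x : E4) : (chart x : E5) = (lift x).2⁻¹ • (lift x).1 := by
  have h : (1 + ‖x‖ ^ 2) / 2 ≠ 0 := by positivity
  rw [lift_eq_smul]
  simp only [Prod.smul_fst, Prod.smul_snd, smul_eq_mul, mul_one]
  rw [smul_smul, inv_mul_cancel₀ h, one_smul]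

theorem hasFDerivAt_lift (x : E4) : HasFDerivAt lift (LinearMap.toContinuousLinearMap liftLinear +
    (((1 / 2 : ℝ) • (2 • innerSL ℝ x)).smulRight ((!₂[0, 0, 0, 0, -1], 1) : E5 × ℝ))) x := by
  refine HasFDerivAt.add ((LinearMap.toContinuousLinearMap liftLinear).hasFDerivAt.add_const _) ?_
  have h1 := ((hasStrictFDerivAt_norm_sq x).hasFDerivAt).const_mul (1 / 2 : ℝ)
  refine (h1.smul_const _).congr_of_eventuallyEq (Filter.Eventually.of_forall fun y => ?_)
  simp only; congr 1; ring

theorem contDiff_lift : ContDiff ℝ ∞ lift :=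
  ((LinearMap.toContinuousLinearMap liftLinear).contDiff.add contDiff_const).add
    (((contDiff_norm_sq ℝ).div_const 2).smul contDiff_const)

theorem lorentz_fderiv_lift (x u v : E4) :
    lorentz (fderiv ℝ lift x u) (fderiv ℝ lift x v) = inner ℝ u v := by
  have h : ∀ u, fderiv ℝ lift x u = liftLinear u + inner ℝ x u • (!₂[0, 0, 0, 0, -1], 1) :=
    fun u => by rw [(hasFDerivAt_lift x).fderiv]; simp
  rw [h, h]
  simp [lorentz_apply, liftLinear, PiLp.inner_apply, Fin.sum_univ_five, Fin.sum_univ_four]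
  ring

theorem contDiff_coe_chart : ContDiff ℝ ∞ (fun x => (chart x : E5)) := by
  have h : (fun x => (chart x : E5)) = fun x => (lift x).2⁻¹ • (lift x).1 := funext coe_chart_eq
  rw [h]
  exact ((contDiff_snd.comp contDiff_lift).inv (fun x => (lift_snd_pos x).ne')).smul
    (contDiff_fst.comp contDiff_lift)

theorem contMDiff_chart : ContMDiff 𝓘(ℝ, E4) (𝓡 4) ∞ chart :=
  have := fact_finrank_E5
  ContMDiff.codRestrict_sphere (n := 4) contDiff_coe_chart.contMDiff fun x => (chart x).2

/-- The Lorentzian products of the derivatives of a null lift `s (G, 1)` of a map `G` to the sphere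
are those of the derivatives of `G`, up to the factor `s²`. -/
theorem lorentz_fderiv_smul_null {s : E4 → ℝ} {G : E4 → E5} {x : E4} (hs : DifferentiableAt ℝ s x)
    (hG : DifferentiableAt ℝ G x) (h1 : ∀ x, ‖G x‖ = 1) (u v : E4) :
    lorentz (fderiv ℝ (fun x => s x • (G x, (1 : ℝ))) x u)
      (fderiv ℝ (fun x => s x • (G x, (1 : ℝ))) x v) =
      s x ^ 2 * inner ℝ (fderiv ℝ G x u) (fderiv ℝ G x v) := by
  have hd : ∀ u, fderiv ℝ (fun x => s x • (G x, (1 : ℝ))) x u =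
      fderiv ℝ s x u • (G x, (1 : ℝ)) + s x • (fderiv ℝ G x u, (0 : ℝ)) := fun u => by
    rw [(hs.hasFDerivAt.fun_smul (hG.hasFDerivAt.prodMk (hasFDerivAt_const (1 : ℝ) x))).fderiv]
    simp [add_comm]
  have hperp : ∀ u, inner ℝ (G x) (fderiv ℝ G x u) = 0 := fun u => by
    have h2 := (hG.hasFDerivAt.norm_sq).fderiv
    simp only [h1] at h2
    have h3 := congrArg (fun A : E4 →L[ℝ] ℝ => A u) h2
    simpa using h3.symm
  have hperp' : ∀ u, inner ℝ (fderiv ℝ G x u) (G x) = 0 := fun u => by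
    rw [real_inner_comm, hperp]
  have hG1 : inner ℝ (G x) (G x) = (1 : ℝ) := by rw [real_inner_self_eq_norm_sq, h1]; simp
  rw [hd, hd]
  simp only [lorentz_apply, Prod.fst_add, Prod.snd_add, Prod.smul_fst, Prod.smul_snd,
    inner_add_left, inner_add_right, inner_smul_left, inner_smul_right, hperp, hperp', hG1,
    smul_eq_mul]
  simp
  ring

theorem inner_fderiv_chart (x u v : E4) :
    (lift x).2 ^ 2 * inner ℝ (fderiv ℝ (fun x => (chart x : E5)) x u)
      (fderiv ℝ (fun x => (chart x : E5)) x v) = inner ℝ u v := by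
  have h : lift = fun x => (lift x).2 • ((chart x : E5), (1 : ℝ)) := by
    funext x
    have := lift_eq_smul x
    rw [this]
    simp
  rw [← lorentz_fderiv_lift x u v]
  conv_rhs => rw [h]
  exact (lorentz_fderiv_smul_null ((contDiff_snd.comp contDiff_lift).differentiable (by simp) x)
    (contDiff_coe_chart.differentiable (by simp) x) (fun x => norm_coe_S4 _) u v).symm

theorem norm_fderiv_chart (x u : E4) :
    ‖fderiv ℝ (fun x => (chart x : E5)) x u‖ = (lift x).2⁻¹ * ‖u‖ := by
  have h := inner_fderiv_chart x u u
  have hp := lift_snd_pos x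
  rw [real_inner_self_eq_norm_sq, real_inner_self_eq_norm_sq, ← mul_pow,
    sq_eq_sq₀ (by positivity) (by positivity)] at h
  rw [← h, inv_mul_cancel_left₀ hp.ne']

/-- In the chart, a conformal diffeomorphism has a derivative that is a similarity. -/
theorem exists_conformal_factor (f : S4 ≃ₘ^∞⟮𝓡 4, 𝓡 4⟯ S4) (hf : IsConformal f) (x : E4) :
    ∃ c : ℝ, 0 < c ∧ ∀ u, ‖fderiv ℝ (fun x => (f (chart x) : E5)) x u‖ = c * ‖u‖ := by
  obtain ⟨c, hc, h⟩ := hf (chart x)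
  have hp := lift_snd_pos x
  refine ⟨c * (lift x).2⁻¹, by positivity, fun u => ?_⟩
  have hch : MDifferentiableAt 𝓘(ℝ, E4) (𝓡 4) chart x :=
    contMDiff_chart.mdifferentiableAt (by simp)
  have h1 := mvfderiv_comp_vector (I' := 𝓘(ℝ, E4)) (g := fun y : S4 => (f y : E5)) (f := chart) x
    (mdifferentiableAt_coe_diffeo f (chart x)) hch u
  have h2 := mvfderiv_comp_vector (I' := 𝓘(ℝ, E4)) (g := fun y : S4 => (y : E5)) (f := chart) x
    (mdifferentiableAt_coe_S4 (chart x)) hch u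
  have e : ∀ G : E4 → E5, mvfderiv 𝓘(ℝ, E4) G x u = fderiv ℝ G x u := fun G => by
    simp only [mvfderiv, mfderiv_eq_fderiv]; rfl
  have h3 : fderiv ℝ (fun x => (f (chart x) : E5)) x u =
      mvfderiv (𝓡 4) (fun y : S4 => (f y : E5)) (chart x) (mfderiv 𝓘(ℝ, E4) (𝓡 4) chart x u) :=
    (e _).symm.trans h1
  have h4 : fderiv ℝ (fun x => (chart x : E5)) x u =
      mvfderiv (𝓡 4) (fun y : S4 => (y : E5)) (chart x) (mfderiv 𝓘(ℝ, E4) (𝓡 4) chart x u) :=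
    (e _).symm.trans h2
  rw [h3, h, ← h4, norm_fderiv_chart, mul_assoc]

theorem inner_of_similarity {T : E4 →L[ℝ] E5} {c : ℝ} (hT : ∀ u, ‖T u‖ = c * ‖u‖) (u v : E4) :
    inner ℝ (T u) (T v) = c ^ 2 * inner ℝ u v := by
  have h := hT (u + v)
  have h' := congrArg (· ^ 2) h
  simp only [map_add, mul_pow, norm_add_sq_real, hT] at h'
  linarith

/-- Liouville's theorem for the 4-sphere: a conformal diffeomorphism is induced by a linear
isometry of the Lorentzian form. (The point `[0 : 1]`, which the chart misses, is left out.) -/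
theorem exists_lorentz_of_conformal (f : S4 ≃ₘ^∞⟮𝓡 4, 𝓡 4⟯ S4) (hf : IsConformal f) :
    ∃ Λ : E5 × ℝ →ₗ[ℝ] E5 × ℝ, (∀ x y, lorentz (Λ x) (Λ y) = lorentz x y) ∧
      ∀ x : E4, ∃ c : ℝ, c ≠ 0 ∧ Λ (lift x) = c • ((f (chart x) : E5), 1) := by
  set G : E4 → E5 := fun x => (f (chart x) : E5) with hGdef
  have hG : ContDiff ℝ ∞ G := by
    have := fact_finrank_E5
    have h1 : ContMDiff (𝓡 4) 𝓘(ℝ, E5) ∞ (fun y : S4 => (f y : E5)) :=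
      (contMDiff_coe_sphere (n := 4)).comp f.contMDiff
    exact (h1.comp contMDiff_chart).contDiff
  have hG1 : ∀ x, ‖G x‖ = 1 := fun x => norm_coe_S4 _
  choose c hc hcG using exists_conformal_factor f hf
  have hpd : ∀ x, ‖pd 0 G x‖ = c x := fun x => by
    have := hcG x (EuclideanSpace.single 0 1)
    rw [PiLp.norm_single, norm_one, mul_one] at this
    exact this
  -- rescale the null lift of `G` by its conformal factor to make it isometric
  have hsmooth : ContDiff ℝ ∞ (fun x => ‖pd 0 G x‖⁻¹) := by
    have hne : ∀ x, pd 0 G x ≠ 0 := fun x => by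
      rw [← norm_ne_zero_iff, hpd]; exact (hc x).ne'
    exact ((contDiff_pd 0 hG).norm ℝ hne).inv fun x => norm_ne_zero_iff.mpr (hne x)
  obtain ⟨F₀, M, a, hF, h00, hMM, h0M, h0a, hMa, haa⟩ := isometric_null_map_quadratic
    (fun x => ‖pd 0 G x‖⁻¹ • (G x, (1 : ℝ))) (hsmooth.smul (hG.prodMk contDiff_const))
    (fun x => by simpa [hpd] using (hc x).ne')
    (fun x => by
      simp only [map_smul, LinearMap.smul_apply, lorentz_apply, real_inner_self_eq_norm_sq, hG1]
      simp)
    (fun x i j => by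
      refine (lorentz_fderiv_smul_null (hsmooth.differentiableAt_infty x)
        (hG.differentiableAt_infty x) hG1 _ _).trans ?_
      rw [inner_of_similarity (hcG x), hpd]
      have := (hc x).ne'
      rw [← mul_assoc, ← mul_pow, inv_mul_cancel₀ this]
      simp [EuclideanSpace.inner_single_left])
  -- the linear map that sends `lift x` to the quadratic polynomial `F x`
  let Λ : E5 × ℝ →ₗ[ℝ] E5 × ℝ :=
    { toFun := fun y => (y.2 + y.1 4) • F₀ + (y.1 0 • a 0 + y.1 1 • a 1 + y.1 2 • a 2 +
        y.1 3 • a 3) + ((y.2 - y.1 4) / 2) • M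
      map_add' := fun y y' => by
        simp only [Prod.fst_add, Prod.snd_add, PiLp.add_apply]; module
      map_smul' := fun t y => by
        simp only [Prod.smul_fst, Prod.smul_snd, PiLp.smul_apply, smul_eq_mul, RingHom.id_apply]
        module }
  have hΛ : ∀ y, Λ y = (y.2 + y.1 4) • F₀ + (y.1 0 • a 0 + y.1 1 • a 1 + y.1 2 • a 2 +
      y.1 3 • a 3) + ((y.2 - y.1 4) / 2) • M := fun y => rfl
  refine ⟨Λ, fun x y => ?_, fun x => ⟨‖pd 0 G x‖⁻¹, by simpa [hpd] using (hc x).ne', ?_⟩⟩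
  · have ha0 : ∀ i, lorentz (a i) F₀ = 0 := fun i => by rw [lorentz_comm, h0a]
    have haM : ∀ i, lorentz (a i) M = 0 := fun i => by rw [lorentz_comm, hMa]
    have hM0 : lorentz M F₀ = -1 := by rw [lorentz_comm, h0M]
    rw [hΛ, hΛ]
    simp only [map_add, map_smul, LinearMap.add_apply, LinearMap.smul_apply, smul_eq_mul, h00, hMM,
      h0M, h0a, hMa, haa, ha0, haM, hM0]
    rw [lorentz_apply, PiLp.inner_apply, Fin.sum_univ_five]
    simp
    ring
  · rw [hF x, hΛ, lift_eq, Fin.sum_univ_four]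
    simp
    module

/-! ### Invariance of the inversive distance -/

theorem planarPoint_eq_chart (z : ℂ) : planarPoint z = chart !₂[z.re, z.im, 0, 0] := by
  refine Subtype.ext (congrArg (hopf 1) ?_)
  ext <;> simp

theorem chart_mem_Sig {x : E4} (hx : ‖x‖ = 1) : chart x ∈ Sig := by
  simp [Sig, chart, hopf_one_coord, norm_ofCoords, hx]

/-- A linear isometry of the Lorentzian form that preserves the hyperplane of `Σ` maps the normal
vector of `Σ` to plus or minus itself; hence it preserves, up to sign, the product `y.1 4` with this
vector. -/
theorem apply_four_of_preserves_Sig (Λ : E5 × ℝ →ₗ[ℝ] E5 × ℝ)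
    (hΛ : ∀ x y, lorentz (Λ x) (Λ y) = lorentz x y)
    (hS : ∀ x : E4, ‖x‖ = 1 → (Λ (lift x)).1 4 = 0) (y : E5 × ℝ) :
    ((Λ y).1 4) ^ 2 = (y.1 4) ^ 2 := by
  set e : E5 × ℝ := (EuclideanSpace.single 4 1, 0) with he
  have hBe : ∀ y, lorentz y e = y.1 4 := fun y => by
    simp [lorentz_apply, he, EuclideanSpace.inner_single_right]
  have hunit : ∀ x : E4, ‖x‖ = 1 → lift x = liftLinear x + (0, 1) := fun x hx => by
    rw [lift_eq, hx]
    ext i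
    · fin_cases i <;> simp [liftLinear]
    · simp [liftLinear]
  have hsplit : ∀ x : E4, ‖x‖ = 1 → (Λ (liftLinear x)).1 4 = 0 ∧ (Λ (0, 1)).1 4 = 0 := by
    intro x hx
    have h1 := hS x hx
    have h2 := hS (-x) (by simpa using hx)
    rw [hunit x hx] at h1
    rw [hunit (-x) (by simpa using hx)] at h2
    simp only [map_add, map_neg, Prod.fst_add, Prod.fst_neg, PiLp.add_apply, PiLp.neg_apply]
      at h1 h2
    constructor <;> linarith
  have htime := (hsplit (EuclideanSpace.single 0 1) (by simp)).2
  have hlin : ∀ x : E4, (Λ (liftLinear x)).1 4 = 0 := by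
    intro x
    by_cases hx : x = 0
    · simp [hx]
    · have hn : ‖x‖ ≠ 0 := norm_ne_zero_iff.mpr hx
      have h1 := (hsplit (‖x‖⁻¹ • x)
        (by rw [norm_smul, norm_inv, norm_norm, inv_mul_cancel₀ hn])).1
      rw [map_smul, map_smul] at h1
      simpa [hn] using h1
  have hφ : ∀ y, (Λ y).1 4 = y.1 4 * (Λ e).1 4 := by
    intro y
    have hy : y = liftLinear !₂[y.1 0, y.1 1, y.1 2, y.1 3] + y.2 • (0, 1) + y.1 4 • e := by
      ext i
      · fin_cases i <;> simp [liftLinear, he]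
      · simp [liftLinear, he]
    conv_lhs => rw [hy]
    rw [map_add, map_add, map_smul, map_smul]
    simp [hlin, htime]
  have hinj : Function.Injective Λ := by
    rw [← LinearMap.ker_eq_bot, LinearMap.ker_eq_bot']
    intro x hx
    have h1 : ∀ y, lorentz x y = 0 := fun y => by rw [← hΛ, hx]; simp
    have h2 := h1 (x.1, 0)
    have h3 := h1 (0, 1)
    simp [lorentz_apply] at h2 h3
    exact Prod.ext h2 h3
  obtain ⟨u, hu⟩ := LinearMap.surjective_of_injective hinj e
  have hu' : ∀ w, lorentz w u = w.1 4 * (Λ e).1 4 := fun w => by rw [← hΛ, hu, hBe, hφ]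
  have h1 : lorentz e u = u.1 4 := by rw [lorentz_comm, hBe]
  have h2 : lorentz u u = 1 := by rw [← hΛ, hu, hBe]; simp [he]
  have h3 := hu' e
  have h4 := hu' u
  rw [h1] at h3
  rw [h2] at h4
  have h5 : e.1 4 = 1 := by simp [he]
  rw [h5, one_mul] at h3
  rw [h3] at h4
  rw [hφ, mul_pow, sq ((Λ e).1 4), ← h4, mul_one]

/-- The Lorentzian normal vector of the 3-sphere `{|q - a| = r}`. -/
def sphereNormal (a r : ℝ) : E5 × ℝ :=
  (!₂[a / r, 0, 0, 0, (1 + r ^ 2 - a ^ 2) / (2 * r)], (1 - r ^ 2 + a ^ 2) / (2 * r))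

theorem lorentz_lift (u : E5 × ℝ) (x : E4) : lorentz u (lift x) =
    u.1 0 * x 0 + u.1 1 * x 1 + u.1 2 * x 2 + u.1 3 * x 3 +
      u.1 4 * ((1 - (x 0 ^ 2 + x 1 ^ 2 + x 2 ^ 2 + x 3 ^ 2)) / 2) -
      u.2 * ((1 + (x 0 ^ 2 + x 1 ^ 2 + x 2 ^ 2 + x 3 ^ 2)) / 2) := by
  rw [lift_eq, lorentz_apply, norm_sq_E4]
  simp [PiLp.inner_apply, Fin.sum_univ_five]
  ring

theorem lorentz_self (u : E5 × ℝ) : lorentz u u =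
    u.1 0 ^ 2 + u.1 1 ^ 2 + u.1 2 ^ 2 + u.1 3 ^ 2 + u.1 4 ^ 2 - u.2 ^ 2 := by
  rw [lorentz_apply, PiLp.inner_apply, Fin.sum_univ_five]
  simp
  ring

/-- A vector orthogonal to the null vectors of the circle `{|z - a| = r}` is a multiple of the
normal vector of `{|q - a| = r}` plus a vector orthogonal to the plane `ℂ`; if it is a unit vector,
its pairing with the normal vector of `Σ` is therefore bounded by the inversive distance. -/
theorem sq_le_of_orthogonal_planarCircle {a r : ℝ} (hr : 0 < r) (u : E5 × ℝ)
    (huu : lorentz u u = 1)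
    (hu : ∀ z : ℂ, ‖z - a‖ = r → lorentz u (lift !₂[z.re, z.im, 0, 0]) = 0) :
    (u.1 4) ^ 2 ≤ ((a ^ 2 - r ^ 2 - 1) / (2 * r)) ^ 2 := by
  have h1 := hu (a + r) (by simp [abs_of_pos hr])
  have h2 := hu (a - r) (by simp [abs_of_pos hr])
  have h3 := hu (a + r * Complex.I) (by simp [abs_of_pos hr])
  have h4 := hu (a - r * Complex.I) (by simp [abs_of_pos hr])
  rw [lorentz_lift] at h1 h2 h3 h4
  simp at h1 h2 h3 h4
  rw [lorentz_self] at huu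
  generalize u.1 0 = u0, u.1 1 = u1, u.1 2 = u2, u.1 3 = u3, u.1 4 = u4, u.2 = t at *
  have e0 : u0 = a * (u4 + t) := by
    apply mul_left_cancel₀ hr.ne'; linarith
  have e4 : u4 = (u4 + t) * r * ((1 + r ^ 2 - a ^ 2) / (2 * r)) := by
    field_simp
    rw [e0] at h1 h2
    linarith
  have e5 : u4 - t = (u4 + t) * (r ^ 2 - a ^ 2) := by
    rw [e0] at h1 h2
    linarith
  have hle : ((u4 + t) * r) ^ 2 ≤ 1 := by
    have : u4 ^ 2 - t ^ 2 = (u4 + t) * ((u4 + t) * (r ^ 2 - a ^ 2)) := by rw [← e5]; ring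
    rw [e0] at huu
    nlinarith [sq_nonneg u1, sq_nonneg u2, sq_nonneg u3]
  have e6 : ((a ^ 2 - r ^ 2 - 1) / (2 * r)) ^ 2 = ((1 + r ^ 2 - a ^ 2) / (2 * r)) ^ 2 := by
    rw [div_pow, div_pow]; congr 1; ring
  rw [e4, e6, mul_pow]
  exact mul_le_of_le_one_left (sq_nonneg _) hle

/-- The inversive distance does not decrease under conformal maps. The map moves the unit normal of
a 3-sphere through the first circle, orthogonal to the plane, to a unit normal of a 3-sphere through
the second one, with the same product with the normal of `Σ`, up to sign. -/
theorem inversive_le_of_conformal {a r a' r' : ℝ} (hr : 0 < r) (hr' : 0 < r')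
    (h : ConformallyEquivalent (planarCircle a r) Sig (planarCircle a' r') Sig) :
    |a ^ 2 - r ^ 2 - 1| / (2 * r) ≤ |a' ^ 2 - r' ^ 2 - 1| / (2 * r') := by
  obtain ⟨f, hf, hD, hS⟩ := h
  obtain ⟨Λ, hΛ, hfΛ⟩ := exists_lorentz_of_conformal f hf
  have hSig : ∀ x : E4, ‖x‖ = 1 → (Λ (lift x)).1 4 = 0 := by
    intro x hx
    obtain ⟨c, -, hc⟩ := hfΛ x
    have h1 : f (chart x) ∈ Sig := hS ▸ Set.mem_image_of_mem _ (chart_mem_Sig hx)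
    have h2 : (f (chart x) : E5) 4 = 0 := h1
    rw [hc]; simp [h2]
  have h4 := apply_four_of_preserves_Sig Λ hΛ hSig (sphereNormal a r)
  have hu := sq_le_of_orthogonal_planarCircle hr' (Λ (sphereNormal a r))
    (by
      rw [hΛ, lorentz_self]
      simp [sphereNormal]
      field_simp
      ring)
    (fun z hz => by
      have hz' : planarPoint z ∈ planarCircle a' r' :=
        Set.mem_image_of_mem _ (by simpa [Complex.dist_eq] using hz)
      rw [← hD] at hz'
      obtain ⟨-, ⟨w, hw, rfl⟩, hwz⟩ := hz'
      obtain ⟨c, hc, hcΛ⟩ := hfΛ !₂[w.re, w.im, 0, 0]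
      rw [← planarPoint_eq_chart, hwz] at hcΛ
      have h0 : lorentz (sphereNormal a r) (lift !₂[w.re, w.im, 0, 0]) = 0 := by
        have hw' : (w.re - a) ^ 2 + w.im ^ 2 = r ^ 2 := by
          have h1 : ‖w - a‖ = r := by simpa [Complex.dist_eq] using hw
          rw [← h1, ← Complex.normSq_eq_norm_sq, Complex.normSq_apply]
          simp; ring
        rw [lorentz_lift]
        simp [sphereNormal]
        field_simp
        linear_combination -2 * hw'
      rw [← hΛ, hcΛ, map_smul, smul_eq_mul] at h0
      rw [lift_eq_smul, ← planarPoint_eq_chart, map_smul, (mul_eq_zero.mp h0).resolve_left hc,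
        smul_zero])
  rw [h4] at hu
  have h5 : ((a ^ 2 - r ^ 2 - 1) / (2 * r)) ^ 2 ≤ ((a' ^ 2 - r' ^ 2 - 1) / (2 * r')) ^ 2 := by
    refine le_trans (le_of_eq ?_) hu
    simp [sphereNormal]
    rw [div_pow, div_pow]; congr 1; ring
  have h6 := sq_le_sq.mp h5
  rwa [abs_div, abs_div, abs_of_pos (by positivity : 0 < 2 * r),
    abs_of_pos (by positivity : 0 < 2 * r')] at h6

/-- The inversive distance of a planar circle and `Σ` is a conformal invariant. -/
theorem inversive_eq_of_conformal {a r a' r' : ℝ} (hr : 0 < r) (hr' : 0 < r')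
    (h : ConformallyEquivalent (planarCircle a r) Sig (planarCircle a' r') Sig) :
    |a ^ 2 - r ^ 2 - 1| / (2 * r) = |a' ^ 2 - r' ^ 2 - 1| / (2 * r') :=
  le_antisymm (inversive_le_of_conformal hr hr' h) (inversive_le_of_conformal hr' hr h.symm)

/-! ### Planar quadrics and their discriminant circles -/

/-- The matrix of the planar quadric `m z₀ z₁ + n (z₀ z₃ + z₁ z₂) + p z₂ z₃ = 0`. -/
def planarMatrix (m n p : ℂ) : Matrix (Fin 4) (Fin 4) ℂ :=
  !![0, m, 0, n; m, 0, n, 0; 0, n, 0, p; n, 0, p, 0]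

theorem planarMatrix_isSymm (m n p : ℂ) : (planarMatrix m n p).IsSymm := by
  ext i j; fin_cases i <;> fin_cases j <;> rfl

theorem planarMatrix_form (m n p : ℂ) (z : Fin 4 → ℂ) :
    z ⬝ᵥ (planarMatrix m n p).mulVec z =
      2 * (m * (z 0 * z 1) + n * (z 0 * z 3 + z 1 * z 2) + p * (z 2 * z 3)) := by
  simp [planarMatrix, Matrix.mulVec, dotProduct, Fin.sum_univ_four]
  ring

theorem planarMatrix_det (m n p : ℂ) : (planarMatrix m n p).det = (m * p - n ^ 2) ^ 2 := by
  simp [planarMatrix, Matrix.det_succ_row_zero, Fin.sum_univ_succ, Fin.succAbove]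
  ring

theorem mk_mem_planarQuadric (m n p : ℂ) (z : Fin 4 → ℂ) (hz : z ≠ 0) :
    Projectivization.mk ℂ z hz ∈ quadric (planarMatrix m n p) ↔
      m * (z 0 * z 1) + n * (z 0 * z 3 + z 1 * z 2) + p * (z 2 * z 3) = 0 := by
  rw [mk_mem_quadric, planarMatrix_form]
  simp

theorem j_j (x : CP3) : j (j x) = x := by
  induction x using Projectivization.ind with | h z hz =>
  rw [j_mk, j_mk, Projectivization.mk_eq_mk_iff']
  exact ⟨-1, by rw [J_J]; simp⟩

theorem j_image_eq_of_subset {S : Set CP3} (h : ∀ x ∈ S, j x ∈ S) : j '' S = S := by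
  refine Set.Subset.antisymm (Set.image_subset_iff.mpr h) fun x hx => ⟨j x, h x hx, j_j x⟩

theorem planarQuadric_mem_smooth {m n p : ℝ} (h : m * p - n ^ 2 ≠ 0) :
    quadric (planarMatrix m n p) ∈ smoothJInvariantQuadrics := by
  refine ⟨⟨_, planarMatrix_isSymm _ _ _, ?_, rfl⟩, j_image_eq_of_subset fun x hx => ?_⟩
  · rw [planarMatrix_det]
    exact pow_ne_zero 2 (by exact_mod_cast h)
  · induction x using Projectivization.ind with | h z hz =>
    rw [mk_mem_planarQuadric] at hx
    rw [j_mk, mk_mem_planarQuadric, J_apply_zero, J_apply_one, J_apply_two, J_apply_three]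
    have h1 := congrArg conj hx
    simp only [map_add, map_mul, Complex.conj_ofReal, map_zero] at h1
    linear_combination -h1

/-- A nondegenerate binary quadratic form over `ℂ` is a product of two independent linear forms. -/
theorem exists_factorization {A B C : ℂ} (h : B ^ 2 - 4 * A * C ≠ 0) :
    ∃ α β γ δ : ℂ, α * δ - β * γ ≠ 0 ∧
      ∀ x y : ℂ, A * x ^ 2 + B * (x * y) + C * y ^ 2 = (α * x + β * y) * (γ * x + δ * y) := by
  by_cases hA : A = 0
  · subst hA
    refine ⟨0, 1, B, C, ?_, fun x y => by ring⟩
    rintro h1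
    apply h
    have : B = 0 := by linear_combination -h1
    rw [this]; ring
  · obtain ⟨d, hd⟩ := IsAlgClosed.exists_pow_nat_eq (B ^ 2 - 4 * A * C) (n := 2) two_pos
    refine ⟨A, (B - d) / 2, 1, (B + d) / (2 * A), ?_, fun x y => ?_⟩
    · have h1 : A * ((B + d) / (2 * A)) - (B - d) / 2 * 1 = d := by field_simp; ring
      rw [h1]
      rintro rfl
      exact h (by rw [← hd]; ring)
    · field_simp
      linear_combination y ^ 2 * hd

/-- A set of points of the line through `[e]` and `[f]` cut out by a nondegenerate binary quadratic
form has exactly two elements. -/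
theorem encard_eq_two_of_form (S : Set CP3) (e f : Fin 4 → ℂ)
    (hef : ∀ x y : ℂ, x • e + y • f = 0 → x = 0 ∧ y = 0) {A B C : ℂ} (h : B ^ 2 - 4 * A * C ≠ 0)
    (hS : ∀ (z : Fin 4 → ℂ) (hz : z ≠ 0), Projectivization.mk ℂ z hz ∈ S ↔
      ∃ x y : ℂ, z = x • e + y • f ∧ A * x ^ 2 + B * (x * y) + C * y ^ 2 = 0) :
    S.encard = 2 := by
  obtain ⟨α, β, γ, δ, hD, hfac⟩ := exists_factorization h
  have h1 : β • e + (-α) • f ≠ 0 := fun h0 => by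
    obtain ⟨h2, h3⟩ := hef _ _ h0
    rw [neg_eq_zero] at h3
    exact hD (by rw [h2, h3]; ring)
  have h2 : δ • e + (-γ) • f ≠ 0 := fun h0 => by
    obtain ⟨h2, h3⟩ := hef _ _ h0
    rw [neg_eq_zero] at h3
    exact hD (by rw [h2, h3]; ring)
  rw [Set.encard_eq_two]
  refine ⟨Projectivization.mk ℂ _ h1, Projectivization.mk ℂ _ h2, ?_, ?_⟩
  · intro heq
    rw [Projectivization.mk_eq_mk_iff'] at heq
    obtain ⟨c, hc⟩ := heq
    obtain ⟨h3, h4⟩ := hef (c * δ - β) (-(c * γ) + α) (by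
      have := sub_eq_zero.mpr hc
      rw [← this]; module)
    apply hD
    have h5 : β = c * δ := by linear_combination -h3
    have h6 : α = c * γ := by linear_combination h4
    rw [h5, h6]; ring
  · ext x
    induction x using Projectivization.ind with | h z hz =>
    rw [hS, Set.mem_insert_iff, Set.mem_singleton_iff, Projectivization.mk_eq_mk_iff',
      Projectivization.mk_eq_mk_iff']
    constructor
    · rintro ⟨x, y, rfl, hxy⟩
      rw [hfac, mul_eq_zero] at hxy
      rcases hxy with hxy | hxy
      · left
        refine ⟨-(γ * x + δ * y) / (α * δ - β * γ), ?_⟩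
        rw [smul_add, smul_smul, smul_smul]
        congr 2
        · rw [div_mul_eq_mul_div, div_eq_iff hD]; linear_combination -δ * hxy
        · rw [div_mul_eq_mul_div, div_eq_iff hD]; linear_combination γ * hxy
      · right
        refine ⟨(α * x + β * y) / (α * δ - β * γ), ?_⟩
        rw [smul_add, smul_smul, smul_smul]
        congr 2
        · rw [div_mul_eq_mul_div, div_eq_iff hD]; linear_combination β * hxy
        · rw [div_mul_eq_mul_div, div_eq_iff hD]; linear_combination -α * hxy
    · rintro (⟨c, rfl⟩ | ⟨c, rfl⟩)
      · refine ⟨c * β, c * -α, by module, ?_⟩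
        rw [hfac]; ring
      · refine ⟨c * δ, c * -γ, by module, ?_⟩
        rw [hfac]; ring

/-- The twistor fibre over `[1 : u + j w]` is a line, parametrized by `(z₀, z₁)`. -/
theorem twistorProj_mk_eq_iff {p : S4} {u w : ℂ} (hp : (p : E5) = hopf 1 (quat u w))
    (z : Fin 4 → ℂ) (hz : z ≠ 0) : twistorProj (Projectivization.mk ℂ z hz) = p ↔
      z 2 = u * z 0 - conj w * z 1 ∧ z 3 = w * z 0 + conj u * z 1 := by
  rw [Subtype.ext_iff, twistorProj_mk, hp, hopf_eq_hopf_one_iff (quat_ne_zero z hz), quat_mul]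
  exact ⟨quat_ext, fun h => by rw [h.1, h.2]⟩

theorem twistorProj_mk_eq_infty_iff {p : S4} (hp : (p : E5) = hopf 0 1) (z : Fin 4 → ℂ)
    (hz : z ≠ 0) : twistorProj (Projectivization.mk ℂ z hz) = p ↔ z 0 = 0 ∧ z 1 = 0 := by
  have h1 : quat 1 0 = 1 := by simp [quat]
  have h0 : quat 0 0 = 0 := by simp [quat]
  rw [Subtype.ext_iff, twistorProj_mk, hp]
  constructor
  · intro h
    have hN := sum_sq_pos (quat_ne_zero z hz)
    have h4 := congrArg (fun v : E5 => v 4) h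
    simp [hopf] at h4
    have h5 : ‖quat (z 0) (z 1)‖ ^ 2 = 0 := by
      field_simp at h4
      linarith
    have h6 : quat (z 0) (z 1) = quat 0 0 := by
      rw [h0]; simpa using h5
    exact quat_ext h6
  · rintro ⟨h2, h3⟩
    have h5 := quat_ne_zero z hz
    rw [h2, h3, h0] at h5
    have h6 : quat (z 2) (z 3) ≠ 0 := by simpa using h5
    rw [h2, h3, h0]
    simpa using hopf_mul 0 1 _ h6

/-- The normal form with discriminant circle `{|z - a| = 1}`, namely
`(z₂ - a z₀) (z₃ - a z₁) = z₀ z₁`. -/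
def normalQuadric (a : ℝ) : Set CP3 :=
  quadric (planarMatrix ((a ^ 2 - 1 : ℝ) : ℂ) ((-a : ℝ) : ℂ) ((1 : ℝ) : ℂ))

theorem normalQuadric_mem_smooth (a : ℝ) : normalQuadric a ∈ smoothJInvariantQuadrics :=
  planarQuadric_mem_smooth (by ring_nf; norm_num)

theorem mk_mem_normalQuadric (a : ℝ) (z : Fin 4 → ℂ) (hz : z ≠ 0) :
    Projectivization.mk ℂ z hz ∈ normalQuadric a ↔
      (z 2 - a * z 0) * (z 3 - a * z 1) - z 0 * z 1 = 0 := by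
  rw [normalQuadric, mk_mem_planarQuadric]
  push_cast
  constructor <;> intro h <;> linear_combination h

/-- The coefficients, in the coordinates `(z₀, z₁)`, of the restriction of the normal form to the
twistor fibre over `[1 : u + j w]`. -/
theorem mk_mem_fibre_iff (a : ℝ) {p : S4} {u w : ℂ} (hp : (p : E5) = hopf 1 (quat u w))
    (z : Fin 4 → ℂ) (hz : z ≠ 0) :
    Projectivization.mk ℂ z hz ∈ twistorProj ⁻¹' {p} ∩ normalQuadric a ↔
      ∃ x y : ℂ, z = x • ![1, 0, u, w] + y • ![0, 1, -conj w, conj u] ∧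
        ((u - a) * w) * x ^ 2 + ((‖u - a‖ ^ 2 - ‖w‖ ^ 2 - 1 : ℝ) : ℂ) * (x * y) +
          (-conj ((u - a) * w)) * y ^ 2 = 0 := by
  have key : ∀ x y : ℂ, (u * x - conj w * y - a * x) * (w * x + conj u * y - a * y) - x * y =
      ((u - a) * w) * x ^ 2 + ((‖u - a‖ ^ 2 - ‖w‖ ^ 2 - 1 : ℝ) : ℂ) * (x * y) +
          (-conj ((u - a) * w)) * y ^ 2 := by
    intro x y
    push_cast
    rw [← Complex.mul_conj', ← Complex.mul_conj']
    simp only [map_sub, map_mul, Complex.conj_ofReal]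
    ring
  rw [Set.mem_inter_iff, Set.mem_preimage, Set.mem_singleton_iff, twistorProj_mk_eq_iff hp,
    mk_mem_normalQuadric]
  constructor
  · rintro ⟨⟨h2, h3⟩, h4⟩
    refine ⟨z 0, z 1, ?_, ?_⟩
    · ext i; fin_cases i <;> simp [h2, h3] <;> ring
    · rw [h2, h3, key] at h4; exact h4
  · rintro ⟨x, y, rfl, h4⟩
    rw [← key] at h4
    refine ⟨⟨by simp; ring, by simp; ring⟩, ?_⟩
    simp
    linear_combination h4

/-- Over a finite point `[1 : u + j w]` the restriction of the normal form to the fibre has the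
discriminant `(|u - a|² - |w|² - 1)² + 4 |(u - a) w|²`, a sum of squares that vanishes just on
the circle. The fibre over `∞` always meets the quadric in two points. -/
theorem discriminant_normalQuadric (a : ℝ) :
    discriminant (normalQuadric a) = planarCircle a 1 := by
  ext p
  rw [discriminant, Set.mem_ofPred_eq]
  rcases exists_hopf_eq p with ⟨q, hq⟩ | hq
  · obtain ⟨u, w, rfl⟩ : ∃ u w, q = quat u w := ⟨_, _, (quat_eta q).symm⟩
    have hcirc : p ∈ planarCircle a 1 ↔ w = 0 ∧ ‖u - a‖ = 1 := by
      constructor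
      · rintro ⟨z, hz, rfl⟩
        have h1 : quat z 0 = quat u w := hopf_one_injective (by rw [← hq]; simp [planarPoint, quat])
        obtain ⟨rfl, rfl⟩ := quat_ext h1
        exact ⟨rfl, by simpa [Complex.dist_eq] using hz⟩
      · rintro ⟨rfl, hu⟩
        refine ⟨u, by simpa [Complex.dist_eq] using hu, Subtype.ext ?_⟩
        rw [hq]; simp [planarPoint, quat]
    rw [hcirc, not_iff_comm]
    have hfib := mk_mem_fibre_iff a hq
    constructor
    · intro hne
      refine encard_eq_two_of_form _ _ _ (fun x y hxy => ?_) ?_ hfib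
      · have h0 := congrFun hxy 0
        have h1 := congrFun hxy 1
        simp at h0 h1
        exact ⟨h0, h1⟩
      · have h1 : ((‖u - a‖ ^ 2 - ‖w‖ ^ 2 - 1 : ℝ) : ℂ) ^ 2 -
            4 * ((u - a) * w) * (-conj ((u - a) * w)) =
            (((‖u - a‖ ^ 2 - ‖w‖ ^ 2 - 1) ^ 2 + 4 * (‖u - a‖ * ‖w‖) ^ 2 : ℝ) : ℂ) := by
          have := Complex.mul_conj' ((u - a) * w)
          rw [norm_mul] at this
          push_cast at this ⊢
          linear_combination 4 * this
        rw [h1, Complex.ofReal_ne_zero]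
        intro h2
        have h3 : ‖u - a‖ ^ 2 - ‖w‖ ^ 2 - 1 = 0 := by
          nlinarith [sq_nonneg (‖u - a‖ ^ 2 - ‖w‖ ^ 2 - 1), sq_nonneg (‖u - a‖ * ‖w‖)]
        have h4 : ‖u - a‖ * ‖w‖ = 0 := by
          rw [h3] at h2; nlinarith
        rcases mul_eq_zero.mp h4 with h5 | h5
        · rw [h5] at h3; nlinarith [sq_nonneg ‖w‖]
        · rw [h5] at h3
          refine hne ⟨norm_eq_zero.mp h5, ?_⟩
          nlinarith [norm_nonneg (u - a)]
    · rintro h2 ⟨rfl, hu⟩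
      -- the fibre lies in the quadric: it contains the three points below
      obtain ⟨x, y, -, hxy⟩ := Set.encard_eq_two.mp h2
      have hmem : ∀ s t : ℂ, ∀ hz : (s • ![1, 0, u, 0] + t • ![0, 1, -conj 0, conj u] :
          Fin 4 → ℂ) ≠ 0, Projectivization.mk ℂ _ hz = x ∨ Projectivization.mk ℂ _ hz = y := by
        intro s t hz
        have : Projectivization.mk ℂ _ hz ∈ twistorProj ⁻¹' {p} ∩ normalQuadric a :=
          (hfib _ hz).mpr ⟨s, t, rfl, by simp [hu]⟩
        rwa [hxy] at this
      have n1 : ((1 : ℂ) • ![1, 0, u, 0] + (0 : ℂ) • ![0, 1, -conj 0, conj u] : Fin 4 → ℂ) ≠ 0 :=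
        fun h => by simpa using congrFun h 0
      have n2 : ((0 : ℂ) • ![1, 0, u, 0] + (1 : ℂ) • ![0, 1, -conj 0, conj u] : Fin 4 → ℂ) ≠ 0 :=
        fun h => by simpa using congrFun h 1
      have n3 : ((1 : ℂ) • ![1, 0, u, 0] + (1 : ℂ) • ![0, 1, -conj 0, conj u] : Fin 4 → ℂ) ≠ 0 :=
        fun h => by simpa using congrFun h 0
      have d12 : Projectivization.mk ℂ _ n1 ≠ Projectivization.mk ℂ _ n2 := fun h => by
        obtain ⟨c, hc⟩ := (Projectivization.mk_eq_mk_iff' _ _ _ _ _).mp h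
        simpa using congrFun hc 0
      have d13 : Projectivization.mk ℂ _ n1 ≠ Projectivization.mk ℂ _ n3 := fun h => by
        obtain ⟨c, hc⟩ := (Projectivization.mk_eq_mk_iff' _ _ _ _ _).mp h
        have h0 := congrFun hc 0
        have h1 := congrFun hc 1
        simp at h0 h1
        simp [h0] at h1
      have d23 : Projectivization.mk ℂ _ n2 ≠ Projectivization.mk ℂ _ n3 := fun h => by
        obtain ⟨c, hc⟩ := (Projectivization.mk_eq_mk_iff' _ _ _ _ _).mp h
        have h0 := congrFun hc 0
        have h1 := congrFun hc 1
        simp at h0 h1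
        simp [h0] at h1
      rcases hmem _ _ n1 with h1 | h1 <;> rcases hmem _ _ n2 with h2 | h2 <;>
        rcases hmem _ _ n3 with h3 | h3
      · exact d12 (h1.trans h2.symm)
      · exact d12 (h1.trans h2.symm)
      · exact d13 (h1.trans h3.symm)
      · exact d23 (h2.trans h3.symm)
      · exact d23 (h2.trans h3.symm)
      · exact d13 (h1.trans h3.symm)
      · exact d12 (h1.trans h2.symm)
      · exact d12 (h1.trans h2.symm)
  · have hnot : p ∉ planarCircle a 1 := by
      rintro ⟨z, -, rfl⟩
      have h4 := congrArg (fun v : E5 => v 4) hq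
      simp only [planarPoint] at h4
      rw [hopf_one_coord] at h4
      simp [hopf] at h4
      field_simp at h4
      linarith
    refine iff_of_false (not_not.mpr ?_) hnot
    refine encard_eq_two_of_form _ ![0, 0, 1, 0] ![0, 0, 0, 1] (A := 0) (B := 1) (C := 0)
      (fun x y hxy => ?_) (by norm_num) (fun z hz => ?_)
    · have h0 := congrFun hxy 2
      have h1 := congrFun hxy 3
      simp at h0 h1
      exact ⟨h0, h1⟩
    · rw [Set.mem_inter_iff, Set.mem_preimage, Set.mem_singleton_iff,
        twistorProj_mk_eq_infty_iff hq, mk_mem_normalQuadric]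
      constructor
      · rintro ⟨⟨h0, h1⟩, h4⟩
        refine ⟨z 2, z 3, ?_, ?_⟩
        · ext i; fin_cases i <;> simp [h0, h1]
        · rw [h0, h1] at h4; linear_combination h4
      · rintro ⟨x, y, rfl, h4⟩
        refine ⟨by simp, ?_⟩
        simp
        simpa using h4

/-! ### Matrices of symmetries -/

/-- The Hermitian form `z̄₀ w₀ + z̄₁ w₁ - z̄₂ w₂ - z̄₃ w₃`, whose null vectors form `Q^{2,2}`. -/
def herm : (Fin 4 → ℂ) →ₗ⋆[ℂ] (Fin 4 → ℂ) →ₗ[ℂ] ℂ :=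
  LinearMap.mk₂'ₛₗ (starRingEnd ℂ) (RingHom.id ℂ)
    (fun z w => conj (z 0) * w 0 + conj (z 1) * w 1 - conj (z 2) * w 2 - conj (z 3) * w 3)
    (fun z z' w => by simp; ring) (fun c z w => by simp; ring)
    (fun z w w' => by simp; ring) (fun c z w => by simp; ring)

theorem herm_apply (z w : Fin 4 → ℂ) : herm z w =
    conj (z 0) * w 0 + conj (z 1) * w 1 - conj (z 2) * w 2 - conj (z 3) * w 3 := rfl

theorem herm_conj (z w : Fin 4 → ℂ) : conj (herm z w) = herm w z := by
  simp only [herm_apply, map_sub, map_add, map_mul, Complex.conj_conj]; ring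

theorem herm_J_J (z w : Fin 4 → ℂ) : herm (J z) (J w) = conj (herm z w) := by
  simp only [herm_apply, J_apply_zero, J_apply_one, J_apply_two, J_apply_three, map_sub, map_add,
    map_mul, map_neg, Complex.conj_conj]; ring

/-- `(z, w) ↦ herm (J z) w` is a complex symplectic form. -/
theorem herm_J_antisymm (z w : Fin 4 → ℂ) : herm (J z) w = -herm (J w) z := by
  simp only [herm_apply, J_apply_zero, J_apply_one, J_apply_two, J_apply_three, map_neg,
    Complex.conj_conj]; ring

theorem herm_J_self (z : Fin 4 → ℂ) : herm (J z) z = 0 := by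
  have := herm_J_antisymm z z
  linear_combination this / 2

theorem herm_self_J (z : Fin 4 → ℂ) : herm z (J z) = 0 := by
  rw [← herm_conj, herm_J_self, map_zero]

theorem herm_J_right (z w : Fin 4 → ℂ) : herm z (J w) = -conj (herm (J z) w) := by
  rw [← herm_J_J, J_J]; simp

/-- The real number `herm z z`. -/
def hermNorm (z : Fin 4 → ℂ) : ℝ := ‖z 0‖ ^ 2 + ‖z 1‖ ^ 2 - ‖z 2‖ ^ 2 - ‖z 3‖ ^ 2

theorem herm_self (z : Fin 4 → ℂ) : herm z z = (hermNorm z : ℂ) := by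
  simp only [herm_apply, hermNorm, Complex.conj_mul']; push_cast; ring

theorem mk_mem_Q22_iff_herm (z : Fin 4 → ℂ) (hz : z ≠ 0) :
    Projectivization.mk ℂ z hz ∈ Q22 ↔ herm z z = 0 := by
  rw [mk_mem_Q22, herm_self, Complex.ofReal_eq_zero, hermNorm]
  constructor <;> intro h <;> linarith

theorem eq_zero_of_herm {z : Fin 4 → ℂ} (h : ∀ w, herm w z = 0) : z = 0 := by
  have h0 := h (Pi.single 0 1)
  have h1 := h (Pi.single 1 1)
  have h2 := h (Pi.single 2 1)
  have h3 := h (Pi.single 3 1)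
  simp [herm_apply] at h0 h1 h2 h3
  ext i; fin_cases i <;> assumption

theorem det_ne_zero_of_herm {A : Matrix (Fin 4) (Fin 4) ℂ} {κ : ℂ} (hκ : κ ≠ 0)
    (hK : ∀ w z, herm (A.mulVec w) (A.mulVec z) = κ * herm w z) : A.det ≠ 0 := by
  rw [← isUnit_iff_ne_zero, ← Matrix.isUnit_iff_isUnit_det, ← Matrix.mulVec_injective_iff_isUnit]
  refine (injective_iff_map_eq_zero A.mulVecLin).mpr fun z hz => eq_zero_of_herm fun w => ?_
  have h1 := hK w z
  rw [← Matrix.mulVecLin_apply A z, hz, map_zero] at h1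
  exact (mul_eq_zero.mp h1.symm).resolve_left hκ

/-- A matrix that commutes with `J` and scales the Hermitian form is a symmetry, which moves
quadrics by substitution. -/
theorem quadric_mem_orbit (A Q Q' : Matrix (Fin 4) (Fin 4) ℂ)
    (hJ : ∀ z, A.mulVec (J z) = J (A.mulVec z)) {κ : ℂ} (hκ : κ ≠ 0)
    (hK : ∀ w z, herm (A.mulVec w) (A.mulVec z) = κ * herm w z)
    (hQ : ∀ z, z ⬝ᵥ Q'.mulVec z = 0 ↔ A.mulVec z ⬝ᵥ Q.mulVec (A.mulVec z) = 0) :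
    quadric Q ∈ MulAction.orbit GjQ22 (quadric Q') := by
  have hdet : IsUnit A.det := (det_ne_zero_of_herm hκ hK).isUnit
  let g₀ : GL (Fin 4) ℂ := Matrix.GeneralLinearGroup.mk'' A hdet
  let g : PGL(4, ℂ) := Matrix.ProjGenLinGroup.mk g₀
  have hact : ∀ (z : Fin 4 → ℂ) (hz : z ≠ 0), ∃ h : A.mulVec z ≠ 0,
      g • Projectivization.mk ℂ z hz = Projectivization.mk ℂ (A.mulVec z) h :=
    fun z hz => mk_GL_smul g₀ z hz
  have hset : ∀ S S' : Set CP3, (∀ x, g • x ∈ S' ↔ x ∈ S) → g • S = S' := by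
    intro S S' h
    ext x
    rw [Set.mem_smul_set_iff_inv_smul_mem, ← h, smul_inv_smul]
  have hg : g ∈ GjQ22 := by
    refine ⟨fun x => ?_, hset _ _ fun x => ?_⟩
    · induction x using Projectivization.ind with | h z hz =>
      obtain ⟨h1, h2⟩ := hact z hz
      obtain ⟨h3, h4⟩ := hact (J z) (J_ne_zero hz)
      rw [h2, j_mk, j_mk, h4]
      simp only [hJ]
    · induction x using Projectivization.ind with | h z hz =>
      obtain ⟨h1, h2⟩ := hact z hz
      rw [h2, mk_mem_Q22_iff_herm, mk_mem_Q22_iff_herm, hK]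
      simp [hκ]
  refine ⟨⟨g, hg⟩, hset _ _ fun x => ?_⟩
  induction x using Projectivization.ind with | h z hz =>
  obtain ⟨h1, h2⟩ := hact z hz
  rw [h2, mk_mem_quadric, mk_mem_quadric, hQ]

theorem quadric_smul {c : ℂ} (hc : c ≠ 0) (Q : Matrix (Fin 4) (Fin 4) ℂ) :
    quadric (c • Q) = quadric Q := by
  ext x
  simp [quadric, Matrix.smul_mulVec, hc]

theorem smul_mem_smooth (g : GjQ22) {S : Set CP3} (hS : S ∈ smoothJInvariantQuadrics) :
    g • S ∈ smoothJInvariantQuadrics := by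
  obtain ⟨⟨Q, hQ, hdet, rfl⟩, hj⟩ := hS
  obtain ⟨A, hA⟩ := Matrix.ProjGenLinGroup.mk_surjective g.1
  have hinv : ∀ z, A⁻¹.1.mulVec (A.1.mulVec z) = z := fun z => by
    rw [Matrix.mulVec_mulVec]; simp
  refine ⟨⟨A⁻¹.1.transpose * Q * A⁻¹.1, ?_, ?_, ?_⟩, ?_⟩
  · rw [Matrix.IsSymm, Matrix.transpose_mul, Matrix.transpose_mul, hQ.eq,
      Matrix.transpose_transpose, mul_assoc]
  · rw [Matrix.det_mul, Matrix.det_mul, Matrix.det_transpose]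
    have : A⁻¹.1.det ≠ 0 := ((Matrix.isUnit_iff_isUnit_det _).mp A⁻¹.isUnit).ne_zero
    exact mul_ne_zero (mul_ne_zero this hdet) this
  · ext x
    obtain ⟨x, rfl⟩ := MulAction.surjective g x
    rw [Set.smul_mem_smul_set_iff]
    induction x using Projectivization.ind with | h z hz =>
    have h1 : g • Projectivization.mk ℂ z hz = g.1 • Projectivization.mk ℂ z hz := rfl
    obtain ⟨h2, h3⟩ := mk_GL_smul A z hz
    change _ ↔ g • Projectivization.mk ℂ z hz ∈ _
    rw [h1, ← hA, h3, mk_mem_quadric, mk_mem_quadric, ← Matrix.mulVec_mulVec, hinv,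
      ← Matrix.mulVec_mulVec, Matrix.dotProduct_mulVec (A.1.mulVec z), Matrix.vecMul_transpose,
      hinv]
  · apply j_image_eq_of_subset
    rintro - ⟨x, hx, rfl⟩
    refine ⟨j x, ?_, g.2.1 x⟩
    exact hj ▸ Set.mem_image_of_mem j hx

/-! ### Real structure of the matrix of a `j`-invariant quadric -/

/-- A symmetric bilinear form that vanishes on the null vectors of a nondegenerate one is a
multiple of it. -/
theorem exists_eq_smul_of_null {V : Type*} [AddCommGroup V] [Module ℂ V] [FiniteDimensional ℂ V]
    [Nontrivial V] (B B' : LinearMap.BilinForm ℂ V) (hB : ∀ v w, B v w = B w v)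
    (hB' : ∀ v w, B' v w = B' w v)
    (hnd : B.Nondegenerate) (h : ∀ v, B v v = 0 → B' v v = 0) : ∃ c : ℂ, B' = c • B := by
  obtain ⟨v, hv⟩ := LinearMap.BilinForm.exists_orthogonal_basis (B := B) ⟨hB⟩
  have hne : ∀ i, B (v i) (v i) ≠ 0 := fun i =>
    hv.not_isOrtho_basis_self_of_separatingLeft hnd.1 i
  have hort : ∀ i k, i ≠ k → B (v i) (v k) = 0 := fun i k hik => hv hik
  -- for `i ≠ k` the two combinations `v k ± μ v i` with `μ² = -B(v k, v k) / B(v i, v i)` are null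
  have key : ∀ i k, i ≠ k → B' (v i) (v k) = 0 ∧
      B' (v k) (v k) * B (v i) (v i) = B (v k) (v k) * B' (v i) (v i) := by
    intro i k hik
    obtain ⟨μ, hμ⟩ := IsAlgClosed.exists_pow_nat_eq
      (-B (v k) (v k) / B (v i) (v i)) (n := 2) two_pos
    have hμ' : μ ^ 2 * B (v i) (v i) = -B (v k) (v k) := by
      rw [hμ, div_mul_cancel₀ _ (hne i)]
    have hμ0 : μ ≠ 0 := by
      rintro rfl
      exact hne k (by linear_combination hμ')
    have h1 := h (v k + μ • v i) (by
      simp only [map_add, map_smul, LinearMap.add_apply, LinearMap.smul_apply, smul_eq_mul,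
        hort i k hik, hort k i hik.symm]
      linear_combination hμ')
    have h2 := h (v k - μ • v i) (by
      simp only [map_sub, map_smul, LinearMap.sub_apply, LinearMap.smul_apply, smul_eq_mul,
        hort i k hik, hort k i hik.symm]
      linear_combination hμ')
    have hs : B' (v k) (v i) = B' (v i) (v k) := hB' _ _
    simp only [map_add, map_sub, map_smul, LinearMap.add_apply, LinearMap.sub_apply,
      LinearMap.smul_apply, smul_eq_mul, hs] at h1 h2
    constructor
    · have : μ * B' (v i) (v k) = 0 := by linear_combination (h1 - h2) / 4
      exact (mul_eq_zero.mp this).resolve_left hμ0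
    · linear_combination (B (v i) (v i)) * (h1 + h2) / 2 - B' (v i) (v i) * hμ'
  have : Nonempty (Fin (Module.finrank ℂ V)) := ⟨⟨0, Module.finrank_pos⟩⟩
  let i₀ : Fin (Module.finrank ℂ V) := Classical.arbitrary _
  refine ⟨B' (v i₀) (v i₀) / B (v i₀) (v i₀), LinearMap.BilinForm.ext_basis v fun i k => ?_⟩
  rw [LinearMap.smul_apply, LinearMap.smul_apply, smul_eq_mul, div_mul_eq_mul_div,
    eq_div_iff (hne i₀)]
  by_cases hik : i = k
  · subst hik
    by_cases hi : i₀ = i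
    · subst hi; ring
    · rw [(key i₀ i hi).2]; ring
  · rw [(key i k hik).1, hort i k hik]; ring

theorem toBilin'_symm {Q : Matrix (Fin 4) (Fin 4) ℂ} (hQ : Q.IsSymm) (z w : Fin 4 → ℂ) :
    Matrix.toBilin' Q z w = Matrix.toBilin' Q w z := by
  rw [Matrix.toBilin'_apply', Matrix.toBilin'_apply', Matrix.dotProduct_mulVec,
    ← Matrix.mulVec_transpose, hQ.eq, dotProduct_comm]

/-- The matrix of a smooth `j`-invariant quadric may be scaled so that its bilinear form is real for
the quaternionic structure `J`. -/
theorem exists_real_matrix {S : Set CP3} (hS : S ∈ smoothJInvariantQuadrics) :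
    ∃ Q : Matrix (Fin 4) (Fin 4) ℂ, Q.IsSymm ∧ Q.det ≠ 0 ∧ S = quadric Q ∧
      ∀ z w, Matrix.toBilin' Q (J z) (J w) = conj (Matrix.toBilin' Q z w) := by
  obtain ⟨⟨Q, hQ, hdet, rfl⟩, hj⟩ := hS
  set B := Matrix.toBilin' Q with hBdef
  have hBsymm : ∀ z w, B z w = B w z := toBilin'_symm hQ
  have hnd : B.Nondegenerate := LinearMap.BilinForm.nondegenerate_toBilin'_of_det_ne_zero' Q hdet
  let B' : LinearMap.BilinForm ℂ (Fin 4 → ℂ) := LinearMap.mk₂ ℂ (fun z w => conj (B (J z) (J w)))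
    (fun z z' w => by simp) (fun c z w => by simp [map_smulₛₗ])
    (fun z w w' => by simp) (fun c z w => by simp [map_smulₛₗ])
  have hB' : ∀ z w, B' z w = conj (B (J z) (J w)) := fun z w => rfl
  -- `B'` vanishes on the null vectors of `B` by invariance, hence is `c B`, where `|c| = 1`
  obtain ⟨c, hc⟩ := exists_eq_smul_of_null B B' hBsymm
    (fun z w => by rw [hB', hB', hBsymm]) hnd (fun z hz => by
      by_cases hz0 : z = 0
      · subst hz0; simp
      · have h1 : Projectivization.mk ℂ z hz0 ∈ quadric Q := by
          rw [mk_mem_quadric]; rwa [hBdef, Matrix.toBilin'_apply'] at hz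
        have h2 : j (Projectivization.mk ℂ z hz0) ∈ quadric Q := by
          rw [← hj]; exact Set.mem_image_of_mem j h1
        rw [j_mk, mk_mem_quadric] at h2
        rw [hB', hBdef, Matrix.toBilin'_apply', h2, map_zero])
  have hBJ : ∀ z w, conj (B (J z) (J w)) = c * B z w := fun z w => by
    rw [← hB', hc]; rfl
  obtain ⟨z₀, w₀, hzw⟩ : ∃ z w, B z w ≠ 0 := by
    by_contra! h0
    have := hnd.1 (Pi.single 0 1) (fun w => h0 _ w)
    simpa using congrFun this 0
  have hcc : conj c * c = 1 := by
    have h1 := hBJ (J z₀) (J w₀)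
    rw [J_J, J_J] at h1
    have h2 := congrArg conj h1
    rw [map_mul, hBJ, Complex.conj_conj] at h2
    simp at h2
    have h3 : (conj c * c - 1) * B z₀ w₀ = 0 := by linear_combination -h2
    exact sub_eq_zero.mp ((mul_eq_zero.mp h3).resolve_right hzw)
  obtain ⟨d, hd, hdn⟩ := exists_unit_sq_eq hcc
  have hd0 : d ≠ 0 := by rintro rfl; simp at hdn
  refine ⟨d • Q, hQ.smul d, ?_, (quadric_smul hd0 Q).symm, fun z w => ?_⟩
  · rw [Matrix.det_smul]; exact mul_ne_zero (pow_ne_zero _ hd0) hdet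
  · rw [map_smul, LinearMap.smul_apply, LinearMap.smul_apply, LinearMap.smul_apply,
      LinearMap.smul_apply, ← hBdef, smul_eq_mul, smul_eq_mul, map_mul]
    have h1 := congrArg conj (hBJ z w)
    rw [Complex.conj_conj, map_mul, ← hd, map_pow] at h1
    rw [h1]
    linear_combination (conj d * conj (B z w)) * hdn

/-! ### Reduction to planar quadrics -/

/-- The endomorphism that represents the symmetric form of `Q` through the symplectic form
`herm (J x) z` has an eigenvector. -/
theorem exists_symplectic_eigenvector {Q : Matrix (Fin 4) (Fin 4) ℂ} (hdet : Q.det ≠ 0) :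
    ∃ (z : Fin 4 → ℂ) (μ : ℂ), z ≠ 0 ∧ μ ≠ 0 ∧
      ∀ x, Matrix.toBilin' Q x z = μ * herm (J x) z := by
  -- `x ⬝ᵥ y = herm (J x) (Ω y)`
  let Ω : Matrix (Fin 4) (Fin 4) ℂ := !![0, -1, 0, 0; 1, 0, 0, 0; 0, 0, 0, 1; 0, 0, -1, 0]
  obtain ⟨μ, hμ⟩ := Module.End.exists_eigenvalue (Matrix.toLin' (Ω * Q))
  obtain ⟨z, hz⟩ := hμ.exists_hasEigenvector
  have h1 := hz.apply_eq_smul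
  rw [Matrix.toLin'_apply, ← Matrix.mulVec_mulVec] at h1
  have key : ∀ x, Matrix.toBilin' Q x z = μ * herm (J x) z := by
    intro x
    rw [Matrix.toBilin'_apply']
    generalize Q.mulVec z = y at h1 ⊢
    have e0 := congrFun h1 0
    have e1 := congrFun h1 1
    have e2 := congrFun h1 2
    have e3 := congrFun h1 3
    simp [Ω, Matrix.mulVec, dotProduct, Fin.sum_univ_four] at e0 e1 e2 e3
    simp only [herm_apply, J_apply_zero, J_apply_one, J_apply_two, J_apply_three, map_neg,
      Complex.conj_conj, dotProduct, Fin.sum_univ_four]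
    linear_combination x 0 * e1 - x 1 * e0 - x 2 * e3 + x 3 * e2
  refine ⟨z, μ, hz.2, ?_, key⟩
  rintro rfl
  have hnd := LinearMap.BilinForm.nondegenerate_toBilin'_of_det_ne_zero' Q hdet
  exact hz.2 (hnd.2 z fun x => by rw [key, zero_mul])

/-- The quaternionic orthogonal complement of a non-null vector contains a vector of the opposite
sign. -/
theorem exists_herm_orthogonal {z : Fin 4 → ℂ} (hN : hermNorm z ≠ 0) :
    ∃ w, herm z w = 0 ∧ herm (J z) w = 0 ∧ hermNorm w * hermNorm z < 0 := by
  have hk2 : 0 < hermNorm z ^ 2 := by positivity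
  have c0 := Complex.conj_mul' (z 0)
  have c1 := Complex.conj_mul' (z 1)
  have c2 := Complex.conj_mul' (z 2)
  have c3 := Complex.conj_mul' (z 3)
  -- the two vectors below are orthogonal projections of the first and third coordinate vectors,
  -- up to a factor
  rcases lt_or_gt_of_ne hN with h | h
  · let w : Fin 4 → ℂ := ![conj (z 2) * z 2 + conj (z 3) * z 3, 0,
      z 2 * conj (z 0) + conj (z 3) * z 1, z 3 * conj (z 0) - conj (z 2) * z 1]
    refine ⟨w, ?_, ?_, ?_⟩
    · simp [herm_apply, w]; ring
    · simp [herm_apply, w, J_apply_zero, J_apply_one, J_apply_two, J_apply_three]; ring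
    · have h1 : hermNorm w * hermNorm z = -(‖z 2‖ ^ 2 + ‖z 3‖ ^ 2) * hermNorm z ^ 2 := by
        have : herm w w * herm z z = ((-(‖z 2‖ ^ 2 + ‖z 3‖ ^ 2) * hermNorm z ^ 2 : ℝ) : ℂ) := by
          rw [Complex.ofReal_mul, Complex.ofReal_pow, ← herm_self]
          push_cast
          rw [← c2, ← c3]
          simp [herm_apply, w]; ring
        rw [herm_self, herm_self] at this
        exact_mod_cast this
      rw [h1]
      have : 0 < ‖z 2‖ ^ 2 + ‖z 3‖ ^ 2 := by
        unfold hermNorm at h; nlinarith [sq_nonneg ‖z 0‖, sq_nonneg ‖z 1‖]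
      nlinarith
  · let w : Fin 4 → ℂ := ![z 0 * conj (z 2) + conj (z 1) * z 3, z 1 * conj (z 2) - conj (z 0) * z 3,
      conj (z 0) * z 0 + conj (z 1) * z 1, 0]
    refine ⟨w, ?_, ?_, ?_⟩
    · simp [herm_apply, w]; ring
    · simp [herm_apply, w, J_apply_zero, J_apply_one, J_apply_two, J_apply_three]; ring
    · have h1 : hermNorm w * hermNorm z = -(‖z 0‖ ^ 2 + ‖z 1‖ ^ 2) * hermNorm z ^ 2 := by
        have : herm w w * herm z z = ((-(‖z 0‖ ^ 2 + ‖z 1‖ ^ 2) * hermNorm z ^ 2 : ℝ) : ℂ) := by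
          rw [Complex.ofReal_mul, Complex.ofReal_pow, ← herm_self]
          push_cast
          rw [← c0, ← c1]
          simp [herm_apply, w]; ring
        rw [herm_self, herm_self] at this
        exact_mod_cast this
      rw [h1]
      have : 0 < ‖z 0‖ ^ 2 + ‖z 1‖ ^ 2 := by
        unfold hermNorm at h; nlinarith [sq_nonneg ‖z 2‖, sq_nonneg ‖z 3‖]
      nlinarith

/-- A pair of vectors spanning a `B`-isotropic plane, whose quaternionic span is the whole space,
split by the Hermitian form into a positive and a negative line. -/
structure AdaptedPair (B : LinearMap.BilinForm ℂ (Fin 4 → ℂ)) (p q : Fin 4 → ℂ) : Prop where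
  left : B p p = 0
  mixed : B p q = 0
  right : B q q = 0
  herm_left : herm p p = 1
  herm_right : herm q q = -1
  herm_mixed : herm p q = 0
  herm_J : herm (J p) q = 0

theorem exists_adaptedPair_of_signs {B : LinearMap.BilinForm ℂ (Fin 4 → ℂ)} {u v : Fin 4 → ℂ}
    (huu : B u u = 0) (huv : B u v = 0) (hvv : B v v = 0) (hu : 0 < hermNorm u)
    (hv : hermNorm v < 0) (h : herm u v = 0) (hJ : herm (J u) v = 0) :
    ∃ p q, AdaptedPair B p q := by
  have hs : ((√(hermNorm u) : ℝ) : ℂ) ^ 2 = herm u u := by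
    rw [herm_self]; exact_mod_cast Real.sq_sqrt hu.le
  have ht : ((√(-hermNorm v) : ℝ) : ℂ) ^ 2 = -herm v v := by
    rw [herm_self]; exact_mod_cast Real.sq_sqrt (neg_pos.mpr hv).le
  have hs0 : ((√(hermNorm u) : ℝ) : ℂ) ≠ 0 := by exact_mod_cast (Real.sqrt_pos.mpr hu).ne'
  have ht0 : ((√(-hermNorm v) : ℝ) : ℂ) ≠ 0 := by
    exact_mod_cast (Real.sqrt_pos.mpr (neg_pos.mpr hv)).ne'
  generalize hsd : √(hermNorm u) = s at *
  generalize htd : √(-hermNorm v) = t at *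
  refine ⟨(s : ℂ)⁻¹ • u, (t : ℂ)⁻¹ • v, ?_, ?_, ?_, ?_, ?_, ?_, ?_⟩
  · simp [huu]
  · simp [huv]
  · simp [hvv]
  · simp only [map_smulₛₗ, LinearMap.smul_apply, smul_eq_mul, ← hs, map_inv₀,
      Complex.conj_ofReal, RingHom.id_apply]
    field_simp
  · simp only [map_smulₛₗ, LinearMap.smul_apply, smul_eq_mul, map_inv₀, RingHom.id_apply,
      Complex.conj_ofReal, show herm v v = -(t : ℂ) ^ 2 by rw [ht, neg_neg]]
    field_simp
  · simp [map_smulₛₗ, h]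
  · simp [map_smulₛₗ, hJ]

theorem herm_add_smul_J {w : Fin 4 → ℂ} (x y : ℂ) : hermNorm (x • w + y • J w) =
    (‖x‖ ^ 2 + ‖y‖ ^ 2) * hermNorm w := by
  have : herm (x • w + y • J w) (x • w + y • J w) =
      (((‖x‖ ^ 2 + ‖y‖ ^ 2) * hermNorm w : ℝ) : ℂ) := by
    rw [Complex.ofReal_mul, ← herm_self]
    push_cast
    simp only [map_add, map_smulₛₗ, LinearMap.add_apply, LinearMap.smul_apply, smul_eq_mul,
      herm_J_J, herm_self_J, herm_J_self, herm_conj, RingHom.id_apply]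
    rw [← Complex.conj_mul', ← Complex.conj_mul']
    ring
  rw [herm_self] at this
  exact_mod_cast this

theorem exists_isotropic_combination {V : Type*} [AddCommGroup V] [Module ℂ V]
    (B : LinearMap.BilinForm ℂ V) (u v : V) :
    ∃ x y : ℂ, (x ≠ 0 ∨ y ≠ 0) ∧ B (x • u + y • v) (x • u + y • v) = 0 := by
  by_cases h : B u u = 0
  · exact ⟨1, 0, Or.inl one_ne_zero, by simpa using h⟩
  · obtain ⟨d, hd⟩ := IsAlgClosed.exists_pow_nat_eq
      ((B u v + B v u) ^ 2 - 4 * B u u * B v v) (n := 2) two_pos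
    refine ⟨(d - (B u v + B v u)) / (2 * B u u), 1, Or.inr one_ne_zero, ?_⟩
    simp only [map_add, map_smul, LinearMap.add_apply, LinearMap.smul_apply, smul_eq_mul]
    field_simp
    linear_combination hd

/-- Adapted pairs exist. Let `z` be an eigenvector of the form relative to `herm (J x) z`. A vector
that is orthogonal to `J z` for the Hermitian form is then also `B`-orthogonal to `z`. If `z` is not
null, the second vector is found in its quaternionic orthogonal complement; if it is null, the pair
consists, up to factors, of the sum and the difference of `z` and a second null vector. -/
theorem exists_adaptedPair {Q : Matrix (Fin 4) (Fin 4) ℂ} (hQ : Q.IsSymm) (hdet : Q.det ≠ 0)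
    (hreal : ∀ z w, Matrix.toBilin' Q (J z) (J w) = conj (Matrix.toBilin' Q z w)) :
    ∃ p q, AdaptedPair (Matrix.toBilin' Q) p q := by
  have hsymm := toBilin'_symm hQ
  obtain ⟨z, μ, hz, hμ, heig⟩ := exists_symplectic_eigenvector hdet
  set B := Matrix.toBilin' Q
  have hzz : B z z = 0 := by rw [heig, herm_J_self, mul_zero]
  have heigJ : ∀ x, B x (J z) = conj μ * herm z x := by
    intro x
    have h1 := hreal (-J x) z
    rw [map_neg J, J_J, neg_neg, heig, map_mul, map_neg J, J_J, neg_neg, herm_conj] at h1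
    exact h1
  by_cases hN : hermNorm z = 0
  · -- `z` and `J z` span an isotropic plane; complete `z` to a hyperbolic pair
    let w' : Fin 4 → ℂ := ![z 0, z 1, -z 2, -z 3]
    -- `M` is the product of `z` and `w'`
    let M : ℝ := ‖z 0‖ ^ 2 + ‖z 1‖ ^ 2 + ‖z 2‖ ^ 2 + ‖z 3‖ ^ 2
    have hM : 0 < M := by
      have h0 : 0 ≤ M := by positivity
      refine lt_of_le_of_ne h0 fun hM => hz ?_
      have e0 : ‖z 0‖ ^ 2 = 0 := by
        nlinarith [sq_nonneg ‖z 0‖, sq_nonneg ‖z 1‖, sq_nonneg ‖z 2‖, sq_nonneg ‖z 3‖]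
      have e1 : ‖z 1‖ ^ 2 = 0 := by
        nlinarith [sq_nonneg ‖z 0‖, sq_nonneg ‖z 1‖, sq_nonneg ‖z 2‖, sq_nonneg ‖z 3‖]
      have e2 : ‖z 2‖ ^ 2 = 0 := by
        nlinarith [sq_nonneg ‖z 0‖, sq_nonneg ‖z 1‖, sq_nonneg ‖z 2‖, sq_nonneg ‖z 3‖]
      have e3 : ‖z 3‖ ^ 2 = 0 := by
        nlinarith [sq_nonneg ‖z 0‖, sq_nonneg ‖z 1‖, sq_nonneg ‖z 2‖, sq_nonneg ‖z 3‖]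
      simp at e0 e1 e2 e3
      ext i; fin_cases i <;> simpa
    have hM0 : (M : ℂ) ≠ 0 := by exact_mod_cast hM.ne'
    have hzw' : herm z w' = M := by
      simp only [M, Complex.ofReal_add, Complex.ofReal_pow, ← Complex.conj_mul']
      simp [herm_apply, w']
    have hJw' : herm (J z) w' = 0 := by
      simp [herm_apply, w', J_apply_zero, J_apply_one, J_apply_two, J_apply_three]; ring
    have hww' : herm w' w' = 0 := by
      have : hermNorm w' = hermNorm z := by simp [hermNorm, w']
      rw [herm_self, this, hN, Complex.ofReal_zero]
    have hzz' : herm z z = 0 := by rw [herm_self, hN, Complex.ofReal_zero]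
    have hw'J : herm w' (J z) = 0 := by rw [← herm_conj, hJw', map_zero]
    have hμ' : conj μ ≠ 0 := by simpa using hμ
    -- adding a multiple of `J z` makes `w'` null for `B` and does not change its Hermitian products
    let s : ℂ := -B w' w' / (2 * (conj μ * M))
    have hs : B w' w' + 2 * s * (conj μ * M) = 0 := by
      simp only [s]; field_simp; ring
    let w : Fin 4 → ℂ := w' + s • J z
    have hzw : herm z w = M := by simp [w, hzw', herm_self_J]
    have hwz : herm w z = M := by rw [← herm_conj, hzw, Complex.conj_ofReal]
    have hJw : herm (J z) w = 0 := by simp [w, hJw', herm_J_J, hzz']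
    have hww : herm w w = 0 := by
      simp [w, map_smulₛₗ, hww', hw'J, hJw', herm_J_J, hzz']
    have hBzw : B w z = 0 := by rw [heig, herm_J_antisymm, hJw, neg_zero, mul_zero]
    have hBzw' : B z w = 0 := by rw [hsymm, hBzw]
    have hBww : B w w = 0 := by
      have h1 : B (J z) w' = B w' (J z) := hsymm _ _
      have h2 : B w' (J z) = conj μ * M := by rw [heigJ, hzw']
      have h3 : B (J z) (J z) = 0 := by rw [hreal, hzz, map_zero]
      simp only [w, map_add, map_smul, LinearMap.add_apply, LinearMap.smul_apply, smul_eq_mul,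
        h1, h2, h3]
      linear_combination hs
    have hJwz : herm (J w) z = 0 := by rw [herm_J_antisymm, hJw, neg_zero]
    refine exists_adaptedPair_of_signs (u := z + w) (v := z - w) ?_ ?_ ?_ ?_ ?_ ?_ ?_
    · simp [hzz, hBzw, hBzw', hBww]
    · simp [hzz, hBzw, hBzw', hBww]
    · simp [hzz, hBzw, hBzw', hBww]
    · have : herm (z + w) (z + w) = ((2 * M : ℝ) : ℂ) := by
        simp [hzz', hzw, hwz, hww]; ring
      rw [herm_self] at this
      have : hermNorm (z + w) = 2 * M := by exact_mod_cast this
      linarith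
    · have : herm (z - w) (z - w) = ((-(2 * M) : ℝ) : ℂ) := by
        simp [hzz', hzw, hwz, hww]; ring
      rw [herm_self] at this
      have : hermNorm (z - w) = -(2 * M) := by exact_mod_cast this
      linarith
    · simp [hzz', hzw, hwz, hww]
    · simp [herm_J_self, hJw, hJwz]
  · obtain ⟨w₀, h1, h2, h3⟩ := exists_herm_orthogonal hN
    obtain ⟨x, y, hxy, hB⟩ := exists_isotropic_combination B w₀ (J w₀)
    have h4 := herm_add_smul_J (w := w₀) x y
    have h5 : herm z (x • w₀ + y • J w₀) = 0 := by simp [h1, herm_J_right, h2]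
    have h6 : herm (J z) (x • w₀ + y • J w₀) = 0 := by simp [h2, herm_J_J, h1]
    generalize x • w₀ + y • J w₀ = w at *
    have hpos : 0 < ‖x‖ ^ 2 + ‖y‖ ^ 2 := by
      rcases hxy with h | h
      · have := norm_pos_iff.mpr h; positivity
      · have := norm_pos_iff.mpr h; positivity
    have h7 : hermNorm w * hermNorm z < 0 := by rw [h4]; nlinarith
    have h8 : herm (J w) z = 0 := by rw [herm_J_antisymm, h6, neg_zero]
    have h9 : B w z = 0 := by rw [heig, h8, mul_zero]
    have h10 : B z w = 0 := by rw [hsymm, h9]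
    rcases mul_neg_iff.mp h7 with ⟨ha, hb⟩ | ⟨ha, hb⟩
    · exact exists_adaptedPair_of_signs hB h9 hzz ha hb (by rw [← herm_conj, h5, map_zero]) h8
    · exact exists_adaptedPair_of_signs hzz h10 hB hb ha h5 h6

theorem AdaptedPair.smul_right {B : LinearMap.BilinForm ℂ (Fin 4 → ℂ)} {p q : Fin 4 → ℂ}
    (h : AdaptedPair B p q) {c : ℂ} (hc : conj c * c = 1) : AdaptedPair B p (c • q) where
  left := h.left
  mixed := by simp [h.mixed]
  right := by simp [h.right]
  herm_left := h.herm_left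
  herm_right := by simp [map_smulₛₗ, h.herm_right]; linear_combination hc
  herm_mixed := by simp [h.herm_mixed]
  herm_J := by simp [h.herm_J]

/-- Every smooth `j`-invariant quadric is equivalent to a planar one: in the quaternionic frame
given by an adapted pair, its matrix is `i` times a real planar matrix. -/
theorem exists_planar_orbit {S : Set CP3} (hS : S ∈ smoothJInvariantQuadrics) :
    ∃ m n p : ℝ, m * p - n ^ 2 ≠ 0 ∧
      S ∈ MulAction.orbit GjQ22 (quadric (planarMatrix m n p)) := by
  obtain ⟨Q, hQ, hdet, rfl, hreal⟩ := exists_real_matrix hS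
  obtain ⟨p, q', hpq'⟩ := exists_adaptedPair hQ hdet hreal
  have hsymm := toBilin'_symm hQ
  set B := Matrix.toBilin' Q with hBdef
  -- rotate the negative vector to make `B p (J q)` purely imaginary
  obtain ⟨c, hc, hcb⟩ : ∃ c : ℂ, conj c * c = 1 ∧
      conj c * B p (J q') = Complex.I * (‖B p (J q')‖ : ℝ) := by
    by_cases hb : B p (J q') = 0
    · exact ⟨1, by simp, by simp [hb]⟩
    · have hb' : ((‖B p (J q')‖ : ℝ) : ℂ) ≠ 0 := by simpa using hb
      refine ⟨conj (Complex.I * (‖B p (J q')‖ : ℝ) / B p (J q')), ?_, ?_⟩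
      · rw [Complex.conj_conj, Complex.mul_conj']
        simp only [norm_div, norm_mul, Complex.norm_I, Complex.norm_real, norm_norm, one_mul]
        rw [div_self (norm_ne_zero_iff.mpr hb)]; simp
      · rw [Complex.conj_conj, div_mul_cancel₀ _ hb]
  have hpq := hpq'.smul_right hc
  obtain ⟨n, hn⟩ : ∃ n : ℝ, B p (J (c • q')) = Complex.I * n := by
    refine ⟨‖B p (J q')‖, ?_⟩
    rw [map_smulₛₗ, map_smul, smul_eq_mul]; exact hcb
  generalize c • q' = q at hpq hn
  have him : ∀ u : Fin 4 → ℂ, ∃ m : ℝ, B u (J u) = Complex.I * m := by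
    intro u
    have h1 := hreal u (J u)
    rw [J_J, map_neg, hsymm] at h1
    have h2 : (B u (J u)).re = 0 := by
      have := congrArg Complex.re h1
      simp at this; linarith
    exact ⟨(B u (J u)).im, by apply Complex.ext <;> simp [h2]⟩
  obtain ⟨m, hm⟩ := him p
  obtain ⟨k, hk⟩ := him q
  have hJpq : B (J p) q = Complex.I * n := by
    have h1 := hreal (J p) q
    rw [J_J, map_neg, LinearMap.neg_apply, hn] at h1
    have h2 := congrArg conj h1
    rw [Complex.conj_conj] at h2
    rw [← h2]; simp
  let v : Fin 4 → Fin 4 → ℂ := ![p, J p, q, J q]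
  let A : Matrix (Fin 4) (Fin 4) ℂ := Matrix.of fun i k => v k i
  have hA : ∀ z, A.mulVec z = z 0 • p + z 1 • J p + z 2 • q + z 3 • J q := by
    intro z
    ext i
    simp [A, v, Matrix.mulVec, dotProduct, Fin.sum_univ_four]; ring
  have hentry : A.transpose * Q * A = Complex.I • planarMatrix m n k := by
    have h1 : ∀ i l, (A.transpose * Q * A) i l = B (v i) (v l) := by
      intro i l
      rw [hBdef, Matrix.toBilin'_apply', mul_assoc]
      simp only [Matrix.mul_apply, Matrix.mulVec, dotProduct, Matrix.transpose_apply, A,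
        Matrix.of_apply]
    have hJJ : ∀ u w : Fin 4 → ℂ, B u w = 0 → B (J u) (J w) = 0 := fun u w h => by
      rw [hreal, h, map_zero]
    have hl := hpq.left
    have hr := hpq.right
    have hx := hpq.mixed
    have hx' : B q p = 0 := by rw [hsymm, hx]
    have hm' : B (J p) p = Complex.I * m := by rw [hsymm, hm]
    have hk' : B (J q) q = Complex.I * k := by rw [hsymm, hk]
    have hn' : B (J q) p = Complex.I * n := by rw [hsymm, hn]
    have hn'' : B q (J p) = Complex.I * n := by rw [hsymm, hJpq]
    ext i l
    rw [h1]
    fin_cases i <;> fin_cases l <;>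
      simp [v, planarMatrix, hl, hr, hx, hx', hm, hm', hk, hk', hn, hn', hn'', hJpq, hJJ p p hl,
        hJJ q q hr, hJJ p q hx, hJJ q p hx']
  have hK : ∀ w z, herm (A.mulVec w) (A.mulVec z) = 1 * herm w z := by
    intro w z
    have e1 : herm q p = 0 := by rw [← herm_conj, hpq.herm_mixed, map_zero]
    have e2 : herm (J q) p = 0 := by rw [herm_J_antisymm, hpq.herm_J, neg_zero]
    have e3 : herm p (J q) = 0 := by rw [herm_J_right, hpq.herm_J]; simp
    have e4 : herm q (J p) = 0 := by rw [herm_J_right, e2]; simp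
    rw [hA, hA]
    simp only [map_add, map_smulₛₗ, LinearMap.add_apply, LinearMap.smul_apply,
      smul_eq_mul, herm_J_J, herm_J_self, herm_self_J, hpq.herm_left, hpq.herm_right,
      hpq.herm_mixed, hpq.herm_J, e1, e2, e3, e4, map_zero, map_one, map_neg, RingHom.id_apply]
    rw [herm_apply]; ring
  have hI : (Complex.I • planarMatrix (m : ℂ) n k).det ≠ 0 := by
    rw [← hentry, Matrix.det_mul, Matrix.det_mul, Matrix.det_transpose]
    have : A.det ≠ 0 := det_ne_zero_of_herm one_ne_zero hK
    exact mul_ne_zero (mul_ne_zero this hdet) this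
  refine ⟨m, n, k, ?_, quadric_mem_orbit A Q _ (fun z => ?_) one_ne_zero hK fun z => ?_⟩
  · rw [Matrix.det_smul, planarMatrix_det] at hI
    intro h0
    apply hI
    have : (m : ℂ) * k - n ^ 2 = 0 := by exact_mod_cast h0
    rw [this]; simp
  · rw [hA, hA]
    simp only [map_add, map_smulₛₗ, J_J, J_apply_zero, J_apply_one, J_apply_two, J_apply_three]
    module
  · have h1 : A.mulVec z ⬝ᵥ Q.mulVec (A.mulVec z) =
        Complex.I * (z ⬝ᵥ (planarMatrix m n k).mulVec z) := by
      rw [← smul_eq_mul, ← dotProduct_smul, ← Matrix.smul_mulVec, ← hentry,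
        ← Matrix.mulVec_mulVec, ← Matrix.mulVec_mulVec, Matrix.dotProduct_mulVec z,
        Matrix.vecMul_transpose]
    rw [h1]; simp

/-! ### The Lorentz action on planar quadrics -/

/-- The planar quadrics in the coordinates `X = m + p`, `Y = 2 n`, `Z = m - p`, in which
the boosts and reflections below are Lorentz transformations of `-X² + Y² + Z²`. -/
def lorentzQuadric (X Y Z : ℝ) : Set CP3 :=
  quadric (planarMatrix (((X + Z) / 2 : ℝ) : ℂ) ((Y / 2 : ℝ) : ℂ) (((X - Z) / 2 : ℝ) : ℂ))

/-- Equivalence of quadrics under the symmetry group. -/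
local notation:50 S " ≈ᵍ " S' => S ∈ MulAction.orbit GjQ22 S'

theorem orbit_trans {S S' S'' : Set CP3} (h : S ≈ᵍ S') (h' : S' ≈ᵍ S'') : S ≈ᵍ S'' := by
  rw [← MulAction.orbit_eq_iff] at *
  exact h.trans h'

theorem lorentzQuadric_scale {t : ℝ} (ht : t ≠ 0) (X Y Z : ℝ) :
    lorentzQuadric (t * X) (t * Y) (t * Z) = lorentzQuadric X Y Z := by
  have hc : (t : ℂ) ≠ 0 := by exact_mod_cast ht
  rw [lorentzQuadric, lorentzQuadric,
    ← quadric_smul hc (planarMatrix (((X + Z) / 2 : ℝ) : ℂ) _ _)]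
  congr 1
  ext i l
  fin_cases i <;> fin_cases l <;> simp [planarMatrix] <;> ring

theorem lorentzQuadric_neg_Y (X Y Z : ℝ) : lorentzQuadric X Y Z ≈ᵍ lorentzQuadric X (-Y) Z := by
  let A : Matrix (Fin 4) (Fin 4) ℂ := !![1, 0, 0, 0; 0, 1, 0, 0; 0, 0, -1, 0; 0, 0, 0, -1]
  have hA : ∀ z, A.mulVec z = ![z 0, z 1, -z 2, -z 3] := fun z => by
    ext i; fin_cases i <;> simp [A, Matrix.mulVec, dotProduct, Fin.sum_univ_four]
  refine quadric_mem_orbit A _ _ (fun z => ?_) one_ne_zero (fun w z => ?_) fun z => ?_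
  · rw [hA, hA]; ext i; fin_cases i <;>
      simp [J_apply_zero, J_apply_one, J_apply_two, J_apply_three]
  · rw [hA, hA]; simp [herm_apply]
  · rw [hA, planarMatrix_form, planarMatrix_form]
    simp
    refine iff_of_eq (congrArg (· = 0) ?_)
    ring

theorem lorentzQuadric_neg_Z (X Y Z : ℝ) : lorentzQuadric X Y Z ≈ᵍ lorentzQuadric X Y (-Z) := by
  let A : Matrix (Fin 4) (Fin 4) ℂ := !![0, 0, 1, 0; 0, 0, 0, 1; 1, 0, 0, 0; 0, 1, 0, 0]
  have hA : ∀ z, A.mulVec z = ![z 2, z 3, z 0, z 1] := fun z => by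
    ext i; fin_cases i <;> simp [A, Matrix.mulVec, dotProduct, Fin.sum_univ_four]
  refine quadric_mem_orbit A _ _ (fun z => ?_) (κ := -1) (by norm_num) (fun w z => ?_) fun z => ?_
  · rw [hA, hA]; ext i; fin_cases i <;>
      simp [J_apply_zero, J_apply_one, J_apply_two, J_apply_three]
  · rw [hA, hA]; simp [herm_apply]; ring
  · rw [hA, planarMatrix_form, planarMatrix_form]
    simp
    refine iff_of_eq (congrArg (· = 0) ?_)
    ring

/-- For `Y = 0` the quadric `m z₀ z₁ + p z₂ z₃ = 0` is equivalent to the one with `-p` in place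
of `p`, although the Lorentzian square changes its sign. -/
theorem lorentzQuadric_swap (X Z : ℝ) : lorentzQuadric X 0 Z ≈ᵍ lorentzQuadric Z 0 X := by
  let A : Matrix (Fin 4) (Fin 4) ℂ := !![1, 0, 0, 0; 0, 1, 0, 0; 0, 0, 0, -1; 0, 0, 1, 0]
  have hA : ∀ z, A.mulVec z = ![z 0, z 1, -z 3, z 2] := fun z => by
    ext i; fin_cases i <;> simp [A, Matrix.mulVec, dotProduct, Fin.sum_univ_four]
  refine quadric_mem_orbit A _ _ (fun z => ?_) one_ne_zero (fun w z => ?_) fun z => ?_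
  · rw [hA, hA]; ext i; fin_cases i <;>
      simp [J_apply_zero, J_apply_one, J_apply_two, J_apply_three]
  · rw [hA, hA]; simp [herm_apply]; ring
  · rw [hA, planarMatrix_form, planarMatrix_form]
    simp
    refine iff_of_eq (congrArg (· = 0) ?_)
    ring

/-- The quaternionic boost with half the parameter acts on `(X, Y)` by a Lorentz boost. -/
theorem lorentzQuadric_boost {C S : ℝ} (hC : 0 < C) (hCS : C ^ 2 - S ^ 2 = 1) (X Y Z : ℝ) :
    lorentzQuadric X Y Z ≈ᵍ lorentzQuadric (C * X + S * Y) (S * X + C * Y) Z := by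
  -- half-parameter: `C = c² + s²`, `S = 2 c s`
  have hc2 : √((C + 1) / 2) ^ 2 = (C + 1) / 2 := Real.sq_sqrt (by linarith)
  have hc : 0 < √((C + 1) / 2) := Real.sqrt_pos.mpr (by linarith)
  generalize √((C + 1) / 2) = c at *
  obtain ⟨s, hs⟩ : ∃ s, S = 2 * c * s := ⟨S / (2 * c), by field_simp⟩
  have hC' : C = 2 * c ^ 2 - 1 := by linarith
  have hcs : c ^ 2 - s ^ 2 = 1 := by
    rw [hs, hC'] at hCS
    have h1 : c ^ 2 * (c ^ 2 - s ^ 2 - 1) = 0 := by linarith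
    have h2 := (mul_eq_zero.mp h1).resolve_left (by positivity)
    linarith
  have hcs' : (c : ℂ) ^ 2 - (s : ℂ) ^ 2 = 1 := by exact_mod_cast hcs
  let A : Matrix (Fin 4) (Fin 4) ℂ := !![c, 0, s, 0; 0, c, 0, s; s, 0, c, 0; 0, s, 0, c]
  have hA : ∀ z, A.mulVec z = ![c * z 0 + s * z 2, c * z 1 + s * z 3, s * z 0 + c * z 2,
      s * z 1 + c * z 3] := fun z => by
    ext i; fin_cases i <;> simp [A, Matrix.mulVec, dotProduct, Fin.sum_univ_four]
  refine quadric_mem_orbit A _ _ (fun z => ?_) one_ne_zero (fun w z => ?_) fun z => ?_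
  · rw [hA, hA]; ext i; fin_cases i <;>
      simp [J_apply_zero, J_apply_one, J_apply_two, J_apply_three] <;> ring
  · rw [hA, hA]; simp [herm_apply]
    linear_combination (conj (w 0) * z 0 + conj (w 1) * z 1 - conj (w 2) * z 2 -
      conj (w 3) * z 3) * hcs'
  · rw [hA, planarMatrix_form, planarMatrix_form]
    refine iff_of_eq (congrArg (· = 0) ?_)
    have hC2 : C = c ^ 2 + s ^ 2 := by linarith
    rw [hC2, hs]
    simp
    linear_combination (-(Z : ℂ) / 2 * (z 0 * z 1 - z 2 * z 3)) * hcs'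

theorem lorentzQuadric_flip (X Y Z : ℝ) : lorentzQuadric X Y Z ≈ᵍ lorentzQuadric (-X) (-Y) Z := by
  have h := lorentzQuadric_scale (t := -1) (by norm_num) X Y Z
  simp only [neg_one_mul] at h
  have h2 := lorentzQuadric_neg_Z (-X) (-Y) (-Z)
  rwa [neg_neg, h] at h2

/-- Two points on the same branch of a hyperbola `X² - Y² = k` differ by a boost. -/
theorem lorentzQuadric_of_hyperbola {X Y X' Y' k : ℝ} (Z : ℝ) (h : X ^ 2 - Y ^ 2 = k)
    (h' : X' ^ 2 - Y' ^ 2 = k) (hk : k ≠ 0) (hpos : 0 < (X * X' - Y * Y') / k) :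
    lorentzQuadric X Y Z ≈ᵍ lorentzQuadric X' Y' Z := by
  have hb := lorentzQuadric_boost (C := (X * X' - Y * Y') / k) (S := (X * Y' - Y * X') / k)
    hpos ?_ X Y Z
  · convert hb using 3
    · field_simp; rw [← h]; ring
    · field_simp; rw [← h]; ring
  · rw [div_pow, div_pow, ← sub_div, div_eq_one_iff_eq (pow_ne_zero 2 hk)]
    nth_rewrite 1 [sq k, ← h, ← h']
    ring

/-- Every nondegenerate planar quadric is equivalent to one of Lorentzian square `4`, even when the
given vector is timelike. -/
theorem exists_spacelike_representative {X Y Z : ℝ} (h : Z ^ 2 + Y ^ 2 - X ^ 2 ≠ 0) :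
    ∃ X' Y' Z' : ℝ, 0 ≤ Z' ∧ Z' ^ 2 + Y' ^ 2 - X' ^ 2 = 4 ∧
      lorentzQuadric X Y Z ≈ᵍ lorentzQuadric X' Y' Z' := by
  have key : ∀ X Y Z : ℝ, 0 < Z ^ 2 + Y ^ 2 - X ^ 2 →
      ∃ X' Y' Z' : ℝ, 0 ≤ Z' ∧ Z' ^ 2 + Y' ^ 2 - X' ^ 2 = 4 ∧
        lorentzQuadric X Y Z ≈ᵍ lorentzQuadric X' Y' Z' := by
    intro X Y Z hk
    have hr2 := Real.sq_sqrt hk.le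
    have hr := Real.sqrt_pos.mpr hk
    generalize √(Z ^ 2 + Y ^ 2 - X ^ 2) = r at hr2 hr
    have ht : 2 / r ≠ 0 := by positivity
    have hsc := lorentzQuadric_scale ht X Y Z
    have h4 : (2 / r * Z) ^ 2 + (2 / r * Y) ^ 2 - (2 / r * X) ^ 2 = 4 := by
      field_simp; linarith
    rcases le_total 0 (2 / r * Z) with hZ | hZ
    · exact ⟨_, _, _, hZ, h4, by rw [hsc]; exact MulAction.mem_orbit_self _⟩
    · refine ⟨2 / r * X, 2 / r * Y, -(2 / r * Z), by linarith, by linarith, ?_⟩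
      rw [← hsc]
      exact lorentzQuadric_neg_Z _ _ _
  rcases lt_or_gt_of_ne h with hk | hk
  · -- a timelike vector is boosted to `Y = 0`, where `X` and `Z` may be exchanged
    have hXY : 0 < X ^ 2 - Y ^ 2 := by nlinarith [sq_nonneg Z]
    have hr2 := Real.sq_sqrt hXY.le
    have hr := Real.sqrt_pos.mpr hXY
    generalize √(X ^ 2 - Y ^ 2) = r at hr2 hr
    have main : ∃ X₁ : ℝ, X₁ ^ 2 = r ^ 2 ∧ lorentzQuadric X Y Z ≈ᵍ lorentzQuadric X₁ 0 Z := by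
      have hX : X ≠ 0 := by rintro rfl; nlinarith [sq_nonneg Y]
      rcases lt_or_gt_of_ne hX with h0 | h0
      · refine ⟨-r, by ring, lorentzQuadric_of_hyperbola (k := r ^ 2) Z hr2.symm (by ring)
          (by positivity) ?_⟩
        refine div_pos ?_ (by positivity)
        nlinarith
      · refine ⟨r, rfl, lorentzQuadric_of_hyperbola (k := r ^ 2) Z hr2.symm (by ring)
          (by positivity) ?_⟩
        refine div_pos ?_ (by positivity)
        nlinarith
    obtain ⟨X₁, hX₁, h1⟩ := main
    obtain ⟨X', Y', Z', h2, h3, h4⟩ := key Z 0 X₁ (by rw [hX₁, hr2]; linarith)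
    exact ⟨X', Y', Z', h2, h3, orbit_trans h1 (orbit_trans (lorentzQuadric_swap _ _) h4)⟩
  · exact key X Y Z hk

theorem normalQuadric_eq_lorentzQuadric {s : ℝ} (hs : -1 ≤ s) :
    normalQuadric √(2 + 2 * s) = lorentzQuadric (2 + 2 * s) (-2 * √(2 + 2 * s)) (2 * s) := by
  have h : √(2 + 2 * s) ^ 2 = 2 + 2 * s := Real.sq_sqrt (by linarith)
  rw [normalQuadric, lorentzQuadric, h]
  congr 4 <;> ring

/-- Every nondegenerate planar quadric is equivalent to a normal form with signed inversive
distance `-1` or at least `0`. -/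
theorem lorentzQuadric_mem_orbit_normalQuadric {X Y Z : ℝ} (h : Z ^ 2 + Y ^ 2 - X ^ 2 ≠ 0) :
    ∃ s : ℝ, (s = -1 ∨ 0 ≤ s) ∧ lorentzQuadric X Y Z ≈ᵍ normalQuadric √(2 + 2 * s) := by
  obtain ⟨X, Y, Z, hZ, h4, hequiv⟩ := exists_spacelike_representative h
  suffices ∃ s : ℝ, (s = -1 ∨ 0 ≤ s) ∧ lorentzQuadric X Y Z ≈ᵍ normalQuadric √(2 + 2 * s) by
    obtain ⟨s, h1, h2⟩ := this
    exact ⟨s, h1, orbit_trans hequiv h2⟩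
  obtain ⟨s, rfl⟩ : ∃ s, Z = 2 * s := ⟨Z / 2, by ring⟩
  have hs : 0 ≤ s := by linarith
  have ha2 : √(2 + 2 * s) ^ 2 = 2 + 2 * s := Real.sq_sqrt (by linarith)
  have ha : 0 < √(2 + 2 * s) := Real.sqrt_pos.mpr (by linarith)
  rcases lt_trichotomy s 1 with h1 | rfl | h1
  · -- `s < 1`: a point of the hyperbola is on the branch of the normal form if `Y < 0`
    refine ⟨s, Or.inr hs, ?_⟩
    rw [normalQuadric_eq_lorentzQuadric (by linarith)]
    generalize √(2 + 2 * s) = a at *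
    have main : ∀ Y < 0, (2 * s) ^ 2 + Y ^ 2 - X ^ 2 = 4 →
        lorentzQuadric X Y (2 * s) ≈ᵍ lorentzQuadric (2 + 2 * s) (-2 * a) (2 * s) := by
      intro Y hY h4
      refine lorentzQuadric_of_hyperbola (k := 4 * s ^ 2 - 4) _ (by linarith) ?_ ?_ ?_
      · nlinarith
      · nlinarith
      · refine div_pos_of_neg_of_neg ?_ (by nlinarith)
        have e1 : X ^ 2 < Y ^ 2 := by nlinarith
        have e2 : |X| < -Y := by rw [← abs_of_neg hY]; exact sq_lt_sq.mp e1
        have e3 : 2 + 2 * s < 2 * a := by nlinarith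
        nlinarith [le_abs_self X, abs_nonneg X]
    have hY : Y ≠ 0 := by rintro rfl; nlinarith [sq_nonneg X]
    rcases lt_or_gt_of_ne hY with h0 | h0
    · exact main Y h0 h4
    · exact orbit_trans (lorentzQuadric_neg_Y _ _ _) (main (-Y) (by linarith) (by linarith))
  · -- `s = 1`: the hyperbola degenerates to two lines, and their intersection is the exceptional
    -- orbit `s = -1`
    by_cases hX : X = 0
    · subst hX
      have hY : Y = 0 := by nlinarith
      subst hY
      refine ⟨-1, Or.inl rfl, ?_⟩
      rw [normalQuadric_eq_lorentzQuadric le_rfl]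
      have h1 := lorentzQuadric_neg_Z 0 0 (2 * 1)
      norm_num at h1 ⊢
      exact h1
    · refine ⟨1, Or.inr zero_le_one, ?_⟩
      rw [normalQuadric_eq_lorentzQuadric (by norm_num)]
      have h2 : √(2 + 2 * 1) = 2 := by
        rw [show (2 : ℝ) + 2 * 1 = 2 ^ 2 by norm_num, Real.sqrt_sq (by norm_num)]
      rw [h2]
      have main : ∀ X : ℝ, 0 < X →
          lorentzQuadric X (-X) (2 * 1) ≈ᵍ lorentzQuadric (2 + 2 * 1) (-2 * 2) (2 * 1) := by
        intro X hX
        have hb := lorentzQuadric_boost (C := (4 / X + X / 4) / 2) (S := (X / 4 - 4 / X) / 2)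
          (by positivity) (by field_simp; ring) X (-X) (2 * 1)
        convert hb using 3
        · field_simp; ring
        · field_simp; ring
      have main' : ∀ X Y : ℝ, 0 < X → X ^ 2 = Y ^ 2 →
          lorentzQuadric X Y (2 * 1) ≈ᵍ lorentzQuadric (2 + 2 * 1) (-2 * 2) (2 * 1) := by
        intro X Y hX hXY
        rcases sq_eq_sq_iff_eq_or_eq_neg.mp hXY with rfl | h0
        · exact orbit_trans (lorentzQuadric_neg_Y _ _ _) (main _ hX)
        · rw [show Y = -X by linarith]; exact main X hX
      rcases lt_or_gt_of_ne hX with h0 | h0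
      · exact orbit_trans (lorentzQuadric_flip _ _ _)
          (main' _ _ (neg_pos.mpr h0) (by linarith))
      · exact main' _ _ h0 (by linarith)
  · -- `s > 1`: a point of the hyperbola is on the branch of the normal form if `X > 0`
    refine ⟨s, Or.inr hs, ?_⟩
    rw [normalQuadric_eq_lorentzQuadric (by linarith)]
    generalize √(2 + 2 * s) = a at *
    have main : ∀ X Y : ℝ, 0 < X → (2 * s) ^ 2 + Y ^ 2 - X ^ 2 = 4 →
        lorentzQuadric X Y (2 * s) ≈ᵍ lorentzQuadric (2 + 2 * s) (-2 * a) (2 * s) := by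
      intro X Y hX h4
      refine lorentzQuadric_of_hyperbola (k := 4 * s ^ 2 - 4) _ (by linarith) ?_ ?_ ?_
      · nlinarith
      · nlinarith
      · refine div_pos ?_ (by nlinarith)
        have e1 : Y ^ 2 < X ^ 2 := by nlinarith
        have e2 : |Y| < X := by rw [← abs_of_pos hX]; exact sq_lt_sq.mp e1
        have e3 : 2 * a < 2 + 2 * s := by nlinarith
        nlinarith [neg_abs_le Y, abs_nonneg Y]
    have hX : X ≠ 0 := by rintro rfl; nlinarith [sq_nonneg Y]
    rcases lt_or_gt_of_ne hX with h0 | h0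
    · exact orbit_trans (lorentzQuadric_flip _ _ _) (main _ _ (by linarith) (by linarith))
    · exact main X Y h0 h4

/-- The classification of smooth `j`-invariant quadrics up to symmetry. -/
theorem exists_normalQuadric_orbit {S : Set CP3} (hS : S ∈ smoothJInvariantQuadrics) :
    ∃ s : ℝ, (s = -1 ∨ 0 ≤ s) ∧ S ≈ᵍ normalQuadric √(2 + 2 * s) := by
  obtain ⟨m, n, p, hdet, hmem⟩ := exists_planar_orbit hS
  have h1 : quadric (planarMatrix m n p) = lorentzQuadric (m + p) (2 * n) (m - p) := by
    rw [lorentzQuadric]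
    congr 4 <;> ring
  obtain ⟨s, h2, h3⟩ := lorentzQuadric_mem_orbit_normalQuadric
    (X := m + p) (Y := 2 * n) (Z := m - p) (fun h => hdet (by linarith))
  exact ⟨s, h2, orbit_trans hmem (h1 ▸ h3)⟩

/-! ### Inversive distance of the normal forms -/

theorem planarPoint_mem_Sig (z : ℂ) : planarPoint z ∈ Sig ↔ ‖z‖ = 1 := by
  have hz : ‖(z : ℍ[ℝ])‖ = ‖z‖ := by
    have h1 := norm_quat z 0
    have h2 : quat z 0 = z := by simp [quat]
    rw [h2] at h1
    simpa using h1
  have hpos : 0 < 1 + ‖z‖ ^ 2 := by positivity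
  have h1 : ((planarPoint z : S4) : E5) 4 = (1 + ‖z‖ ^ 2)⁻¹ * (1 - ‖z‖ ^ 2) := by
    simp [planarPoint, hopf, hz]
  rw [Sig, Set.mem_ofPred_eq, h1, mul_eq_zero, or_iff_right (inv_ne_zero hpos.ne'), sub_eq_zero,
    eq_comm, pow_eq_one_iff_of_nonneg (norm_nonneg _) two_ne_zero]

theorem planarCircle_subset_Sig_iff {a : ℝ} (ha : 0 ≤ a) : planarCircle a 1 ⊆ Sig ↔ a = 0 := by
  rw [planarCircle, Set.image_subset_iff]
  constructor
  · intro h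
    have h1 : ((a + 1 : ℝ) : ℂ) ∈ Metric.sphere (a : ℂ) 1 := by simp
    have h2 := (planarPoint_mem_Sig _).mp (h h1)
    rw [Complex.norm_real, Real.norm_of_nonneg (by linarith)] at h2
    linarith
  · rintro rfl z hz
    exact (planarPoint_mem_Sig z).mpr (by simpa using hz)

theorem ConformallyEquivalent.subset_iff {D D' B B' : Set S4}
    (h : ConformallyEquivalent D B D' B') : D ⊆ B ↔ D' ⊆ B' := by
  obtain ⟨f, -, rfl, rfl⟩ := h
  exact (Set.image_subset_image_iff f.injective).symm

theorem conformallyEquivalent_of_mem_orbit {S S' : Set CP3} (h : S' ∈ MulAction.orbit GjQ22 S) :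
    ConformallyEquivalent (discriminant S) Sig (discriminant S') Sig := by
  obtain ⟨g, rfl⟩ := h
  exact conformallyEquivalent_smul g S

theorem conformallyEquivalent_planarCircle {S : Set CP3} {a : ℝ}
    (h : S ∈ MulAction.orbit GjQ22 (normalQuadric a)) :
    ConformallyEquivalent (discriminant S) Sig (planarCircle a 1) Sig := by
  rw [← discriminant_normalQuadric]
  exact (conformallyEquivalent_of_mem_orbit h).symm

/-- The parameter `s` of the normal forms is a signed inversive distance. -/
theorem inversive_normal {s : ℝ} (hs : s = -1 ∨ 0 ≤ s) :
    |√(2 + 2 * s) ^ 2 - 1 ^ 2 - 1| / (2 * 1) = |s| := by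
  have h1 : -1 ≤ s := by rcases hs with rfl | h <;> linarith
  rw [Real.sq_sqrt (by linarith), show 2 + 2 * s - 1 ^ 2 - 1 = 2 * s by ring, abs_mul]
  norm_num

theorem inversiveValues_eq {S : Set CP3} {s : ℝ} (hs : s = -1 ∨ 0 ≤ s)
    (h : S ∈ MulAction.orbit GjQ22 (normalQuadric √(2 + 2 * s))) :
    inversiveValues (discriminant S) Sig = {|s|} := by
  have h1 := conformallyEquivalent_planarCircle h
  ext t
  rw [Set.mem_singleton_iff]
  constructor
  · rintro ⟨a, r, -, hr, h2, rfl⟩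
    rw [← inversive_normal hs]
    exact inversive_eq_of_conformal hr one_pos (h2.symm.trans h1)
  · rintro rfl
    exact ⟨_, 1, Real.sqrt_nonneg _, one_pos, h1, (inversive_normal hs).symm⟩

theorem inversiveDistance_eq {S : Set CP3} {s : ℝ} (hs : s = -1 ∨ 0 ≤ s)
    (h : S ∈ MulAction.orbit GjQ22 (normalQuadric √(2 + 2 * s))) :
    inversiveDistance (discriminant S) Sig = |s| := by
  rw [inversiveDistance, inversiveValues_eq hs h, csInf_singleton]

theorem discriminant_subset_Sig_iff {S : Set CP3} {s : ℝ} (hs : s = -1 ∨ 0 ≤ s)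
    (h : S ∈ MulAction.orbit GjQ22 (normalQuadric √(2 + 2 * s))) :
    discriminant S ⊆ Sig ↔ s = -1 := by
  rw [(conformallyEquivalent_planarCircle h).subset_iff,
    planarCircle_subset_Sig_iff (Real.sqrt_nonneg _)]
  have h1 : -1 ≤ s := by rcases hs with rfl | h <;> linarith
  rw [Real.sqrt_eq_zero (by linarith)]
  constructor <;> intro <;> linarith

theorem mem_orbit_of_same_normal {S S' N : Set CP3} (h : S ∈ MulAction.orbit GjQ22 N)
    (h' : S' ∈ MulAction.orbit GjQ22 N) : S' ∈ MulAction.orbit GjQ22 S := by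
  rw [← MulAction.orbit_eq_iff] at *
  exact h'.trans h.symm

end

end TwistorQuadrics

theorem mainTheorem7 :
    -- two quadrics are equivalent iff the pairs (circle, 3-sphere) are conformally equivalent
    (∀ S ∈ smoothJInvariantQuadrics, ∀ S' ∈ smoothJInvariantQuadrics,
      S' ∈ MulAction.orbit GjQ22 S ↔
        ConformallyEquivalent (discriminant S) Sig (discriminant S') Sig) ∧
    -- the quadrics with discriminant circle in the 3-sphere form one orbit
    (∃ S₀ : Set CP3,
      {S | S ∈ smoothJInvariantQuadrics ∧ discriminant S ⊆ Sig} = MulAction.orbit GjQ22 S₀) ∧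
    -- the inversive distance is defined, independently of the normalization
    (∀ S ∈ smoothJInvariantQuadrics,
      inversiveValues (discriminant S) Sig = {inversiveDistance (discriminant S) Sig}) ∧
    -- off the contained case, it separates the orbits
    (∀ S ∈ smoothJInvariantQuadrics, ∀ S' ∈ smoothJInvariantQuadrics,
      ¬ discriminant S ⊆ Sig → ¬ discriminant S' ⊆ Sig →
        (S' ∈ MulAction.orbit GjQ22 S ↔
          inversiveDistance (discriminant S) Sig = inversiveDistance (discriminant S') Sig)) ∧
    -- and takes exactly the values in [0, ∞)
    (fun S : Set CP3 => inversiveDistance (discriminant S) Sig) ''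
      {S | S ∈ smoothJInvariantQuadrics ∧ ¬ discriminant S ⊆ Sig} = Set.Ici (0 : ℝ) := by
  refine ⟨fun S hS S' hS' => ⟨conformallyEquivalent_of_mem_orbit, fun h => ?_⟩,
    ⟨normalQuadric 0, ?_⟩, fun S hS => ?_, fun S hS S' hS' hD hD' => ?_, ?_⟩
  · obtain ⟨s, hs, hmem⟩ := exists_normalQuadric_orbit hS
    obtain ⟨s', hs', hmem'⟩ := exists_normalQuadric_orbit hS'
    have h1 := (conformallyEquivalent_planarCircle hmem).symm.trans
      (h.trans (conformallyEquivalent_planarCircle hmem'))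
    have h2 := inversive_eq_of_conformal one_pos one_pos h1
    rw [inversive_normal hs, inversive_normal hs'] at h2
    have h3 : s = -1 ↔ s' = -1 := by
      rw [← discriminant_subset_Sig_iff hs hmem, ← discriminant_subset_Sig_iff hs' hmem',
        h.subset_iff]
    have h4 : s = s' := by
      rcases hs with rfl | hs
      · exact (h3.mp rfl).symm
      · rcases hs' with rfl | hs'
        · exact h3.mpr rfl
        · rwa [abs_of_nonneg hs, abs_of_nonneg hs'] at h2
    subst h4
    exact mem_orbit_of_same_normal hmem hmem'
  · have h0 : normalQuadric 0 = normalQuadric √(2 + 2 * (-1)) := by norm_num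
    rw [h0]
    ext S
    constructor
    · rintro ⟨hS, hD⟩
      obtain ⟨s, hs, hmem⟩ := exists_normalQuadric_orbit hS
      rwa [(discriminant_subset_Sig_iff hs hmem).mp hD] at hmem
    · intro hS
      refine ⟨?_, (discriminant_subset_Sig_iff (Or.inl rfl) hS).mpr rfl⟩
      obtain ⟨g, rfl⟩ := hS
      exact smul_mem_smooth g (normalQuadric_mem_smooth _)
  · obtain ⟨s, hs, hmem⟩ := exists_normalQuadric_orbit hS
    rw [inversiveDistance_eq hs hmem, inversiveValues_eq hs hmem]
  · obtain ⟨s, hs, hmem⟩ := exists_normalQuadric_orbit hS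
    obtain ⟨s', hs', hmem'⟩ := exists_normalQuadric_orbit hS'
    rw [discriminant_subset_Sig_iff hs hmem] at hD
    rw [discriminant_subset_Sig_iff hs' hmem'] at hD'
    constructor
    · intro h
      have h1 : S' ∈ MulAction.orbit GjQ22 (normalQuadric √(2 + 2 * s)) := by
        rwa [← MulAction.orbit_eq_iff.mpr hmem]
      rw [inversiveDistance_eq hs hmem, inversiveDistance_eq hs h1]
    · intro h
      rw [inversiveDistance_eq hs hmem, inversiveDistance_eq hs' hmem',
        abs_of_nonneg (hs.resolve_left hD), abs_of_nonneg (hs'.resolve_left hD')] at h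
      subst h
      exact mem_orbit_of_same_normal hmem hmem'
  · ext t
    rw [Set.mem_image, Set.mem_Ici]
    constructor
    · rintro ⟨S, ⟨hS, -⟩, rfl⟩
      obtain ⟨s, hs, hmem⟩ := exists_normalQuadric_orbit hS
      change 0 ≤ inversiveDistance (discriminant S) Sig
      rw [inversiveDistance_eq hs hmem]
      exact abs_nonneg s
    · intro ht
      have hself := MulAction.mem_orbit_self (M := GjQ22) (normalQuadric √(2 + 2 * t))
      refine ⟨_, ⟨normalQuadric_mem_smooth √(2 + 2 * t), ?_⟩, ?_⟩
      · rw [discriminant_subset_Sig_iff (Or.inr ht) hself]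
        linarith
      · exact (inversiveDistance_eq (Or.inr ht) hself).trans (abs_of_nonneg ht)
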